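/- Let $F$ be a non-archimedean local field, let $k$ be an algebraically closed field of prime characteristic $\ell$ different from the residue characteristic of $F$, and let $\psi : F \to W(k)^\times$ be a nontrivial locally constant additive character, where $W(k)$ is the ring of ($\ell$-typical) Witt vectors. Let $A$ be a commutative Noetherian $W(k)$-algebra and let $\psi_A : F \to A^\times$ be the character induced by $\psi$. Let $n \ge 1$, $G = \mathrm{GL}_n(F)$, let $P \subset G$ be the mirabolic subgroup of matrices with last row $(0,\dots,0,1)$, and let $N \subset P$ be the subgroup of upper triangular unipotent matrices, with the character $\psi_A(u) = \psi_A(u_{1,2} + \dots + u_{n-1,n})$. For an $A[P]$-module $M$ (for instance the restriction to $P$ of an $A[G]$-module) write $M^{(n)} = M / \langle um - \psi_A(u)m : u \in N, m \in M\rangle_A$ for its highest derivative. An $A[G]$-module $V$ is of Whittaker type if it is admissible (that is, every vector is fixed by an open subgroup, and $V^K$ is a finitely generated $A$-module for every compact open subgroup $K$ of $G$), finitely generated over $A[G]$, and $V^{(n)} \cong A$ as an $A$-module. For such $V$, its Whittaker space $\mathcal{W}(V,\psi_A) \subset \mathrm{Ind}_N^G \psi_A$ is the image of $V$ under $v \mapsto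 (g \mapsto e([gv]))$, where $e : V^{(n)} \to A$ is any isomorphism of $A$-modules. Let $\mathrm{ind}_N^P \psi_A$ denote the compactly induced $A[P]$-module. Let $V$ be an $A[G]$-module of Whittaker type. Then: 1. The natural map $A \to \mathrm{End}_{A[G]}(\mathcal{W}(V,\psi_A))$ is an isomorphism. 2. There is exactly one $A[P]$-submodule $\mathcal{S}(V,\psi_A)$ of $\mathcal{W}(V,\psi_A)$ that is the image of an injective $A[P]$-homomorphism $\mathrm{ind}_N^P \psi_A \to \mathcal{W}(V,\psi_A)$ inducing an isomorphism on highest derivatives (the Schwartz functions). Every $A[G]$-endomorphism of $\mathcal{W}(V,\psi_A)$ preserves $\mathcal{S}(V,\psi_A)$, and restriction defines an isomorphism of $A$-algebras $$\mathrm{End}_{A[G]}(\mathcal{W}(V,\psi_A)) \to \mathrm{End}_{A[P]}(\mathcal{S}(V,\psi_A)).$$ -/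

import Mathlib

/-! ### Smooth representations and induction

Throughout, an `A[G]`-module is a `Representation A G V`, i.e. an `A`-module `V` with an
`A`-linear action of `G`. -/

namespace WhittakerFamily

section General

variable {A : Type*} [CommRing A] {G : Type*} [Group G]

variable (A G) in
/-- The action of `G` by right translation on functions `G → A`: `(g • f) x = f (x * g)`. -/
def rightTranslation : Representation A G (G → A) where
  toFun g :=
    { toFun := fun f x => f (x * g)
      map_add' := fun _ _ => rfl
      map_smul' := fun _ _ => rfl }
  map_one' := by ext; simp
  map_mul' g h := by
    refine LinearMap.ext fun f => funext fun x => ?_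
    simp [mul_assoc]

@[simp] theorem rightTranslation_apply (g : G) (f : G → A) (x : G) :
    rightTranslation A G g f x = f (x * g) := rfl

/-- The submodule of `V` spanned by the vectors `h v - χ(h) v` for `h` in `H`. -/
def twistedKernel {V : Type*} [AddCommGroup V] [Module A V] (ρ : Representation A G V)
    (H : Subgroup G) (χ : H →* A) : Submodule A V :=
  Submodule.span A {w | ∃ (h : H) (v : V), w = ρ h v - χ h • v}

/-- The twisted coinvariants `V_{H,χ}`: the largest quotient of `V` on which `H` acts by `χ`. -/
abbrev TwistedCoinvariants {V : Type*} [AddCommGroup V] [Module A V] (ρ : Representation A G V)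
    (H : Subgroup G) (χ : H →* A) : Type _ :=
  V ⧸ twistedKernel ρ H χ

/-- The map `V_{H,χ} → V'_{H,χ}` induced by a `G`-equivariant map `V → V'`. -/
def TwistedCoinvariants.map {V V' : Type*} [AddCommGroup V] [Module A V]
    [AddCommGroup V'] [Module A V'] {ρ : Representation A G V} {ρ' : Representation A G V'}
    (H : Subgroup G) (χ : H →* A) (f : ρ.IntertwiningMap ρ') :
    TwistedCoinvariants ρ H χ →ₗ[A] TwistedCoinvariants ρ' H χ :=
  Submodule.mapQ _ _ f.toLinearMap <| by
    refine Submodule.span_le.mpr ?_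
    rintro _ ⟨h, v, rfl⟩
    refine Submodule.subset_span ⟨h, f v, ?_⟩
    have := f.isIntertwining' (h : G)
    simpa using LinearMap.congr_fun this v

section Topology

variable [TopologicalSpace G]

/-- An `A[G]`-module is smooth if every vector is fixed by an open subgroup. -/
def IsSmooth {V : Type*} [AddCommGroup V] [Module A V] (ρ : Representation A G V) : Prop :=
  ∀ v : V, ∃ K : Subgroup G, IsOpen (K : Set G) ∧ ∀ g ∈ K, ρ g v = v

/-- An `A[G]`-module is admissible if it is smooth and its `K`-invariants are finitely generated
over `A` for every compact open subgroup `K`. -/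
structure IsAdmissible {V : Type*} [AddCommGroup V] [Module A V] (ρ : Representation A G V) :
    Prop where
  smooth : IsSmooth ρ
  fg_invariants : ∀ K : Subgroup G, IsOpen (K : Set G) → IsCompact (K : Set G) →
    (Representation.invariants (ρ.comp K.subtype)).FG

variable [IsTopologicalGroup G]

/-- The smooth induction `Ind_H^G χ` of a character `χ` of `H`: functions `f` with
`f (h x) = χ h * f x` that are right invariant under some open subgroup. -/
def smoothInd (H : Subgroup G) (χ : H →* A) : Subrepresentation (rightTranslation A G) where
  toSubmodule :=
    { carrier := {f | (∀ (h : H) (x : G), f (h * x) = χ h * f x) ∧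
        ∃ K : Subgroup G, IsOpen (K : Set G) ∧ ∀ g ∈ K, ∀ x, f (x * g) = f x}
      zero_mem' := ⟨fun _ _ => by simp, ⊤, by simp, fun _ _ _ => rfl⟩
      add_mem' := by
        rintro a b ⟨ha, K, hK, hKa⟩ ⟨hb, L, hL, hLb⟩
        refine ⟨fun h x => by simp [ha, hb, mul_add], K ⊓ L, hK.inter hL, fun g hg x => ?_⟩
        simp [hKa g hg.1, hLb g hg.2]
      smul_mem' := by
        rintro c a ⟨ha, K, hK, hKa⟩
        refine ⟨fun h x => by simp [ha, mul_left_comm], K, hK, fun g hg x => ?_⟩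
        simp [hKa g hg] }
  apply_mem_toSubmodule := by
    rintro g f ⟨hf, K, hK, hKf⟩
    refine ⟨fun h x => by simp [hf, mul_assoc],
      K.comap (MulAut.conj g⁻¹).toMonoidHom, ?_, fun y hy x => ?_⟩
    · refine hK.preimage (f := fun y => (MulAut.conj g⁻¹) y) ?_
      simp only [MulAut.conj_apply]
      fun_prop
    · have := hKf _ hy (x * g)
      simpa [mul_assoc] using this

/-- The compact induction `ind_H^G χ` of a character `χ` of `H`: the functions in `Ind_H^G χ`
whose support is compact modulo `H`. -/
def compactInd (H : Subgroup G) (χ : H →* A) : Subrepresentation (rightTranslation A G) where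
  toSubmodule :=
    { carrier := {f | f ∈ smoothInd H χ ∧
        ∃ C : Set G, IsCompact C ∧ ∀ x, f x ≠ 0 → ∃ h ∈ H, ∃ c ∈ C, x = h * c}
      zero_mem' := ⟨(smoothInd H χ).toSubmodule.zero_mem, ∅, isCompact_empty, by simp⟩
      add_mem' := by
        rintro a b ⟨ha, C, hC, hCa⟩ ⟨hb, D, hD, hDb⟩
        refine ⟨(smoothInd H χ).toSubmodule.add_mem ha hb, C ∪ D, hC.union hD, fun x hx => ?_⟩
        by_cases h : a x = 0
        · obtain ⟨y, hy, c, hc, e⟩ := hDb x (by rintro h'; simp [h, h'] at hx)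
          exact ⟨y, hy, c, .inr hc, e⟩
        · obtain ⟨y, hy, c, hc, e⟩ := hCa x h
          exact ⟨y, hy, c, .inl hc, e⟩
      smul_mem' := by
        rintro c a ⟨ha, C, hC, hCa⟩
        refine ⟨(smoothInd H χ).toSubmodule.smul_mem c ha, C, hC, fun x hx => hCa x ?_⟩
        rintro h
        simp [h] at hx }
  apply_mem_toSubmodule := by
    rintro g f ⟨hf, C, hC, hCf⟩
    refine ⟨(smoothInd H χ).apply_mem_toSubmodule g hf, (fun c => c * g⁻¹) '' C,
      hC.image (by fun_prop), fun x hx => ?_⟩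
    obtain ⟨h, hh, c, hc, e⟩ := hCf (x * g) hx
    exact ⟨h, hh, c * g⁻¹, ⟨c, hc, rfl⟩, by rw [← mul_assoc, ← e]; simp⟩

end Topology

end General

/-! ### The groups `G_n ⊇ P_n ⊇ N_n` and the character `ψ` of `N_n` -/

section Groups

open Matrix

/-- The mirabolic subgroup `P_n` of `GL_n(F)`: matrices with last row `(0, …, 0, 1)`. -/
def mirabolic (n : ℕ) (F : Type*) [Field F] : Subgroup (GL (Fin n) F) where
  carrier := {g | ∀ i j : Fin n, (i : ℕ) + 1 = n →
    (g : Matrix (Fin n) (Fin n) F) i j = (1 : Matrix (Fin n) (Fin n) F) i j}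
  one_mem' := fun _ _ _ => rfl
  mul_mem' := by
    intro a b ha hb i j hi
    simp [Matrix.mul_apply, ha i _ hi, Matrix.one_apply, hb i _ hi]
  inv_mem' := by
    intro a ha i j hi
    have h : ((a : Matrix (Fin n) (Fin n) F) * (a⁻¹ : GL (Fin n) F)) i j =
        (1 : Matrix (Fin n) (Fin n) F) i j := by rw [← Units.val_mul]; simp
    simpa [Matrix.mul_apply, ha i _ hi, Matrix.one_apply] using h

/-- The subgroup `N_n` of upper triangular unipotent matrices of `GL_n(F)`. -/
def unipotent (n : ℕ) (F : Type*) [Field F] : Subgroup (GL (Fin n) F) where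
  carrier := {g | ∀ i j : Fin n, j ≤ i →
    (g : Matrix (Fin n) (Fin n) F) i j = (1 : Matrix (Fin n) (Fin n) F) i j}
  one_mem' := fun _ _ _ => rfl
  mul_mem' := by
    intro a b ha hb i j hij
    simp only [Units.val_mul, Matrix.mul_apply]
    rw [Finset.sum_eq_single i]
    · rw [ha i i le_rfl, hb i j hij]; simp
    · intro m _ hm
      rcases lt_or_gt_of_ne hm with h | h
      · rw [ha i m h.le]; simp [h.ne']
      · rw [hb m j (hij.trans h.le)]; simp [(hij.trans_lt h).ne']
    · simp
  inv_mem' := by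
    intro a ha
    have hT : (a : Matrix (Fin n) (Fin n) F).BlockTriangular id := by
      intro i j hij
      rw [ha i j (le_of_lt hij)]
      exact Matrix.one_apply_ne (ne_of_gt hij)
    have : Invertible (a : Matrix (Fin n) (Fin n) F) := a.invertible
    have hT' := Matrix.blockTriangular_inv_of_blockTriangular hT
    rw [← Matrix.coe_units_inv] at hT'
    intro i j hij
    rcases hij.lt_or_eq with h | rfl
    · rw [hT' h, Matrix.one_apply_ne h.ne']
    · have h : ((a : Matrix (Fin n) (Fin n) F) * (a⁻¹ : GL (Fin n) F)) j j =
          (1 : Matrix (Fin n) (Fin n) F) j j := by rw [← Units.val_mul]; simp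
      rw [Matrix.mul_apply, Finset.sum_eq_single j] at h
      · simpa [ha j j le_rfl] using h
      · intro m _ hm
        rcases lt_or_gt_of_ne hm with h | h
        · rw [ha j m h.le]; simp [h.ne']
        · rw [hT' h]; simp
      · simp

/-- The subgroup `N_n` lies in `P_n`. -/
theorem unipotent_le_mirabolic (n : ℕ) (F : Type*) [Field F] :
    unipotent n F ≤ mirabolic n F :=
  fun _ hg i j hi => hg i j (by have := j.2; exact Fin.le_def.mpr (by omega))

/-- The sum `u_{1,2} + u_{2,3} + ⋯ + u_{n-1,n}` of the entries above the diagonal. -/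
def superdiagonalSum {n : ℕ} {F : Type*} [Field F] (u : Matrix (Fin n) (Fin n) F) : F :=
  ∑ i : Fin n, if h : (i : ℕ) + 1 < n then u i ⟨i + 1, h⟩ else 0

theorem superdiagonalSum_mul {n : ℕ} {F : Type*} [Field F] (a b : unipotent n F) :
    superdiagonalSum ((a * b : unipotent n F) : GL (Fin n) F).val =
      superdiagonalSum (a : GL (Fin n) F).val + superdiagonalSum (b : GL (Fin n) F).val := by
  rw [superdiagonalSum, superdiagonalSum, superdiagonalSum, ← Finset.sum_add_distrib]
  refine Finset.sum_congr rfl fun i _ => ?_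
  split_ifs with h
  · have ha := a.2
    have hb := b.2
    have hne : i ≠ ⟨i + 1, h⟩ := fun e => by have := congrArg Fin.val e; simp at this
    rw [Subgroup.coe_mul, Units.val_mul, Matrix.mul_apply,
      Finset.sum_eq_add i ⟨i + 1, h⟩ hne]
    · rw [ha i i le_rfl, hb ⟨i + 1, h⟩ ⟨i + 1, h⟩ le_rfl]
      simp [add_comm]
    · rintro m - ⟨h1, h2⟩
      rcases lt_or_gt_of_ne h1 with h' | h'
      · rw [ha i m h'.le]; simp [h1.symm]
      · rw [hb m ⟨i + 1, h⟩ (Fin.le_def.mpr h'), Matrix.one_apply_ne h2, mul_zero]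
    · simp
    · simp
  · simp

/-- The character `u ↦ ψ(u_{1,2} + ⋯ + u_{n-1,n})` of `N_n` attached to an additive
character `ψ` of `F`. -/
def genericChar {n : ℕ} {F : Type*} [Field F] {A : Type*} [CommRing A] (ψ : AddChar F A) :
    unipotent n F →* A where
  toFun u := ψ (superdiagonalSum (u : GL (Fin n) F).val)
  map_one' := by
    have : superdiagonalSum ((1 : unipotent n F) : GL (Fin n) F).val = 0 := by
      have := superdiagonalSum_mul (1 : unipotent n F) 1
      simpa using this
    rw [this]; simp
  map_mul' a b := by rw [superdiagonalSum_mul, AddChar.map_add_eq_mul]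

/-- The character `ψ_A` with values in an `R`-algebra `A` induced by a character `ψ` with
values in `R`. -/
def extendScalars {F R : Type*} [Field F] [CommRing R] (A : Type*) [CommRing A] [Algebra R A]
    (ψ : AddChar F R) : AddChar F A :=
  (algebraMap R A : R →* A).compAddChar ψ

variable (n : ℕ) (F : Type*) [Field F]

/-- `N_n` as a subgroup of `P_n`. -/
abbrev unipotentInMirabolic : Subgroup (mirabolic n F) :=
  (unipotent n F).comap (mirabolic n F).subtype

variable {n F}

/-- The character `u ↦ ψ(u_{1,2} + ⋯ + u_{n-1,n})` on `N_n` as a subgroup of `P_n`. -/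
def genericCharMirabolic {A : Type*} [CommRing A] (ψ : AddChar F A) :
    unipotentInMirabolic n F →* A :=
  (genericChar ψ).comp ((mirabolic n F).subtype.subgroupComap (unipotent n F))

end Groups

/-! ### Highest derivatives, Whittaker spaces and Schwartz functions -/

section Whittaker

open Matrix

variable {n : ℕ} {F : Type*} [Field F] {A : Type*} [CommRing A]
variable {V : Type*} [AddCommGroup V] [Module A V]

/-- The restriction of an `A[G_n]`-module to `P_n`. -/
abbrev resMirabolic (ρ : Representation A (GL (Fin n) F) V) :
    Representation A (mirabolic n F) V :=
  ρ.comp (mirabolic n F).subtype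

/-- The highest (`n`-th) derivative `M^{(n)} = M_{N_n,ψ}` of an `A[P_n]`-module `M`. -/
abbrev TopDerivative (τ : Representation A (mirabolic n F) V) (ψ : AddChar F A) : Type _ :=
  TwistedCoinvariants τ (unipotentInMirabolic n F) (genericCharMirabolic ψ)

/-- The class in `V^{(n)}` of a vector of an `A[G_n]`-module `V`. -/
abbrev toTopDerivative (ρ : Representation A (GL (Fin n) F) V) (ψ : AddChar F A) :
    V →ₗ[A] TopDerivative (resMirabolic ρ) ψ :=
  Submodule.mkQ _

/-- The `A`-linear map `v ↦ (g ↦ e [g v])` from `V` to functions on `G_n` attached to an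
isomorphism `e : V^{(n)} ≃ A`; it is the `G_n`-equivariant map `V → Ind_{N_n}^{G_n} ψ`
corresponding to `e` under Frobenius reciprocity. -/
def whittakerMap (ρ : Representation A (GL (Fin n) F) V) (ψ : AddChar F A)
    (e : TopDerivative (resMirabolic ρ) ψ ≃ₗ[A] A) : V →ₗ[A] (GL (Fin n) F → A) where
  toFun v g := e (toTopDerivative ρ ψ (ρ g v))
  map_add' v w := funext fun g => by simp only [map_add, Pi.add_apply]
  map_smul' a v := funext fun g => by simp only [map_smul, Pi.smul_apply, RingHom.id_apply]

/-- The Whittaker space of `V`: the image of `V` in `Ind_{N_n}^{G_n} ψ` under the map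
corresponding to an isomorphism `e : V^{(n)} ≃ A`. -/
def whittakerSpace (ρ : Representation A (GL (Fin n) F) V) (ψ : AddChar F A)
    (e : TopDerivative (resMirabolic ρ) ψ ≃ₗ[A] A) :
    Subrepresentation (rightTranslation A (GL (Fin n) F)) where
  toSubmodule := LinearMap.range (whittakerMap ρ ψ e)
  apply_mem_toSubmodule := by
    rintro g _ ⟨v, rfl⟩
    refine ⟨ρ g v, funext fun x => ?_⟩
    change e (toTopDerivative ρ ψ (ρ x (ρ g v))) = e (toTopDerivative ρ ψ (ρ (x * g) v))
    rw [map_mul]; rfl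

/-- The Whittaker space of `V` as an `A[G_n]`-module. -/
abbrev whittakerRep (ρ : Representation A (GL (Fin n) F) V) (ψ : AddChar F A)
    (e : TopDerivative (resMirabolic ρ) ψ ≃ₗ[A] A) :
    Representation A (GL (Fin n) F) (whittakerSpace ρ ψ e).toSubmodule :=
  (whittakerSpace ρ ψ e).toRepresentation

section Topology

variable [TopologicalSpace F] [IsTopologicalRing F]

/-- An `A[G_n]`-module is of Whittaker type (with respect to `ψ`) if it is admissible, finitely
generated over `A[G_n]`, and `V^{(n)}` is isomorphic to `A` as an `A`-module. -/
structure IsWhittakerType (ρ : Representation A (GL (Fin n) F) V) (ψ : AddChar F A) : Prop where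
  admissible : IsAdmissible ρ
  finite : Module.Finite (MonoidAlgebra A (GL (Fin n) F)) ρ.asModule
  topDerivative : Nonempty (TopDerivative (resMirabolic ρ) ψ ≃ₗ[A] A)

/-- The Whittaker space of a smooth module consists of functions in `Ind_{N_n}^{G_n} ψ`. -/
theorem whittakerSpace_le_smoothInd (ρ : Representation A (GL (Fin n) F) V) (hρ : IsSmooth ρ)
    (ψ : AddChar F A) (e : TopDerivative (resMirabolic ρ) ψ ≃ₗ[A] A) :
    whittakerSpace ρ ψ e ≤ smoothInd (unipotent n F) (genericChar ψ) := by
  rintro _ ⟨v, rfl⟩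
  refine ⟨fun u x => ?_, ?_⟩
  · let u' : unipotentInMirabolic n F := ⟨⟨u, unipotent_le_mirabolic n F u.2⟩, u.2⟩
    have h : toTopDerivative ρ ψ (ρ u (ρ x v)) =
        genericChar ψ u • toTopDerivative ρ ψ (ρ x v) := by
      rw [← map_smul, ← sub_eq_zero, ← map_sub]
      exact (Submodule.Quotient.mk_eq_zero _).mpr (Submodule.subset_span ⟨u', ρ x v, rfl⟩)
    have h' := congrArg e h
    rw [map_smul] at h'
    change e (toTopDerivative ρ ψ (ρ (u * x) v)) = _
    rw [map_mul]
    exact h'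
  · obtain ⟨K, hK, hKv⟩ := hρ v
    refine ⟨K, hK, fun g hg x => ?_⟩
    change e (toTopDerivative ρ ψ (ρ (x * g) v)) = e (toTopDerivative ρ ψ (ρ x v))
    rw [map_mul, Module.End.mul_apply, hKv g hg]

variable (n) in
/-- The `A[P_n]`-module `(Φ⁺)^{n-1} Ψ⁺ (1_A) = ind_{N_n}^{P_n} ψ`. -/
abbrev gelfandGraev (ψ : AddChar F A) : Subrepresentation (rightTranslation A (mirabolic n F)) :=
  compactInd (unipotentInMirabolic n F) (genericCharMirabolic ψ)

/-- `S` is the space of Schwartz functions of an `A[P_n]`-module `M` with `M^{(n)} ≅ A`: the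
image of the embedding `(Φ⁺)^{n-1} Ψ⁺ (1_A) = ind_{N_n}^{P_n} ψ → M`, that is, of a
`P_n`-equivariant embedding inducing an isomorphism on highest derivatives. -/
def IsSchwartzSpace {τ : Representation A (mirabolic n F) V} (ψ : AddChar F A)
    (S : Subrepresentation τ) : Prop :=
  ∃ ι : (gelfandGraev n ψ).toRepresentation.IntertwiningMap τ,
    Function.Injective ι ∧
    Function.Bijective (TwistedCoinvariants.map (unipotentInMirabolic n F)
      (genericCharMirabolic ψ) ι) ∧
    ι.range = S

end Topology

end Whittaker

end WhittakerFamily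

/-!
Write `P`, `N` for the mirabolic and the unipotent group and `χ` for the generic character of `N`.
The proof rests on two facts about the Gelfand-Graev representation `ind_N^P χ`: evaluation at `1`
identifies its highest derivative with `A`, and it represents the highest derivative on smooth
`A[P]`-modules `M`, that is, `Hom_P(ind_N^P χ, M)` is `M_{N,χ}`. Both facts are proved by Rodier's
approximation of `χ` by characters of compact open subgroups.

Rodier's groups `H s` are compact open pro-`p` subgroups of `P` carrying characters which agree
with `χ` on `N ∩ H s`; the groups `N ∩ H s` exhaust `N` while the rest of `H s` shrinks to `1`
(`IsRodierTower`). Call a vector of type `H s` if `H s` acts on it through its character. As `p`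
is invertible in `A`, averaging over `H (s + 1)` followed by averaging over `H s` is, up to a
unit, the identity on the vectors of type `H s`: all nontrivial cosets of `N` contribute zero,
because they move the character of `H s` by a unit (`exists_step`). Hence the vectors of type
`H s` embed into the twisted coinvariants (`eq_zero_of_mem_twistedKernel`), and every class lifts
to them for large `s` (`eventually_exists_lift`). Applied to `ind_N^P χ`, in which the vectors of
type `H s` are the multiples of a single function (`eq_smul_bumpInd`), this gives the statement on
evaluation at `1` (`mem_twistedKernel_iff`). A vector of type `H 0` in `M` starts a sequence of
vectors of type `H s`, compatible under traces, and sending the `s`-th bump function to the `s`-th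
vector defines the map `ind_N^P χ → M` (`exists_intertwiningMap`), which is unique
(`eq_zero_of_forall_mem_twistedKernel`).

The Whittaker space `W` has `W_{N,χ} = A` through evaluation at `1`, and a function in `W` is
determined by the values at `1` of its translates. So an endomorphism of `W` is a scalar, and a
map `ind_N^P χ → W` corresponds to an element `a` of `A`; it induces an isomorphism on highest
derivatives if and only if `a` is a unit, and it is then injective. Two maps with `a` a unit
differ by a unit and have the same image, the space of Schwartz functions, and the
`P`-endomorphisms of this image are again the scalars. Restriction from `W` is therefore the
identity of `A`.

It remains to see that the generic character of `N` has a Rodier tower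
(`isRodierTower_rodierGroup`). The entries of `g - 1` for `g` in `H s` are bounded by powers of
the uniformizer that grow linearly along the diagonals. Two properties need the conductor of `ψ`:
an element of `N ∩ H (s + 1)` fixing the character of `H s` lies in `H s`
(`mem_rodierGroup_of_forall_conj`), and an element of `P` intertwining the characters of `N` and
`H s` lies in `N * H s` (`exists_eq_mul_of_forall_conj`). Distinct values of `ψ` differ by a unit
of `W(k)` because they are roots of unity of `p`-power order and `p ≠ ℓ`
(`IsConductor.isUnit_sub`).
-/

/-! ### Characters of compact open subgroups and twisted traces -/

namespace WhittakerFamily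

open Filter Topology

section Trace

variable {A : Type*} [CommRing A] {G : Type*} [Group G]
variable {V : Type*} [AddCommGroup V] [Module A V]

/-- The function `Θ : G → A` restricts to a character of the subgroup `K`. -/
structure IsCharOn (Θ : G → A) (K : Subgroup G) : Prop where
  map_one : Θ 1 = 1
  map_mul : ∀ a ∈ K, ∀ b ∈ K, Θ (a * b) = Θ a * Θ b

namespace IsCharOn

variable {Θ : G → A} {K : Subgroup G} (hΘ : IsCharOn Θ K)
include hΘ

theorem inv_mul_self {a : G} (ha : a ∈ K) : Θ a⁻¹ * Θ a = 1 := by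
  rw [← hΘ.map_mul _ (K.inv_mem ha) _ ha, inv_mul_cancel, hΘ.map_one]

theorem mul_inv_self {a : G} (ha : a ∈ K) : Θ a * Θ a⁻¹ = 1 := by
  rw [mul_comm, hΘ.inv_mul_self ha]

theorem conj {a b : G} (ha : a ∈ K) (hb : b ∈ K) : Θ (b⁻¹ * a * b) = Θ a := by
  rw [hΘ.map_mul _ (K.mul_mem (K.inv_mem hb) ha) _ hb, hΘ.map_mul _ (K.inv_mem hb) _ ha,
    mul_right_comm, hΘ.inv_mul_self hb, one_mul]

end IsCharOn

/-- The vectors on which the subgroup `K` acts through the function `Θ`. -/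
def eigenvectors (ρ : Representation A G V) (Θ : G → A) (K : Subgroup G) : Submodule A V where
  carrier := {v | ∀ k ∈ K, ρ k v = Θ k • v}
  zero_mem' := by simp
  add_mem' := by
    intro a b ha hb k hk
    rw [map_add, ha k hk, hb k hk, smul_add]
  smul_mem' := by
    intro c a ha k hk
    rw [map_smul, ha k hk, smul_comm]

theorem eigenvectors_anti (ρ : Representation A G V) (Θ : G → A) {K L : Subgroup G} (h : L ≤ K) :
    eigenvectors ρ Θ K ≤ eigenvectors ρ Θ L := fun _ hv k hk => hv k (h hk)

/-- The `Θ`-twisted trace from `K ∩ L` to `K`: the sum of `Θ(k)⁻¹ k v` over `k` in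
`K / (K ∩ L)`. It is independent of the chosen representatives on vectors on which `K ∩ L`
acts through `Θ`, see `twistedTrace_term`. -/
noncomputable def twistedTrace (ρ : Representation A G V) (Θ : G → A) (K L : Subgroup G)
    [Fintype (K ⧸ L.subgroupOf K)] : V →ₗ[A] V :=
  ∑ q : K ⧸ L.subgroupOf K, Θ (q.out : G)⁻¹ • ρ (q.out : G)

variable {ρ : Representation A G V} {Θ : G → A} {K L : Subgroup G}

theorem twistedTrace_apply [Fintype (K ⧸ L.subgroupOf K)] (v : V) :
    twistedTrace ρ Θ K L v =
      ∑ q : K ⧸ L.subgroupOf K, Θ (q.out : G)⁻¹ • ρ (q.out : G) v := by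
  simp [twistedTrace]

theorem twistedTrace_term (hΘ : IsCharOn Θ K) {v : V} (hv : v ∈ eigenvectors ρ Θ (L ⊓ K))
    {a b : K} (h : (a : K ⧸ L.subgroupOf K) = b) :
    Θ (a : G)⁻¹ • ρ (a : G) v = Θ (b : G)⁻¹ • ρ (b : G) v := by
  rw [QuotientGroup.eq] at h
  have h1 : ρ (b : G) v = Θ ((a : G)⁻¹ * b) • ρ (a : G) v := by
    rw [← map_smul, ← hv ((a : G)⁻¹ * b) ⟨h, (a⁻¹ * b).2⟩, ← Module.End.mul_apply, ← map_mul]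
    simp
  rw [h1, hΘ.map_mul _ (K.inv_mem a.2) _ b.2, smul_smul, mul_left_comm, hΘ.inv_mul_self b.2,
    mul_one]

theorem twistedTrace_eq_of_rep [Fintype (K ⧸ L.subgroupOf K)] (hΘ : IsCharOn Θ K) {v : V}
    (hv : v ∈ eigenvectors ρ Θ (L ⊓ K)) (r : K ⧸ L.subgroupOf K → K)
    (hr : ∀ q, (r q : K ⧸ L.subgroupOf K) = q) :
    twistedTrace ρ Θ K L v = ∑ q, Θ (r q : G)⁻¹ • ρ (r q : G) v := by
  rw [twistedTrace_apply]
  exact Finset.sum_congr rfl fun q _ => twistedTrace_term hΘ hv (by rw [hr q]; simp)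

theorem twistedTrace_mem [Fintype (K ⧸ L.subgroupOf K)] (hΘ : IsCharOn Θ K) {v : V}
    (hv : v ∈ eigenvectors ρ Θ (L ⊓ K)) : twistedTrace ρ Θ K L v ∈ eigenvectors ρ Θ K := by
  intro k hk
  rw [twistedTrace_apply, map_sum, Finset.smul_sum]
  refine Fintype.sum_equiv (MulAction.toPerm (⟨k, hk⟩ : K)) _ _ fun q => ?_
  have h : ((⟨k, hk⟩ * q.out : K) : K ⧸ L.subgroupOf K) =
      ((MulAction.toPerm (⟨k, hk⟩ : K) q).out : K) := by
    rw [QuotientGroup.out_eq']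
    change _ = (⟨k, hk⟩ : K) • q
    conv_rhs => rw [← QuotientGroup.out_eq' q]
    rfl
  rw [← twistedTrace_term hΘ hv h, map_smul, ← Module.End.mul_apply, ← map_mul, smul_smul]
  congr 1
  rw [Subgroup.coe_mul, mul_inv_rev, hΘ.map_mul _ (K.inv_mem q.out.2) _ (K.inv_mem hk),
    mul_left_comm, hΘ.mul_inv_self hk, mul_one]

theorem twistedTrace_of_mem [Fintype (K ⧸ L.subgroupOf K)] (hΘ : IsCharOn Θ K) {v : V}
    (hv : v ∈ eigenvectors ρ Θ K) :
    twistedTrace ρ Θ K L v = (Fintype.card (K ⧸ L.subgroupOf K) : A) • v := by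
  rw [twistedTrace_apply, Finset.sum_congr rfl fun q _ => ?_, Finset.sum_const, Finset.card_univ,
    Nat.cast_smul_eq_nsmul]
  rw [hv _ q.out.2, smul_smul, hΘ.inv_mul_self q.out.2, one_smul]

/-- If every coset has a representative on which the linear map `f` is `Θ`-equivariant at `v`,
then `f` multiplies by the index along the trace. -/
theorem map_twistedTrace [Fintype (K ⧸ L.subgroupOf K)] (hΘ : IsCharOn Θ K) {v : V}
    (hv : v ∈ eigenvectors ρ Θ (L ⊓ K)) {Q : Type*} [AddCommGroup Q] [Module A Q]
    (f : V →ₗ[A] Q) (hf : ∀ k ∈ K, ∃ n ∈ K, n⁻¹ * k ∈ L ∧ f (ρ n v) = Θ n • f v) :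
    f (twistedTrace ρ Θ K L v) = (Fintype.card (K ⧸ L.subgroupOf K) : A) • f v := by
  choose! n hn hnL hnf using hf
  rw [twistedTrace_eq_of_rep hΘ hv (fun q => ⟨n q.out, hn _ q.out.2⟩), map_sum]
  · rw [Finset.sum_congr rfl fun q _ => ?_, Finset.sum_const, Finset.card_univ,
      Nat.cast_smul_eq_nsmul]
    rw [map_smul, hnf _ q.out.2, smul_smul, hΘ.inv_mul_self (hn _ q.out.2), one_smul]
  · intro q
    conv_rhs => rw [← QuotientGroup.out_eq' q]
    rw [QuotientGroup.eq]
    exact hnL _ q.out.2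

theorem twistedTrace_map_of_normal [Fintype (K ⧸ L.subgroupOf K)] [hN : (L.subgroupOf K).Normal]
    (hΘ : IsCharOn Θ K) {v : V}
    (hv : v ∈ eigenvectors ρ Θ (L ⊓ K)) {h : G} (hh : h ∈ K) :
    twistedTrace ρ Θ K L (ρ h v) = Θ h • twistedTrace ρ Θ K L v := by
  rw [twistedTrace_apply, twistedTrace_apply, Finset.smul_sum]
  refine Fintype.sum_equiv (Equiv.mulRight ((⟨h, hh⟩ : K) : K ⧸ L.subgroupOf K)) _ _ fun q => ?_
  have e : ((q.out * ⟨h, hh⟩ : K) : K ⧸ L.subgroupOf K) =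
      ((Equiv.mulRight ((⟨h, hh⟩ : K) : K ⧸ L.subgroupOf K) q).out : K) := by
    rw [QuotientGroup.out_eq', Equiv.coe_mulRight, QuotientGroup.mk_mul, QuotientGroup.out_eq']
  rw [← twistedTrace_term hΘ hv e, Subgroup.coe_mul, map_mul, Module.End.mul_apply, smul_smul,
    mul_inv_rev, hΘ.map_mul _ (K.inv_mem hh) _ (K.inv_mem q.out.2), ← mul_assoc,
    hΘ.mul_inv_self hh, one_mul]

/-- The trace of a vector on which `K` acts by scalars vanishes as soon as these scalars differ
from `Θ` by a unit at some element of `K`. -/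
theorem twistedTrace_eq_zero [Fintype (K ⧸ L.subgroupOf K)] (hΘ : IsCharOn Θ K) {v : V}
    (hv : v ∈ eigenvectors ρ Θ (L ⊓ K)) (η : G → A) (hη : ∀ k ∈ K, ρ k v = η k • v)
    {y : G} (hy : y ∈ K) (hu : IsUnit (η y - Θ y)) : twistedTrace ρ Θ K L v = 0 := by
  have h1 : ∃ a : A, twistedTrace ρ Θ K L v = a • v := by
    refine ⟨∑ q : K ⧸ L.subgroupOf K, Θ (q.out : G)⁻¹ * η q.out, ?_⟩
    rw [twistedTrace_apply, Finset.sum_smul]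
    exact Finset.sum_congr rfl fun q _ => by rw [hη _ q.out.2, smul_smul]
  obtain ⟨a, ha⟩ := h1
  have h2 := twistedTrace_mem hΘ hv y hy
  have h3 : ρ y (twistedTrace ρ Θ K L v) = η y • twistedTrace ρ Θ K L v := by
    rw [ha, map_smul, hη y hy, smul_comm]
  rw [h3, ← sub_eq_zero, ← sub_smul] at h2
  exact hu.smul_eq_zero.mp h2

end Trace

theorem map_mem_twistedKernel {A : Type*} [CommRing A] {G : Type*} [Group G] {V W : Type*}
    [AddCommGroup V] [Module A V] [AddCommGroup W] [Module A W] {ρ : Representation A G V}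
    {τ : Representation A G W} {N : Subgroup G} {χ : N →* A} (φ : ρ.IntertwiningMap τ) {v : V}
    (hv : v ∈ twistedKernel ρ N χ) : φ v ∈ twistedKernel τ N χ := by
  refine (Submodule.span_le (p := (twistedKernel τ N χ).comap φ.toLinearMap)).mpr ?_ hv
  rintro _ ⟨n, f, rfl⟩
  refine Submodule.subset_span ⟨n, φ f, ?_⟩
  rw [← φ.isIntertwining]
  simp

theorem twistedKernel_le_ker {A : Type*} [CommRing A] {G : Type*} [Group G] {W : Type*}
    [AddCommGroup W] [Module A W] {τ : Representation A G W} {N : Subgroup G} {χ : N →* A}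
    (f : W →ₗ[A] A) (hf : ∀ (n : N) (w : W), f (τ n w) = χ n * f w) :
    twistedKernel τ N χ ≤ LinearMap.ker f := by
  refine Submodule.span_le.mpr ?_
  rintro _ ⟨n, w, rfl⟩
  simp [hf]

section Index

variable {G : Type*} [Group G] [TopologicalSpace G] [IsTopologicalGroup G]

theorem finite_quotient_subgroupOf {K L : Subgroup G} (hK : IsCompact (K : Set G))
    (hL : IsOpen (L : Set G)) : Finite (K ⧸ L.subgroupOf K) := by
  have : CompactSpace K := isCompact_iff_compactSpace.mp hK
  exact Subgroup.quotient_finite_of_isOpen _ (hL.preimage continuous_subtype_val)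

/-- Every open subgroup contains an open subgroup of the compact group `K` normal in `K`. -/
theorem exists_normal_open {K L : Subgroup G} (hKo : IsOpen (K : Set G))
    (hK : IsCompact (K : Set G)) (hL : IsOpen (L : Set G)) :
    ∃ M : Subgroup G, IsOpen (M : Set G) ∧ M ≤ L ∧ M ≤ K ∧ (M.subgroupOf K).Normal := by
  have : CompactSpace K := isCompact_iff_compactSpace.mp hK
  have : Finite (K ⧸ L.subgroupOf K) := finite_quotient_subgroupOf hK hL
  have hfi : (L.subgroupOf K).FiniteIndex := Subgroup.finiteIndex_of_finite_quotient
  let C := (L.subgroupOf K).normalCore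
  have hC : IsOpen (C : Set K) := by
    refine Subgroup.isOpen_of_isClosed_of_finiteIndex _ ?_
    have hcl : IsClosed ((L.subgroupOf K : Subgroup K) : Set K) :=
      Subgroup.isClosed_of_isOpen _ (hL.preimage continuous_subtype_val)
    have : (C : Set K) = ⋂ b : K, (fun a => b * a * b⁻¹) ⁻¹' (L.subgroupOf K : Set K) := by
      ext a
      simp [C, Subgroup.normalCore]
    rw [this]
    exact isClosed_iInter fun b => hcl.preimage (by fun_prop)
  refine ⟨C.map K.subtype, ?_, ?_, ?_, ?_⟩
  · rw [Subgroup.coe_map]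
    exact hKo.isOpenMap_subtype_val _ hC
  · rintro _ ⟨x, hx, rfl⟩
    exact (L.subgroupOf K).normalCore_le hx
  · rintro _ ⟨x, hx, rfl⟩
    exact x.2
  · have : (C.map K.subtype).subgroupOf K = C := by
      rw [Subgroup.subgroupOf]
      exact Subgroup.comap_map_eq_self_of_injective K.subtype_injective C
    rw [this]
    infer_instance

/-- If the elements of the compact open group `K` are topologically `p`-torsion, then the
indices of open subgroups are powers of `p`. -/
theorem exists_card_eq_pow {p : ℕ} [Fact p.Prime] {K L : Subgroup G} (hKo : IsOpen (K : Set G))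
    (hK : IsCompact (K : Set G)) (hL : IsOpen (L : Set G))
    (hp : ∀ h ∈ K, ∀ O ∈ 𝓝 (1 : G), ∃ k : ℕ, h ^ p ^ k ∈ O) [Fintype (K ⧸ L.subgroupOf K)] :
    ∃ j : ℕ, Fintype.card (K ⧸ L.subgroupOf K) = p ^ j := by
  obtain ⟨M, hMo, hML, hMK, hn⟩ := exists_normal_open hKo hK hL
  have : Finite (K ⧸ M.subgroupOf K) := finite_quotient_subgroupOf hK hMo
  have hpg : IsPGroup p (K ⧸ M.subgroupOf K) := by
    intro q
    obtain ⟨x, rfl⟩ := QuotientGroup.mk_surjective q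
    obtain ⟨k, hk⟩ := hp x x.2 M (hMo.mem_nhds M.one_mem)
    refine ⟨k, ?_⟩
    rw [← QuotientGroup.mk_pow, QuotientGroup.eq_one_iff]
    exact hk
  obtain ⟨j, hj⟩ := hpg.exists_card_eq
  have hdvd : Nat.card (K ⧸ L.subgroupOf K) ∣ p ^ j := by
    rw [← hj]
    exact Subgroup.index_dvd_of_le fun x hx => hML hx
  obtain ⟨i, -, hi⟩ := (Nat.dvd_prime_pow Fact.out).mp hdvd
  exact ⟨i, by rw [← Nat.card_eq_fintype_card, hi]⟩

end Index

end WhittakerFamily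

/-! ### Rodier towers and twisted coinvariants -/

namespace WhittakerFamily

open Filter Topology

variable {A : Type*} [CommRing A] {G : Type*} [Group G] [TopologicalSpace G] [IsTopologicalGroup G]

/-- The properties of Rodier's approximation of a character `χ` of a closed subgroup `N` by
characters of compact open subgroups `H s` that are used below. One function `Θ` on `G` carries
`χ` and the characters of all the `H s`; `p` is a prime such that the `H s` are pro-`p`-groups. -/
structure IsRodierTower (p : ℕ) (N : Subgroup G) (χ : N →* A) (Θ : G → A) (H : ℕ → Subgroup G) :
    Prop where
  prime : p.Prime
  isUnit : IsUnit (p : A)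
  isCharOn : ∀ s, IsCharOn Θ (H s)
  apply_coe : ∀ n : N, Θ n = χ n
  eventually_one : ∀ᶠ g in 𝓝 (1 : G), Θ g = 1
  isClosed : IsClosed (N : Set G)
  isOpen : ∀ s, IsOpen (H s : Set G)
  isCompact : ∀ s, IsCompact (H s : Set G)
  pow_mem : ∀ s, ∀ h ∈ H s, ∀ O ∈ 𝓝 (1 : G), ∃ k : ℕ, h ^ p ^ k ∈ O
  inf_le_succ : ∀ s, N ⊓ H s ≤ H (s + 1)
  exists_mem : ∀ n ∈ N, ∃ s, n ∈ H s
  /-- Every coset of `H s ∩ H (s + 1)` in `H (s + 1)` meets `N`. -/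
  exists_left : ∀ s, ∀ h ∈ H (s + 1), ∃ n ∈ N ⊓ H (s + 1), n⁻¹ * h ∈ H s
  /-- Up to elements of `N`, the groups `H s` shrink to `1`. -/
  exists_small : ∀ O ∈ 𝓝 (1 : G), ∀ᶠ s in atTop, ∀ h ∈ H s, ∃ n ∈ N ⊓ H s, n⁻¹ * h ∈ O
  mul_mem_succ : ∀ s, ∀ n ∈ N, ∀ h ∈ H (s + 1), n * h ∈ H s → n * h ∈ H (s + 1)
  /-- An element of `N ∩ H (s + 1)` outside `H s` normalizes `H s` and moves its character. -/
  conj : ∀ s, ∀ n ∈ N ⊓ H (s + 1), n ∉ H s → (∀ y ∈ H s, n⁻¹ * y * n ∈ H s) ∧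
    ∃ y ∈ H s, IsUnit (Θ (n⁻¹ * y * n) - Θ y)
  /-- An element that intertwines `χ` with the character of `H s` lies in `N * H s`. -/
  intertwine : ∀ s, ∀ g : G, (∀ n ∈ N, ∀ h ∈ H s, g ≠ n * h) →
    ∃ h ∈ H s, g * h * g⁻¹ ∈ N ∧ IsUnit (Θ (g * h * g⁻¹) - Θ h)

theorem mkQ_eq_smul_mkQ {V : Type*} [AddCommGroup V] [Module A V] {Z : Submodule A V} {v w : V}
    {a : A} (h : w - a • v ∈ Z) : Z.mkQ w = a • Z.mkQ v := by
  rw [← map_smul, ← sub_eq_zero, ← map_sub]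
  exact (Submodule.Quotient.mk_eq_zero _).mpr h

namespace IsRodierTower

variable {p : ℕ} {N : Subgroup G} {χ : N →* A} {Θ : G → A} {H : ℕ → Subgroup G}
variable (hT : IsRodierTower p N χ Θ H)
variable {V : Type*} [AddCommGroup V] [Module A V] {ρ : Representation A G V}
include hT

omit [IsTopologicalGroup G] in
theorem shift (t : ℕ) : IsRodierTower p N χ Θ fun s => H (s + t) where
  prime := hT.prime
  isUnit := hT.isUnit
  isCharOn s := hT.isCharOn _
  apply_coe := hT.apply_coe
  eventually_one := hT.eventually_one
  isClosed := hT.isClosed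
  isOpen s := hT.isOpen _
  isCompact s := hT.isCompact _
  pow_mem s := hT.pow_mem _
  inf_le_succ s := by rw [add_right_comm]; exact hT.inf_le_succ _
  exists_mem n hn := by
    obtain ⟨s, hs⟩ := hT.exists_mem n hn
    refine ⟨s, ?_⟩
    have : ∀ k, n ∈ H (s + k) := by
      intro k
      induction k with
      | zero => exact hs
      | succ k ih => exact hT.inf_le_succ _ ⟨hn, ih⟩
    exact this t
  exists_left s := by rw [add_right_comm]; exact hT.exists_left _
  exists_small O hO := (tendsto_add_atTop_nat t).eventually (hT.exists_small O hO)
  mul_mem_succ s := by rw [add_right_comm]; exact hT.mul_mem_succ _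
  conj s := by rw [add_right_comm]; exact hT.conj _
  intertwine s := hT.intertwine _

omit [IsTopologicalGroup G] in
theorem inf_le {s t : ℕ} (h : s ≤ t) : N ⊓ H s ≤ H t := by
  induction t, h using Nat.le_induction with
  | base => exact inf_le_right
  | succ k _ ih => exact fun n hn => hT.inf_le_succ k ⟨hn.1, ih hn⟩

omit [IsTopologicalGroup G] in
theorem eventually_mem_of_isCompact {C : Set G} (hC : IsCompact C) :
    ∀ᶠ s in atTop, ∀ n ∈ N, n ∈ C → n ∈ H s := by
  obtain ⟨I, hI⟩ := (hC.inter_left hT.isClosed).elim_finite_subcover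
    (fun s => (H s : Set G)) hT.isOpen (fun n hn => by
      obtain ⟨s, hs⟩ := hT.exists_mem n hn.1
      exact Set.mem_iUnion.mpr ⟨s, hs⟩)
  refine (eventually_ge_atTop (I.sup id)).mono fun t ht n hn hnC => ?_
  obtain ⟨s, hs, hns⟩ := Set.mem_iUnion₂.mp (hI ⟨hn, hnC⟩)
  exact hT.inf_le ((Finset.le_sup (f := id) hs).trans ht) ⟨hn, hns⟩

/-- For large `s`, the set `N * H s` meets a given compact set inside `H s`. -/
theorem eventually_mem_of_mul {C : Set G} (hC : IsCompact C) :
    ∀ᶠ s in atTop, ∀ n ∈ N, ∀ h ∈ H s, n * h ∈ C → n * h ∈ H s := by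
  have h0 : (H 0 : Set G) ∈ 𝓝 (1 : G) := (hT.isOpen 0).mem_nhds (H 0).one_mem
  filter_upwards [hT.exists_small _ h0,
    hT.eventually_mem_of_isCompact (hC.mul (hT.isCompact 0))] with s hs hs' n hn h hh hC
  obtain ⟨m, hm, hmh⟩ := hs h hh
  have h1 : n * m ∈ H s := by
    refine hs' _ (N.mul_mem hn hm.1) ?_
    refine ⟨n * h, hC, (m⁻¹ * h)⁻¹, (H 0).inv_mem hmh, ?_⟩
    simp [mul_assoc]
  have : n * h = (n * m) * (m⁻¹ * h) := by simp [mul_assoc]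
  rw [this]
  exact (H s).mul_mem h1 ((H s).mul_mem ((H s).inv_mem hm.2) hh)

theorem finite_quotient (s : ℕ) {L : Subgroup G} (hL : IsOpen (L : Set G)) :
    Finite (H s ⧸ L.subgroupOf (H s)) :=
  finite_quotient_subgroupOf (hT.isCompact s) hL

theorem isUnit_card (s : ℕ) {L : Subgroup G} (hL : IsOpen (L : Set G))
    [Fintype (H s ⧸ L.subgroupOf (H s))] :
    IsUnit ((Fintype.card (H s ⧸ L.subgroupOf (H s)) : ℕ) : A) := by
  have := Fact.mk hT.prime
  obtain ⟨j, hj⟩ := exists_card_eq_pow (hT.isOpen s) (hT.isCompact s) hL (hT.pow_mem s)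
  rw [hj, Nat.cast_pow]
  exact hT.isUnit.pow j

theorem exists_open_one : ∃ L : Subgroup G, IsOpen (L : Set G) ∧ L ≤ H 0 ∧ ∀ g ∈ L, Θ g = 1 := by
  have hΘ := hT.isCharOn 0
  let L : Subgroup G :=
    { carrier := {g | g ∈ H 0 ∧ Θ g = 1}
      one_mem' := ⟨(H 0).one_mem, hΘ.map_one⟩
      mul_mem' := fun {a b} ha hb =>
        ⟨(H 0).mul_mem ha.1 hb.1, by rw [hΘ.map_mul a ha.1 b hb.1, ha.2, hb.2, one_mul]⟩
      inv_mem' := fun {a} ha =>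
        ⟨(H 0).inv_mem ha.1, by have := hΘ.inv_mul_self ha.1; rwa [ha.2, mul_one] at this⟩ }
  refine ⟨L, L.isOpen_of_mem_nhds (g := 1) ?_, fun g hg => hg.1, fun g hg => hg.2⟩
  filter_upwards [hT.eventually_one, (hT.isOpen 0).mem_nhds (H 0).one_mem] with g h1 h2
  exact ⟨h2, h1⟩

/-- A vector of a smooth module is `Θ`-equivariant under an open subgroup. -/
theorem exists_mem_eigenvectors (hρ : IsSmooth ρ) (v : V) :
    ∃ L : Subgroup G, IsOpen (L : Set G) ∧ v ∈ eigenvectors ρ Θ L := by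
  obtain ⟨K, hK, hKv⟩ := hρ v
  obtain ⟨L, hL, -, hLΘ⟩ := hT.exists_open_one
  refine ⟨K ⊓ L, hK.inter hL, fun g hg => ?_⟩
  rw [hKv g hg.1, hLΘ g hg.2, one_smul]

omit [IsTopologicalGroup G] in
theorem sub_mem_twistedKernel {n : G} (hn : n ∈ N) (v : V) :
    ρ n v - Θ n • v ∈ twistedKernel ρ N χ :=
  Submodule.subset_span ⟨⟨n, hn⟩, v, by rw [← hT.apply_coe]⟩

/-- A vector `v` of a smooth module has the same class in the twisted coinvariants as a vector on
which `H s` acts through `Θ`, for all large `s`. -/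
theorem eventually_exists_lift {L : Subgroup G} (hL : IsOpen (L : Set G)) {v : V}
    (hv : v ∈ eigenvectors ρ Θ L) : ∀ᶠ s in atTop, ∃ w ∈ eigenvectors ρ Θ (H s),
      ∀ Z : Submodule A V, (∀ n ∈ N, ρ n v - Θ n • v ∈ Z) → w - v ∈ Z := by
  filter_upwards [hT.exists_small _ (hL.mem_nhds L.one_mem)] with s hs
  have := hT.finite_quotient s hL
  let := Fintype.ofFinite (H s ⧸ L.subgroupOf (H s))
  obtain ⟨c, hc⟩ := hT.isUnit_card s hL
  have hv' := eigenvectors_anti ρ Θ (inf_le_left (a := L) (b := H s)) hv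
  refine ⟨(↑c⁻¹ : A) • twistedTrace ρ Θ (H s) L v,
    Submodule.smul_mem _ _ (twistedTrace_mem (hT.isCharOn s) hv'), fun Z hZ => ?_⟩
  rw [← Submodule.Quotient.mk_eq_zero, ← Submodule.mkQ_apply, map_sub, map_smul,
    map_twistedTrace (hT.isCharOn s) hv' Z.mkQ, ← hc, smul_smul, Units.inv_mul, one_smul, sub_self]
  intro k hk
  obtain ⟨n, hn, hnk⟩ := hs k hk
  exact ⟨n, hn.2, hnk, mkQ_eq_smul_mkQ (hZ n hn.1)⟩

/-- One step in the tower: a vector `v` on which `H s` acts through `Θ` is the trace of a vector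
on which `H (s + 1)` acts through `Θ`, whose class in
the coinvariants is a unit multiple of that of `v`. -/
theorem exists_step (s : ℕ) {v : V} (hv : v ∈ eigenvectors ρ Θ (H s)) :
    ∃ w ∈ eigenvectors ρ Θ (H (s + 1)),
      (∀ [Fintype (H s ⧸ (H (s + 1)).subgroupOf (H s))],
        twistedTrace ρ Θ (H s) (H (s + 1)) w = v) ∧
      ∃ a : Aˣ, ∀ Z : Submodule A V, (∀ n ∈ N ⊓ H (s + 1), ρ n v - Θ n • v ∈ Z) →
        w - (a : A) • v ∈ Z := by
  have := hT.finite_quotient (s + 1) (hT.isOpen s)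
  let := Fintype.ofFinite (H (s + 1) ⧸ (H s).subgroupOf (H (s + 1)))
  have hΘ := hT.isCharOn s
  have hΘ' := hT.isCharOn (s + 1)
  have hv' := eigenvectors_anti ρ Θ (inf_le_left (a := H s) (b := H (s + 1))) hv
  obtain ⟨c, hc⟩ := hT.isUnit_card (s + 1) (hT.isOpen s)
  have hback : ∀ [Fintype (H s ⧸ (H (s + 1)).subgroupOf (H s))],
      twistedTrace ρ Θ (H s) (H (s + 1)) (twistedTrace ρ Θ (H (s + 1)) (H s) v) =
        (Fintype.card (H s ⧸ (H (s + 1)).subgroupOf (H s)) : A) • v := by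
    intro _
    have key : ∀ q : H (s + 1) ⧸ (H s).subgroupOf (H (s + 1)), ∃ n : H (s + 1),
        (n : H (s + 1) ⧸ (H s).subgroupOf (H (s + 1))) = q ∧ (n : G) ∈ N := by
      intro q
      obtain ⟨n, hn, hnq⟩ := hT.exists_left s q.out q.out.2
      refine ⟨⟨n, hn.2⟩, ?_, hn.1⟩
      conv_rhs => rw [← QuotientGroup.out_eq' q]
      rw [QuotientGroup.eq]
      exact hnq
    choose r hr hrN using key
    rw [twistedTrace_eq_of_rep hΘ' hv' r hr, map_sum,
      Finset.sum_eq_single ((1 : H (s + 1)) : H (s + 1) ⧸ (H s).subgroupOf (H (s + 1)))]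
    · have h1 : (r ((1 : H (s + 1)) : H (s + 1) ⧸ (H s).subgroupOf (H (s + 1))) : G) ∈ H s := by
        have := (QuotientGroup.eq.mp (hr ((1 : H (s + 1)) : _ ⧸ _)))
        have := inv_mem this
        simpa [Subgroup.mem_subgroupOf] using this
      rw [hv _ h1, map_smul, map_smul, smul_smul, hΘ.inv_mul_self h1, one_smul,
        twistedTrace_of_mem hΘ hv]
    · intro q _ hq
      have hn : (r q : G) ∈ N ⊓ H (s + 1) := ⟨hrN q, (r q).2⟩
      have hns : (r q : G) ∉ H s := by
        intro h
        refine hq ?_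
        rw [← hr q, QuotientGroup.eq]
        simpa [Subgroup.mem_subgroupOf] using h
      obtain ⟨h1, y, hy, hu⟩ := hT.conj s _ hn hns
      have h2 : ∀ k : G, ρ k (ρ (r q : G) v) = ρ (r q : G) (ρ ((r q : G)⁻¹ * k * (r q : G)) v) := by
        intro k
        rw [← Module.End.mul_apply, ← Module.End.mul_apply, ← map_mul, ← map_mul]
        simp [mul_assoc]
      rw [map_smul, twistedTrace_eq_zero hΘ ?_ (fun k => Θ ((r q : G)⁻¹ * k * (r q : G))) ?_ hy hu,
        smul_zero]
      · intro k hk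
        rw [h2, hv _ (h1 k hk.2), map_smul, hΘ'.conj hk.1 hn.2]
      · intro k hk
        rw [h2, hv _ (h1 k hk), map_smul]
    · simp
  have := hT.finite_quotient s (hT.isOpen (s + 1))
  let := Fintype.ofFinite (H s ⧸ (H (s + 1)).subgroupOf (H s))
  obtain ⟨d, hd⟩ := hT.isUnit_card s (hT.isOpen (s + 1))
  refine ⟨(↑d⁻¹ : A) • twistedTrace ρ Θ (H (s + 1)) (H s) v,
    Submodule.smul_mem _ _ (twistedTrace_mem hΘ' hv'), ?_, d⁻¹ * c, fun Z h => ?_⟩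
  · intro inst
    rw [map_smul, hback, Subsingleton.elim inst this, ← hd, smul_smul, Units.inv_mul, one_smul]
  · rw [← Submodule.Quotient.mk_eq_zero, ← Submodule.mkQ_apply, map_sub, map_smul, map_smul,
      map_twistedTrace hΘ' hv' Z.mkQ, ← hc, smul_smul, Units.val_mul, sub_self]
    intro k hk
    obtain ⟨n, hn, hnk⟩ := hT.exists_left s k hk
    exact ⟨n, hn.2, hnk, mkQ_eq_smul_mkQ (h n hn)⟩

theorem exists_seq {v : V} (hv : v ∈ eigenvectors ρ Θ (H 0)) :
    ∃ u : ℕ → V, u 0 = v ∧ (∀ s, u s ∈ eigenvectors ρ Θ (H s)) ∧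
      (∀ s [Fintype (H s ⧸ (H (s + 1)).subgroupOf (H s))],
        twistedTrace ρ Θ (H s) (H (s + 1)) (u (s + 1)) = u s) ∧
      ∀ s, ∃ a : Aˣ, ∀ Z : Submodule A V,
        (∀ n ∈ N ⊓ H (s + 1), ρ n (u s) - Θ n • u s ∈ Z) → u (s + 1) - (a : A) • u s ∈ Z := by
  choose up h1 h2 h3 using fun (s : ℕ) (w : eigenvectors ρ Θ (H s)) => hT.exists_step s w.2
  obtain ⟨u, hu0, hu⟩ : ∃ u : ∀ s, eigenvectors ρ Θ (H s), u 0 = ⟨v, hv⟩ ∧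
      ∀ s, (u (s + 1) : V) = up s (u s) :=
    ⟨fun s => Nat.rec ⟨v, hv⟩ (fun s w => ⟨up s w, h1 s w⟩) s, rfl, fun _ => rfl⟩
  refine ⟨fun s => (u s).1, by simp only [hu0], fun s => (u s).2, fun s _ => ?_, fun s => ?_⟩
  · simp only [hu]
    exact h2 s (u s)
  · simp only [hu]
    exact h3 s (u s)

end IsRodierTower

/-- The vectors with vanishing trace from all sufficiently small open normal subgroups of `K`. -/
def traceKernel {V : Type*} [AddCommGroup V] [Module A V] (ρ : Representation A G V) (Θ : G → A)
    (K : Subgroup G) : Submodule A V where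
  carrier := {w | ∃ U : Subgroup G, IsOpen (U : Set G) ∧ ∀ L ≤ U, IsOpen (L : Set G) → L ≤ K →
    (L.subgroupOf K).Normal → ∀ [Fintype (K ⧸ L.subgroupOf K)], twistedTrace ρ Θ K L w = 0}
  zero_mem' := ⟨⊤, by simp, fun _ _ _ _ _ _ => map_zero _⟩
  add_mem' := by
    rintro a b ⟨U, hU, ha⟩ ⟨U', hU', hb⟩
    refine ⟨U ⊓ U', hU.inter hU', fun L hL hLo hLK hn _ => ?_⟩
    rw [map_add, ha L (hL.trans inf_le_left) hLo hLK hn, hb L (hL.trans inf_le_right) hLo hLK hn,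
      add_zero]
  smul_mem' := by
    rintro c a ⟨U, hU, ha⟩
    refine ⟨U, hU, fun L hL hLo hLK hn _ => ?_⟩
    rw [map_smul, ha L hL hLo hLK hn, smul_zero]

namespace IsRodierTower

variable {p : ℕ} {N : Subgroup G} {χ : N →* A} {Θ : G → A} {H : ℕ → Subgroup G}
variable (hT : IsRodierTower p N χ Θ H)
variable {V : Type*} [AddCommGroup V] [Module A V] {ρ : Representation A G V}
include hT

theorem sub_mem_traceKernel (hρ : IsSmooth ρ) {s : ℕ} {h : G} (hh : h ∈ H s) (v : V) :
    ρ h v - Θ h • v ∈ traceKernel ρ Θ (H s) := by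
  obtain ⟨U, hU, hUv⟩ := hT.exists_mem_eigenvectors hρ v
  refine ⟨U, hU, fun L hL hLo hLK hn _ => ?_⟩
  rw [map_sub, map_smul, twistedTrace_map_of_normal (hT.isCharOn s) ?_ hh, sub_self]
  exact eigenvectors_anti ρ Θ (inf_le_left.trans hL) hUv

theorem eq_zero_of_mem_traceKernel {s : ℕ} {v : V} (hv : v ∈ eigenvectors ρ Θ (H s))
    (hv' : v ∈ traceKernel ρ Θ (H s)) : v = 0 := by
  obtain ⟨U, hU, h⟩ := hv'
  obtain ⟨L, hL, hLU, hLK, hn⟩ := exists_normal_open (hT.isOpen s) (hT.isCompact s) hU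
  have := hT.finite_quotient s hL
  let := Fintype.ofFinite (H s ⧸ L.subgroupOf (H s))
  have h1 := h L hLU hL hLK hn
  rw [twistedTrace_of_mem (hT.isCharOn s) hv] at h1
  exact (hT.isUnit_card s hL).smul_eq_zero.mp h1

/-- On a smooth module, the vectors on which `H 0` acts through `Θ` embed into the twisted
coinvariants. -/
theorem eq_zero_of_mem_twistedKernel_zero (hρ : IsSmooth ρ) {v : V}
    (hv : v ∈ eigenvectors ρ Θ (H 0)) (hv' : v ∈ twistedKernel ρ N χ) : v = 0 := by
  obtain ⟨u, rfl, hu, hback, hZ⟩ := hT.exists_seq hv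
  have hev : ∀ᶠ t in atTop, u 0 ∈ traceKernel ρ Θ (H t) := by
    refine Submodule.span_induction (p := fun w _ => ∀ᶠ t in atTop, w ∈ traceKernel ρ Θ (H t))
      ?_ ?_ ?_ ?_ hv'
    · rintro _ ⟨n, w, rfl⟩
      obtain ⟨s, hs⟩ := hT.exists_mem n n.2
      filter_upwards [eventually_ge_atTop s] with t ht
      rw [← hT.apply_coe]
      exact hT.sub_mem_traceKernel hρ (hT.inf_le ht ⟨n.2, hs⟩) w
    · exact .of_forall fun t => Submodule.zero_mem _
    · intro x y _ _ hx hy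
      filter_upwards [hx, hy] with t h1 h2 using Submodule.add_mem _ h1 h2
    · intro a x _ hx
      filter_upwards [hx] with t h1 using Submodule.smul_mem _ a h1
  obtain ⟨t, ht⟩ := hev.exists
  have h1 : ∀ s ≤ t, u s ∈ traceKernel ρ Θ (H t) := by
    intro s
    induction s with
    | zero => exact fun _ => ht
    | succ s ih =>
      intro hs
      obtain ⟨a, ha⟩ := hZ s
      have h2 := ha (traceKernel ρ Θ (H t)) fun n hn =>
        hT.sub_mem_traceKernel hρ (hT.inf_le hs hn) _
      have h3 := Submodule.add_mem _ h2 (Submodule.smul_mem _ (a : A) (ih (by omega)))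
      simpa using h3
  have h0 : ∀ k ≤ t, u (t - k) = 0 := by
    intro k
    induction k with
    | zero => exact fun _ => hT.eq_zero_of_mem_traceKernel (hu t) (h1 t le_rfl)
    | succ k ih =>
      intro hk
      have := hT.finite_quotient (t - (k + 1)) (hT.isOpen (t - (k + 1) + 1))
      let := Fintype.ofFinite (H (t - (k + 1)) ⧸ (H (t - (k + 1) + 1)).subgroupOf (H (t - (k + 1))))
      have e : u (t - (k + 1) + 1) = 0 := by
        rw [show t - (k + 1) + 1 = t - k by omega, ih (by omega)]
      rw [← hback, e, map_zero]
  simpa using h0 t le_rfl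

theorem eq_zero_of_mem_twistedKernel (hρ : IsSmooth ρ) {s : ℕ} {v : V}
    (hv : v ∈ eigenvectors ρ Θ (H s)) (hv' : v ∈ twistedKernel ρ N χ) : v = 0 :=
  (hT.shift s).eq_zero_of_mem_twistedKernel_zero hρ (by simpa using hv) hv'

end IsRodierTower

end WhittakerFamily

/-! ### The compact induction -/

namespace WhittakerFamily

open Filter Topology

variable {A : Type*} [CommRing A] {G : Type*} [Group G]

open Classical in
/-- The function on `G` supported on `N * K` with value `χ(n) Θ(k)` at `n * k`. -/
noncomputable def bump {N : Subgroup G} (χ : N →* A) (Θ : G → A) (K : Subgroup G) (x : G) : A :=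
  if hx : ∃ nk : N × K, x = nk.1 * nk.2 then χ hx.choose.1 * Θ hx.choose.2 else 0

section Bump

variable {N : Subgroup G} {χ : N →* A} {Θ : G → A} {K : Subgroup G}

theorem bump_mul (hΘ : IsCharOn Θ K) (hχ : ∀ n : N, Θ n = χ n) (n : N) {k : G} (hk : k ∈ K) :
    bump χ Θ K (n * k) = χ n * Θ k := by
  have hx : ∃ nk : N × K, (n : G) * k = nk.1 * nk.2 := ⟨(n, ⟨k, hk⟩), rfl⟩
  rw [bump, dif_pos hx]
  set m := hx.choose.1
  set l := hx.choose.2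
  have h : (n : G) * k = m * l := hx.choose_spec
  have h1 : ((m⁻¹ * n : N) : G) = l * k⁻¹ := by
    rw [Subgroup.coe_mul, Subgroup.coe_inv, inv_mul_eq_iff_eq_mul, ← mul_assoc, ← h]
    simp
  have h2 : χ n = χ m * (Θ l * Θ k⁻¹) := by
    rw [← hΘ.map_mul _ l.2 _ (K.inv_mem hk), ← h1, hχ, ← map_mul, mul_inv_cancel_left]
  rw [h2, mul_assoc, mul_assoc, hΘ.inv_mul_self hk, mul_one]

theorem bump_of_mem (hΘ : IsCharOn Θ K) (hχ : ∀ n : N, Θ n = χ n) {k : G} (hk : k ∈ K) :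
    bump χ Θ K k = Θ k := by
  simpa using bump_mul hΘ hχ 1 hk

theorem bump_one (hΘ : IsCharOn Θ K) (hχ : ∀ n : N, Θ n = χ n) : bump χ Θ K 1 = 1 := by
  rw [bump_of_mem hΘ hχ K.one_mem, hΘ.map_one]

theorem exists_of_bump_ne_zero {x : G} (hx : bump χ Θ K x ≠ 0) : ∃ n ∈ N, ∃ k ∈ K, x = n * k := by
  by_contra h
  refine hx (dif_neg ?_)
  rintro ⟨⟨n, k⟩, e⟩
  exact h ⟨n, n.2, k, k.2, e⟩

theorem bump_mul_left (hΘ : IsCharOn Θ K) (hχ : ∀ n : N, Θ n = χ n) (n : N) (x : G) :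
    bump χ Θ K (n * x) = χ n * bump χ Θ K x := by
  by_cases h : bump χ Θ K x = 0
  · by_cases h' : bump χ Θ K (n * x) = 0
    · rw [h, h', mul_zero]
    · obtain ⟨m, hm, k, hk, e⟩ := exists_of_bump_ne_zero h'
      have hx : x = (n⁻¹ * ⟨m, hm⟩ : N) * k := by
        rw [Subgroup.coe_mul, mul_assoc, ← e]
        simp
      rw [hx, ← mul_assoc, ← Subgroup.coe_mul, bump_mul hΘ hχ _ hk, bump_mul hΘ hχ _ hk, map_mul,
        mul_assoc]
  · obtain ⟨m, hm, k, hk, rfl⟩ := exists_of_bump_ne_zero h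
    have h1 := bump_mul hΘ hχ (n * ⟨m, hm⟩) hk
    have h2 := bump_mul hΘ hχ ⟨m, hm⟩ hk
    rw [Subgroup.coe_mul, mul_assoc] at h1
    rw [h1, h2, map_mul, mul_assoc]

theorem bump_mul_right (hΘ : IsCharOn Θ K) (hχ : ∀ n : N, Θ n = χ n) (x : G) {k : G}
    (hk : k ∈ K) : bump χ Θ K (x * k) = Θ k * bump χ Θ K x := by
  by_cases h : bump χ Θ K x = 0
  · by_cases h' : bump χ Θ K (x * k) = 0
    · rw [h, h', mul_zero]
    · obtain ⟨m, hm, l, hl, e⟩ := exists_of_bump_ne_zero h'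
      refine absurd h ?_
      have hx : x = (⟨m, hm⟩ : N) * (l * k⁻¹) := by
        rw [← mul_assoc, ← e]
        simp
      have h1 := bump_mul hΘ hχ ⟨m, hm⟩ hl
      have hlk : l * k⁻¹ ∈ K := K.mul_mem hl (K.inv_mem hk)
      rw [hx, bump_mul hΘ hχ _ hlk]
      intro h0
      refine h' ?_
      have h3 : Θ l = Θ (l * k⁻¹) * Θ k := by
        rw [← hΘ.map_mul _ hlk _ hk]
        simp
      rw [e, h1, h3, ← mul_assoc, h0, zero_mul]
  · obtain ⟨m, hm, l, hl, rfl⟩ := exists_of_bump_ne_zero h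
    have h1 := bump_mul hΘ hχ ⟨m, hm⟩ (K.mul_mem hl hk)
    have h2 := bump_mul hΘ hχ ⟨m, hm⟩ hl
    rw [mul_assoc, h1, h2, hΘ.map_mul _ hl _ hk]
    ring

end Bump

variable [TopologicalSpace G] [IsTopologicalGroup G]

theorem isSmooth_compactInd {N : Subgroup G} (χ : N →* A) :
    IsSmooth (compactInd N χ).toRepresentation := by
  rintro ⟨f, ⟨-, K, hK, hKf⟩, -⟩
  exact ⟨K, hK, fun g hg => Subtype.ext (funext fun x => hKf g hg x)⟩

namespace IsRodierTower

variable {p : ℕ} {N : Subgroup G} {χ : N →* A} {Θ : G → A} {H : ℕ → Subgroup G}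
variable (hT : IsRodierTower p N χ Θ H)
variable {V : Type*} [AddCommGroup V] [Module A V] {ρ : Representation A G V}
include hT

theorem bump_mem (s : ℕ) : bump χ Θ (H s) ∈ compactInd N χ := by
  have hΘ := hT.isCharOn s
  obtain ⟨L, hL, -, hLΘ⟩ := hT.exists_open_one
  refine ⟨⟨bump_mul_left hΘ hT.apply_coe, H s ⊓ L, (hT.isOpen s).inter hL, fun g hg x => ?_⟩,
    H s, hT.isCompact s, fun x hx => exists_of_bump_ne_zero hx⟩
  rw [bump_mul_right hΘ hT.apply_coe x hg.1, hLΘ g hg.2, one_mul]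

/-- The function `bump χ Θ (H s)` as an element of the compact induction. -/
noncomputable def bumpInd (s : ℕ) : (compactInd N χ).toSubmodule := ⟨_, hT.bump_mem s⟩

theorem bumpInd_mem_eigenvectors (s : ℕ) :
    hT.bumpInd s ∈ eigenvectors (compactInd N χ).toRepresentation Θ (H s) := fun _ hk =>
  Subtype.ext (funext fun x => bump_mul_right (hT.isCharOn s) hT.apply_coe x hk)

theorem bumpInd_apply_one (s : ℕ) : (hT.bumpInd s).val 1 = 1 :=
  bump_one (hT.isCharOn s) hT.apply_coe

/-- The functions in the compact induction on which `H s` acts through `Θ` are the multiples of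
`bump χ Θ (H s)`. -/
theorem eq_smul_bumpInd {s : ℕ} {f : (compactInd N χ).toSubmodule}
    (hf : f ∈ eigenvectors (compactInd N χ).toRepresentation Θ (H s)) :
    f = f.val 1 • hT.bumpInd s := by
  have hfN : ∀ (n : N) (x : G), f.val (n * x) = χ n * f.val x := f.2.1.1
  have hfH : ∀ h ∈ H s, ∀ x, f.val (x * h) = Θ h * f.val x := fun h hh x =>
    congrFun (congrArg Subtype.val (hf h hh)) x
  refine Subtype.ext (funext fun x => ?_)
  change f.val x = f.val 1 * bump χ Θ (H s) x
  by_cases hx : ∃ n ∈ N, ∃ h ∈ H s, x = n * h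
  · obtain ⟨n, hn, h, hh, rfl⟩ := hx
    have h1 := bump_mul (hT.isCharOn s) hT.apply_coe ⟨n, hn⟩ hh
    have h2 := hfN ⟨n, hn⟩ (1 * h)
    rw [hfH h hh] at h2
    simp only [one_mul] at h1 h2
    rw [h1, h2]
    ring
  · push Not at hx
    obtain ⟨h, hh, hN, hu⟩ := hT.intertwine s x hx
    have h1 : f.val (x * h) = Θ (x * h * x⁻¹) * f.val x := by
      have := hfN ⟨_, hN⟩ x
      rw [← hT.apply_coe] at this
      simpa using this
    rw [hfH h hh, eq_comm, ← sub_eq_zero, ← sub_mul] at h1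
    have h2 : f.val x = 0 := hu.mul_right_eq_zero.mp h1
    have h3 : bump χ Θ (H s) x = 0 := by
      by_contra h0
      obtain ⟨n, hn, k, hk, e⟩ := exists_of_bump_ne_zero h0
      exact hx n hn k hk e
    rw [h2, h3, mul_zero]

/-- Evaluation at `1` identifies the twisted coinvariants of the compact induction with `A`. -/
theorem mem_twistedKernel_iff (f : (compactInd N χ).toSubmodule) :
    f ∈ twistedKernel (compactInd N χ).toRepresentation N χ ↔ f.val 1 = 0 := by
  let ev : (compactInd N χ).toSubmodule →ₗ[A] A :=
    { toFun := fun f => f.val 1, map_add' := fun _ _ => rfl, map_smul' := fun _ _ => rfl }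
  have hev : ∀ (n : N) (f : (compactInd N χ).toSubmodule),
      ev ((compactInd N χ).toRepresentation n f) = χ n * ev f := fun n f => by
    have := f.2.1.1 n 1
    change f.val (1 * n) = χ n * f.val 1
    simpa using this
  refine ⟨fun h => twistedKernel_le_ker ev hev h, fun h => ?_⟩
  obtain ⟨L, hL, hfL⟩ := hT.exists_mem_eigenvectors (isSmooth_compactInd χ) f
  obtain ⟨s, w, hw, hwZ⟩ := (hT.eventually_exists_lift hL hfL).exists
  have h1 : w - f ∈ LinearMap.ker ev := hwZ _ fun n hn => by
    have := hev ⟨n, hn⟩ f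
    rw [LinearMap.mem_ker, map_sub, this, map_smul, smul_eq_mul, hT.apply_coe ⟨n, hn⟩, sub_self]
  have h2 : w = 0 := by
    rw [LinearMap.mem_ker, map_sub, sub_eq_zero] at h1
    have h3 : w.val 1 = 0 := h1.trans h
    rw [hT.eq_smul_bumpInd hw, h3, zero_smul]
  have h4 := hwZ _ fun n hn => hT.sub_mem_twistedKernel hn f
  rw [h2, zero_sub] at h4
  exact neg_mem_iff.mp h4

theorem twistedTrace_bumpInd (s : ℕ) [Fintype (H s ⧸ (H (s + 1)).subgroupOf (H s))] :
    twistedTrace (compactInd N χ).toRepresentation Θ (H s) (H (s + 1)) (hT.bumpInd (s + 1)) =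
      hT.bumpInd s := by
  have hΘ := hT.isCharOn s
  have hv := eigenvectors_anti _ _ (inf_le_left (a := H (s + 1)) (b := H s))
    (hT.bumpInd_mem_eigenvectors (s + 1))
  rw [hT.eq_smul_bumpInd (twistedTrace_mem hΘ hv)]
  have h1 : (twistedTrace (compactInd N χ).toRepresentation Θ (H s) (H (s + 1))
      (hT.bumpInd (s + 1))).val 1 = 1 := by
    have key : ∀ f, (twistedTrace (compactInd N χ).toRepresentation Θ (H s) (H (s + 1)) f).val 1 =
        ∑ q : H s ⧸ (H (s + 1)).subgroupOf (H s), Θ (q.out : G)⁻¹ * f.val (1 * q.out) := by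
      intro f
      rw [twistedTrace_apply, Submodule.coe_sum, Finset.sum_apply]
      rfl
    rw [key, Finset.sum_eq_single ((1 : H s) : H s ⧸ (H (s + 1)).subgroupOf (H s))]
    · have h2 : ((((1 : H s) : H s ⧸ (H (s + 1)).subgroupOf (H s)).out : H s) : G) ∈ H (s + 1) := by
        have := QuotientGroup.eq.mp
          (QuotientGroup.out_eq' ((1 : H s) : H s ⧸ (H (s + 1)).subgroupOf (H s)))
        have := inv_mem this
        simpa [Subgroup.mem_subgroupOf] using this
      rw [one_mul]
      change _ * bump χ Θ (H (s + 1)) _ = 1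
      rw [bump_of_mem (hT.isCharOn _) hT.apply_coe h2, (hT.isCharOn _).inv_mul_self h2]
    · intro q _ hq
      rw [one_mul]
      change _ * bump χ Θ (H (s + 1)) _ = 0
      by_contra h0
      obtain ⟨n, hn, h, hh, e⟩ := exists_of_bump_ne_zero (right_ne_zero_of_mul h0)
      have h3 := hT.mul_mem_succ s n hn h hh (e ▸ q.out.2)
      rw [← e] at h3
      refine hq ?_
      rw [← QuotientGroup.out_eq' q, QuotientGroup.eq]
      simpa [Subgroup.mem_subgroupOf] using h3
    · simp
  rw [h1, one_smul]

/-- Functions in the compact induction are combinations of translates of `bump χ Θ (H s)`, for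
all large `s`. -/
theorem eventually_mem_span_bumpInd (f : (compactInd N χ).toSubmodule) :
    ∀ᶠ s in atTop, f ∈ Submodule.span A
      (Set.range fun q => (compactInd N χ).toRepresentation q (hT.bumpInd s)) := by
  classical
  obtain ⟨f, ⟨hfN, K, hK, hKf⟩, C, hC, hCf⟩ := f
  have h1 : ∀ᶠ b in 𝓝 (1 : G), ∀ r ∈ C, r⁻¹ * b * r ∈ K := by
    refine hC.eventually_forall_of_forall_eventually fun r _ => ?_
    refine ContinuousAt.eventually_mem (f := fun z : G × G => z.2⁻¹ * z.1 * z.2)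
      (by fun_prop) ?_
    simpa using hK.mem_nhds K.one_mem
  filter_upwards [hT.exists_small _ (h1.and hT.eventually_one),
    hT.eventually_mem_of_mul (hC.mul hC.inv)] with s hs hs'
  have hΘ := hT.isCharOn s
  have hf : ∀ h ∈ H s, ∀ r ∈ C, f (h * r) = Θ h * f r := by
    intro h hh r hr
    obtain ⟨n, hn, hn1, hn2⟩ := hs h hh
    have e1 : h * r = n * (r * (r⁻¹ * (n⁻¹ * h) * r)) := by group
    have e2 : Θ h = Θ n := by
      have := hΘ.map_mul n hn.2 (n⁻¹ * h) ((H s).mul_mem ((H s).inv_mem hn.2) hh)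
      rw [hn2, mul_one] at this
      simpa using this
    rw [e1, hfN ⟨n, hn.1⟩, hKf _ (hn1 r hr), e2, hT.apply_coe ⟨n, hn.1⟩]
  let S : Set (G ⧸ H s) := (fun r : G => ((r⁻¹ : G) : G ⧸ H s)) '' C
  have hS : S.Finite := by
    have := QuotientGroup.discreteTopology (hT.isOpen s)
    have hc : IsCompact S := hC.image (QuotientGroup.continuous_mk.comp continuous_inv)
    exact hc.finite_of_discrete
  have hrep : ∀ c ∈ S, ∃ r ∈ C, ((r⁻¹ : G) : G ⧸ H s) = c := fun c hc => hc
  choose! r hrC hr using hrep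
  have key : ∀ x, ∀ c ∈ S, bump χ Θ (H s) (x * (r c)⁻¹) ≠ 0 →
      f (r c) * bump χ Θ (H s) (x * (r c)⁻¹) = f x := by
    intro x c hc h0
    obtain ⟨n, hn, h, hh, e⟩ := exists_of_bump_ne_zero h0
    have e1 : bump χ Θ (H s) (x * (r c)⁻¹) = χ ⟨n, hn⟩ * Θ h := by
      rw [e]
      exact bump_mul hΘ hT.apply_coe ⟨n, hn⟩ hh
    have e2 : f x = χ ⟨n, hn⟩ * (Θ h * f (r c)) := by
      rw [← hf h hh _ (hrC c hc), ← hfN]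
      congr 1
      rw [eq_comm, ← mul_assoc]
      exact eq_mul_inv_iff_mul_eq.mp e.symm ▸ rfl
    rw [e1, e2]
    ring
  have hsum : ∀ x, f x = ∑ c ∈ hS.toFinset, f (r c) * bump χ Θ (H s) (x * (r c)⁻¹) := by
    intro x
    by_cases hx : f x = 0
    · rw [hx, Finset.sum_eq_zero]
      intro c hc
      by_cases h0 : bump χ Θ (H s) (x * (r c)⁻¹) = 0
      · rw [h0, mul_zero]
      · rw [key x c (hS.mem_toFinset.mp hc) h0, hx]
    · obtain ⟨n, hn, y, hy, rfl⟩ := hCf x hx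
      have hyS : ((y⁻¹ : G) : G ⧸ H s) ∈ S := ⟨y, hy, rfl⟩
      have hbump : ∀ c, bump χ Θ (H s) (n * y * (r c)⁻¹) =
          χ ⟨n, hn⟩ * bump χ Θ (H s) (y * (r c)⁻¹) := fun c => by
        rw [mul_assoc]
        exact bump_mul_left hΘ hT.apply_coe ⟨n, hn⟩ _
      rw [Finset.sum_eq_single ((y⁻¹ : G) : G ⧸ H s)]
      · have h1 : y * (r ((y⁻¹ : G) : G ⧸ H s))⁻¹ ∈ H s := by
          simpa using QuotientGroup.eq.mp (hr _ hyS).symm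
        have h2 := hf _ h1 _ (hrC _ hyS)
        have h3 := hfN ⟨n, hn⟩ y
        simp only [inv_mul_cancel_right] at h2
        rw [hbump, bump_of_mem hΘ hT.apply_coe h1]
        simp only at h3
        rw [h3, h2]
        ring
      · intro c hc hne
        have hcS := hS.mem_toFinset.mp hc
        by_contra h0
        have h1 := right_ne_zero_of_mul (hbump c ▸ right_ne_zero_of_mul h0)
        obtain ⟨m, hm, h, hh, e⟩ := exists_of_bump_ne_zero h1
        have h2 := hs' m hm h hh (e ▸ ⟨y, hy, (r c)⁻¹, Set.inv_mem_inv.mpr (hrC c hcS), rfl⟩)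
        rw [← e] at h2
        refine hne ?_
        rw [← hr c hcS, eq_comm, QuotientGroup.eq]
        simpa using h2
      · intro h
        exact absurd (hS.mem_toFinset.mpr hyS) h
  have hmem : (⟨f, ⟨hfN, K, hK, hKf⟩, C, hC, hCf⟩ : (compactInd N χ).toSubmodule) =
      ∑ c ∈ hS.toFinset, f (r c) • (compactInd N χ).toRepresentation (r c)⁻¹ (hT.bumpInd s) := by
    refine Subtype.ext (funext fun x => ?_)
    rw [Submodule.coe_sum, Finset.sum_apply]
    exact hsum x
  rw [hmem]
  exact Submodule.sum_mem _ fun c _ => Submodule.smul_mem _ _ (Submodule.subset_span ⟨_, rfl⟩)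

end IsRodierTower

end WhittakerFamily

/-! ### Frobenius reciprocity for twisted coinvariants -/

namespace WhittakerFamily

open Filter Topology
open scoped Pointwise

variable {A : Type*} [CommRing A] {G : Type*} [Group G] [TopologicalSpace G] [IsTopologicalGroup G]

namespace IsRodierTower

variable {p : ℕ} {N : Subgroup G} {χ : N →* A} {Θ : G → A} {H : ℕ → Subgroup G}
variable (hT : IsRodierTower p N χ Θ H)
variable {V : Type*} [AddCommGroup V] [Module A V] {ρ : Representation A G V}
include hT

/-- In a trace-compatible sequence `y`, the vector `y s` is a combination of translates of `y t`
for `t ≥ s`, where the translating elements stay in a subgroup `O` independent of `s` and `t`. -/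
theorem mem_span_of_trace {O : Subgroup G}
    (hO : ∀ s, ∀ h ∈ H s, ∃ n ∈ N ⊓ H s, n⁻¹ * h ∈ O) {y : ℕ → V}
    (hy : ∀ s, y s ∈ eigenvectors ρ Θ (H s))
    (hback : ∀ s [Fintype (H s ⧸ (H (s + 1)).subgroupOf (H s))],
      twistedTrace ρ Θ (H s) (H (s + 1)) (y (s + 1)) = y s) {s t : ℕ} (hst : s ≤ t) :
    y s ∈ Submodule.span A ((fun q => ρ q (y t)) '' (O : Set G)) := by
  induction t, hst using Nat.le_induction with
  | base => exact Submodule.subset_span ⟨1, O.one_mem, by simp⟩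
  | succ t _ ih =>
    have := hT.finite_quotient t (hT.isOpen (t + 1))
    let := Fintype.ofFinite (H t ⧸ (H (t + 1)).subgroupOf (H t))
    have h1 : y t ∈ Submodule.span A ((fun q => ρ q (y (t + 1))) '' (O : Set G)) := by
      have key : ∀ q : H t ⧸ (H (t + 1)).subgroupOf (H t), ∃ z : H t,
          (z : H t ⧸ (H (t + 1)).subgroupOf (H t)) = q ∧ (z : G) ∈ O := by
        intro q
        obtain ⟨n, hn, hnq⟩ := hO t (q.out : G)⁻¹ ((H t).inv_mem q.out.2)
        have hz : (n⁻¹ * (q.out : G)⁻¹)⁻¹ ∈ H t :=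
          (H t).inv_mem ((H t).mul_mem ((H t).inv_mem hn.2) ((H t).inv_mem q.out.2))
        refine ⟨⟨_, hz⟩, ?_, O.inv_mem hnq⟩
        conv_rhs => rw [← QuotientGroup.out_eq' q]
        rw [QuotientGroup.eq]
        simpa [Subgroup.mem_subgroupOf] using hT.inf_le_succ t hn
      choose r hr hrO using key
      rw [← hback t, twistedTrace_eq_of_rep (hT.isCharOn t)
        (eigenvectors_anti _ _ inf_le_left (hy (t + 1))) r hr]
      exact Submodule.sum_mem _ fun q _ =>
        Submodule.smul_mem _ _ (Submodule.subset_span ⟨_, hrO q, rfl⟩)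
    refine Submodule.span_le.mpr ?_ ih
    rintro _ ⟨q, hq, rfl⟩
    have h2 := Submodule.mem_map_of_mem (f := ρ q) h1
    rw [Submodule.map_span] at h2
    refine Submodule.span_mono ?_ h2
    rintro _ ⟨_, ⟨r, hr, rfl⟩, rfl⟩
    refine ⟨q * r, O.mul_mem hq hr, ?_⟩
    simp

/-- If the translates of `bump χ Θ (H s)` by a set `Ω` have equal or disjoint supports, then
these translates satisfy no other linear relations than those satisfied by the translates of any
vector on which `H s` acts through `Θ`. -/
theorem eq_zero_of_mem_span {s : ℕ} {Ω : Set G}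
    (hΩ : ∀ q ∈ Ω, ∀ r ∈ Ω, ∀ n ∈ N, ∀ h ∈ H s, r⁻¹ * q = n * h → n * h ∈ H s)
    {y : (compactInd N χ).toSubmodule × V} (hy1 : y.1 = hT.bumpInd s)
    (hy2 : y.2 ∈ eigenvectors ρ Θ (H s)) {w : (compactInd N χ).toSubmodule × V}
    (hw : w ∈ Submodule.span A
      ((fun q => ((compactInd N χ).toRepresentation.prod ρ) q y) '' Ω)) (hw0 : w.1 = 0) :
    w.2 = 0 := by
  classical
  have hΘ := hT.isCharOn s
  obtain ⟨l, hl, rfl⟩ := (Finsupp.mem_span_image_iff_linearCombination A).mp hw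
  rw [Finsupp.mem_supported] at hl
  let S : Finset (G ⧸ H s) := l.support.image (QuotientGroup.mk : G → G ⧸ H s)
  have hrep : ∀ c ∈ S, ∃ q ∈ l.support, (q : G ⧸ H s) = c := fun c hc => Finset.mem_image.mp hc
  choose! r hrl hr using hrep
  -- The map sending each translate of the bump function to the same translate of `y.2`.
  let T : (compactInd N χ).toSubmodule →ₗ[A] V :=
    { toFun := fun f => ∑ c ∈ S, f.val (r c)⁻¹ • ρ (r c) y.2
      map_add' := fun f g => by
        rw [← Finset.sum_add_distrib]
        exact Finset.sum_congr rfl fun c _ => add_smul _ _ _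
      map_smul' := fun a f => by
        rw [RingHom.id_apply, Finset.smul_sum]
        exact Finset.sum_congr rfl fun c _ => mul_smul _ _ _ }
  have hTq : ∀ q ∈ l.support, T ((compactInd N χ).toRepresentation q y.1) = ρ q y.2 := by
    intro q hq
    have hval : ∀ c, ((compactInd N χ).toRepresentation q y.1).val (r c)⁻¹ =
        bump χ Θ (H s) ((r c)⁻¹ * q) := fun c => by rw [hy1]; rfl
    have hqS : (q : G ⧸ H s) ∈ S := Finset.mem_image_of_mem _ hq
    change ∑ c ∈ S, ((compactInd N χ).toRepresentation q y.1).val (r c)⁻¹ • ρ (r c) y.2 = _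
    rw [Finset.sum_eq_single (q : G ⧸ H s)]
    · have h1 := QuotientGroup.eq.mp (hr _ hqS)
      rw [hval, bump_of_mem hΘ hT.apply_coe h1, ← map_smul, ← hy2 _ h1, ← Module.End.mul_apply,
        ← map_mul, mul_inv_cancel_left]
    · intro c hc hne
      by_cases h0 : bump χ Θ (H s) ((r c)⁻¹ * q) = 0
      · rw [hval, h0, zero_smul]
      · obtain ⟨n, hn, h, hh, e⟩ := exists_of_bump_ne_zero h0
        have h2 := hΩ q (hl hq) (r c) (hl (hrl c hc)) n hn h hh e
        rw [← e] at h2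
        exact absurd ((hr c hc).symm.trans (QuotientGroup.eq.mpr h2)) hne.symm.symm
    · exact fun h => absurd hqS h
  have hsum : ∀ z : (compactInd N χ).toSubmodule × V,
      z = Finsupp.linearCombination A
        (fun q => ((compactInd N χ).toRepresentation.prod ρ) q y) l → z.2 = T z.1 := by
    rintro z rfl
    rw [Finsupp.linearCombination_apply, Finsupp.sum, Prod.snd_sum, Prod.fst_sum, map_sum]
    refine Finset.sum_congr rfl fun q hq => ?_
    rw [Prod.smul_snd, Prod.smul_fst, map_smul]
    exact congrArg _ (hTq q hq).symm
  rw [hsum _ rfl, hw0, map_zero]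

/-- Frobenius reciprocity for the twisted coinvariants, existence part, for a class represented
by a vector on which `H 0` acts through `Θ`. The graph of the map is spanned by the translates
of the pairs formed by `bump χ Θ (H s)` and the vector corresponding to `m` at level `s`. -/
theorem exists_intertwiningMap_zero {O : Subgroup G} (hOc : IsCompact (O : Set G))
    (hO : ∀ s, ∀ h ∈ H s, ∃ n ∈ N ⊓ H s, n⁻¹ * h ∈ O)
    {m : V} (hm : m ∈ eigenvectors ρ Θ (H 0)) :
    ∃ φ : (compactInd N χ).toRepresentation.IntertwiningMap ρ, φ (hT.bumpInd 0) = m := by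
  obtain ⟨u, rfl, hu, hback, -⟩ := hT.exists_seq hm
  let π := (compactInd N χ).toRepresentation.prod ρ
  let y : ℕ → (compactInd N χ).toSubmodule × V := fun s => (hT.bumpInd s, u s)
  have hy : ∀ s, y s ∈ eigenvectors π Θ (H s) := fun s k hk =>
    Prod.ext (hT.bumpInd_mem_eigenvectors s k hk) (hu s k hk)
  have hyback : ∀ s [Fintype (H s ⧸ (H (s + 1)).subgroupOf (H s))],
      twistedTrace π Θ (H s) (H (s + 1)) (y (s + 1)) = y s := by
    intro s _
    rw [twistedTrace_apply]
    refine Prod.ext ?_ ?_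
    · change _ = hT.bumpInd s
      rw [Prod.fst_sum, ← hT.twistedTrace_bumpInd s, twistedTrace_apply]
      rfl
    · change _ = u s
      rw [Prod.snd_sum, ← hback s, twistedTrace_apply]
      rfl
  let R : Submodule A ((compactInd N χ).toSubmodule × V) :=
    Submodule.span A (Set.range fun q : G × ℕ => π q.1 (y q.2))
  have hRπ : ∀ g : G, ∀ w ∈ R, π g w ∈ R := by
    intro g w hw
    have h2 := Submodule.mem_map_of_mem (f := π g) hw
    rw [Submodule.map_span] at h2
    refine Submodule.span_mono ?_ h2
    rintro _ ⟨_, ⟨⟨q, s⟩, rfl⟩, rfl⟩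
    exact ⟨(g * q, s), by simp⟩
  have hbounded : ∀ w ∈ R, ∃ Ω : Set G, IsCompact Ω ∧
      ∀ᶠ t in atTop, w ∈ Submodule.span A ((fun q => π q (y t)) '' Ω) := by
    intro w hw
    induction hw using Submodule.span_induction with
    | mem w hw =>
      obtain ⟨⟨q, s⟩, rfl⟩ := hw
      refine ⟨q • (O : Set G), hOc.smul q, ?_⟩
      filter_upwards [eventually_ge_atTop s] with t ht
      have h1 := hT.mem_span_of_trace hO hy hyback ht
      have h2 := Submodule.mem_map_of_mem (f := π q) h1
      rw [Submodule.map_span] at h2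
      refine Submodule.span_mono ?_ h2
      rintro _ ⟨_, ⟨r, hr, rfl⟩, rfl⟩
      exact ⟨q * r, Set.smul_mem_smul_set hr, by simp⟩
    | zero => exact ⟨∅, isCompact_empty, .of_forall fun t => Submodule.zero_mem _⟩
    | add w z _ _ hw hz =>
      obtain ⟨Ω, hΩ, h1⟩ := hw
      obtain ⟨Ω', hΩ', h2⟩ := hz
      refine ⟨Ω ∪ Ω', hΩ.union hΩ', ?_⟩
      filter_upwards [h1, h2] with t h1 h2
      exact Submodule.add_mem _
        (Submodule.span_mono (Set.image_mono Set.subset_union_left) h1)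
        (Submodule.span_mono (Set.image_mono Set.subset_union_right) h2)
    | smul a w _ hw =>
      obtain ⟨Ω, hΩ, h1⟩ := hw
      exact ⟨Ω, hΩ, h1.mono fun t h => Submodule.smul_mem _ a h⟩
  have hgraph : ∀ w ∈ R, w.1 = 0 → w.2 = 0 := by
    intro w hw hw0
    obtain ⟨Ω, hΩ, h⟩ := hbounded w hw
    obtain ⟨t, ht, ht'⟩ := (h.and (hT.eventually_mem_of_mul (hΩ.inv.mul hΩ))).exists
    refine hT.eq_zero_of_mem_span (Ω := Ω) ?_ (y := y t) rfl (hu t) ht hw0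
    intro q hq r hr n hn h hh e
    exact ht' n hn h hh (e ▸ ⟨r⁻¹, Set.inv_mem_inv.mpr hr, q, hq, rfl⟩)
  have hex : ∀ f : (compactInd N χ).toSubmodule, ∃ v : V, (f, v) ∈ R := by
    intro f
    obtain ⟨t, ht⟩ := (hT.eventually_mem_span_bumpInd f).exists
    have h1 : Submodule.span A
        (Set.range fun q => (compactInd N χ).toRepresentation q (hT.bumpInd t)) ≤
        R.map (LinearMap.fst A _ V) := by
      refine Submodule.span_le.mpr ?_
      rintro _ ⟨q, rfl⟩
      exact ⟨π q (y t), Submodule.subset_span ⟨(q, t), rfl⟩, rfl⟩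
    obtain ⟨⟨f', v⟩, hv, rfl⟩ := h1 ht
    exact ⟨v, hv⟩
  choose φ hφ using hex
  have huniq : ∀ f v, (f, v) ∈ R → φ f = v := by
    intro f v hv
    have := hgraph _ (Submodule.sub_mem _ (hφ f) hv) (sub_self f)
    exact sub_eq_zero.mp this
  refine ⟨LinearMap.intertwiningMap_of_isIntertwiningMap _ _
    { toFun := φ
      map_add' := fun f g => huniq _ _ (Submodule.add_mem _ (hφ f) (hφ g))
      map_smul' := fun a f => huniq _ _ (Submodule.smul_mem _ a (hφ f)) }
    fun g f => huniq _ _ (hRπ g _ (hφ f)), huniq _ _ (Submodule.subset_span ⟨(1, 0), ?_⟩)⟩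
  simp [y]

/-- Frobenius reciprocity for the twisted coinvariants, existence part: every class of twisted
coinvariants of a smooth module comes from a map out of the compact induction. -/
theorem exists_intertwiningMap (hρ : IsSmooth ρ) (m : V) :
    ∃ φ : (compactInd N χ).toRepresentation.IntertwiningMap ρ,
      ∀ f, φ f - f.val 1 • m ∈ twistedKernel ρ N χ := by
  obtain ⟨L, hL, hLm⟩ := hT.exists_mem_eigenvectors hρ m
  have h0 : (H 0 : Set G) ∈ 𝓝 (1 : G) := (hT.isOpen 0).mem_nhds (H 0).one_mem
  obtain ⟨t, ht, hO⟩ :=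
    ((hT.eventually_exists_lift hL hLm).and
      (eventually_forall_ge_atTop.mpr (hT.exists_small _ h0))).exists
  obtain ⟨w, hw, hwm⟩ := ht
  have hT' := hT.shift t
  obtain ⟨φ, hφ⟩ := hT'.exists_intertwiningMap_zero (O := H 0) (hT.isCompact 0)
    (fun s => hO (s + t) (Nat.le_add_left _ _)) (by simpa using hw)
  refine ⟨φ, fun f => ?_⟩
  have h1 : f - f.val 1 • hT'.bumpInd 0 ∈
      twistedKernel (compactInd N χ).toRepresentation N χ := by
    rw [hT.mem_twistedKernel_iff]
    change f.val 1 - f.val 1 * (hT'.bumpInd 0).val 1 = 0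
    rw [hT'.bumpInd_apply_one, mul_one, sub_self]
  have h2 : φ (f - f.val 1 • hT'.bumpInd 0) ∈ twistedKernel ρ N χ :=
    map_mem_twistedKernel φ h1
  rw [map_sub, map_smul, hφ] at h2
  have h3 := Submodule.smul_mem _ (f.val 1) (hwm _ fun n hn => hT.sub_mem_twistedKernel hn m)
  have h4 := Submodule.add_mem _ h2 h3
  rw [smul_sub] at h4
  simpa using h4

/-- Frobenius reciprocity for the twisted coinvariants, uniqueness part. -/
theorem eq_zero_of_forall_mem_twistedKernel (hρ : IsSmooth ρ)
    (φ : (compactInd N χ).toRepresentation.IntertwiningMap ρ)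
    (hφ : ∀ f, φ f ∈ twistedKernel ρ N χ) (f : (compactInd N χ).toSubmodule) : φ f = 0 := by
  obtain ⟨s, hs⟩ := (hT.eventually_mem_span_bumpInd f).exists
  have h0 : φ (hT.bumpInd s) = 0 := by
    refine hT.eq_zero_of_mem_twistedKernel hρ (s := s) (fun k hk => ?_) (hφ _)
    rw [← φ.isIntertwining, hT.bumpInd_mem_eigenvectors s k hk, map_smul]
  refine (Submodule.span_le (p := LinearMap.ker φ.toLinearMap)).mpr ?_ hs
  rintro _ ⟨q, rfl⟩
  change φ _ = 0
  rw [φ.isIntertwining, h0, map_zero]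

end IsRodierTower

end WhittakerFamily

/-! ### Whittaker spaces and Schwartz functions -/

namespace WhittakerFamily

section WhittakerSpace

variable {n : ℕ} {F : Type*} [Field F] {A : Type*} [CommRing A]
variable {V : Type*} [AddCommGroup V] [Module A V]
variable (ρ : Representation A (GL (Fin n) F) V) (ψ : AddChar F A)
variable (e : TopDerivative (resMirabolic ρ) ψ ≃ₗ[A] A)

/-- Evaluation at `1` on the Whittaker space. -/
def whittakerEval : (whittakerSpace ρ ψ e).toSubmodule →ₗ[A] A where
  toFun w := w.val 1
  map_add' _ _ := rfl
  map_smul' _ _ := rfl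

theorem whittakerEval_surjective : Function.Surjective (whittakerEval ρ ψ e) := by
  intro a
  obtain ⟨v, hv⟩ := Submodule.mkQ_surjective _ (e.symm a)
  refine ⟨⟨whittakerMap ρ ψ e v, v, rfl⟩, ?_⟩
  change e (toTopDerivative ρ ψ (ρ 1 v)) = a
  rw [map_one, Module.End.one_apply]
  exact (congrArg e hv).trans (e.apply_symm_apply a)

/-- Evaluation at `1` identifies the highest derivative of the Whittaker space with `A`. -/
theorem mem_twistedKernel_whittaker_iff (w : (whittakerSpace ρ ψ e).toSubmodule) :
    w ∈ twistedKernel (resMirabolic (whittakerRep ρ ψ e)) (unipotentInMirabolic n F)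
      (genericCharMirabolic ψ) ↔ whittakerEval ρ ψ e w = 0 := by
  constructor
  · intro h
    refine twistedKernel_le_ker (whittakerEval ρ ψ e) (fun u w => ?_) h
    obtain ⟨_, v, rfl⟩ := w
    change e (toTopDerivative ρ ψ (ρ (1 * u.1.1) v)) =
      genericCharMirabolic ψ u * e (toTopDerivative ρ ψ (ρ 1 v))
    rw [one_mul, map_one, Module.End.one_apply, ← smul_eq_mul, ← map_smul, ← map_smul,
      ← sub_eq_zero, ← map_sub, ← map_sub]
    refine (LinearEquiv.map_eq_zero_iff e).mpr ((Submodule.Quotient.mk_eq_zero _).mpr ?_)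
    exact Submodule.subset_span ⟨u, v, rfl⟩
  · intro h
    obtain ⟨_, v, rfl⟩ := w
    let f : V →ₗ[A] (whittakerSpace ρ ψ e).toSubmodule := (whittakerMap ρ ψ e).rangeRestrict
    have hv : v ∈ twistedKernel (resMirabolic ρ) (unipotentInMirabolic n F)
        (genericCharMirabolic ψ) := by
      change e (toTopDerivative ρ ψ (ρ 1 v)) = 0 at h
      rw [map_one, Module.End.one_apply] at h
      exact (Submodule.Quotient.mk_eq_zero _).mp ((LinearEquiv.map_eq_zero_iff e).mp h)
    refine (Submodule.span_le (p := (twistedKernel (resMirabolic (whittakerRep ρ ψ e))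
      (unipotentInMirabolic n F) (genericCharMirabolic ψ)).comap f)).mpr ?_ hv
    rintro _ ⟨u, v, rfl⟩
    refine Submodule.subset_span ⟨u, f v, ?_⟩
    rw [map_sub, map_smul]
    congr 1
    refine Subtype.ext (funext fun x => ?_)
    change e (toTopDerivative ρ ψ (ρ x (ρ u.1.1 v))) = e (toTopDerivative ρ ψ (ρ (x * u.1.1) v))
    rw [map_mul]
    rfl

/-- The `A[G_n]`-endomorphisms of the Whittaker space are the scalars, since such an endomorphism
is determined by its effect on values at `1`. -/
theorem bijective_algebraMap_whittaker :
    Function.Bijective (algebraMap A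
      ((whittakerRep ρ ψ e).IntertwiningMap (whittakerRep ρ ψ e))) := by
  obtain ⟨w₀, hw₀⟩ := whittakerEval_surjective ρ ψ e 1
  constructor
  · intro a b hab
    have h1 : a • w₀ = b • w₀ := congrArg (fun φ => φ w₀) hab
    have h2 := congrArg (whittakerEval ρ ψ e) h1
    simpa [hw₀] using h2
  · intro φ
    have h1 : ∀ w, whittakerEval ρ ψ e (φ w) =
        whittakerEval ρ ψ e (φ w₀) * whittakerEval ρ ψ e w := by
      intro w
      let f : (resMirabolic (whittakerRep ρ ψ e)).IntertwiningMap
          (resMirabolic (whittakerRep ρ ψ e)) :=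
        ⟨φ.toLinearMap, fun g => φ.isIntertwining' g⟩
      have h2 : w - whittakerEval ρ ψ e w • w₀ ∈
          twistedKernel (resMirabolic (whittakerRep ρ ψ e)) (unipotentInMirabolic n F)
            (genericCharMirabolic ψ) := by
        rw [mem_twistedKernel_whittaker_iff, map_sub, map_smul, hw₀, smul_eq_mul, mul_one, sub_self]
      have h3 := map_mem_twistedKernel f h2
      rw [mem_twistedKernel_whittaker_iff] at h3
      change whittakerEval ρ ψ e (φ _) = 0 at h3
      rw [map_sub, map_smul, map_sub, map_smul, sub_eq_zero] at h3
      rw [h3, smul_eq_mul, mul_comm]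
    refine ⟨whittakerEval ρ ψ e (φ w₀), ?_⟩
    refine Representation.IntertwiningMap.ext (LinearMap.ext fun w => ?_)
    refine Subtype.ext (funext fun g => ?_)
    have h2 := h1 (whittakerRep ρ ψ e g w)
    rw [φ.isIntertwining] at h2
    change (φ w).val (1 * g) = whittakerEval ρ ψ e (φ w₀) * w.val (1 * g) at h2
    rw [one_mul] at h2
    exact h2.symm

variable [TopologicalSpace F] [IsTopologicalRing F]

omit [IsTopologicalRing F] in
theorem isSmooth_resMirabolic_whittaker (hρ : IsSmooth ρ) :
    IsSmooth (resMirabolic (whittakerRep ρ ψ e)) := by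
  rintro ⟨_, v, rfl⟩
  obtain ⟨K, hK, hKv⟩ := hρ v
  refine ⟨K.comap (mirabolic n F).subtype, hK.preimage continuous_subtype_val, fun g hg => ?_⟩
  refine Subtype.ext (funext fun x => ?_)
  change e (toTopDerivative ρ ψ (ρ (x * g.1) v)) = e (toTopDerivative ρ ψ (ρ x v))
  rw [map_mul, Module.End.mul_apply, hKv g.1 hg]

variable {p : ℕ} {Θ : mirabolic n F → A} {H : ℕ → Subgroup (mirabolic n F)}
variable (hT : IsRodierTower p (unipotentInMirabolic n F) (genericCharMirabolic ψ) Θ H)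
include hT

omit e in
variable {ρ ψ} in
/-- A map out of the Gelfand-Graev representation multiplies values at `1` by a constant. -/
theorem eval_intertwiningMap {M : Type*} [AddCommGroup M] [Module A M]
    {τ : Representation A (mirabolic n F) M} (ev : M →ₗ[A] A)
    (hev : ∀ m ∈ twistedKernel τ (unipotentInMirabolic n F) (genericCharMirabolic ψ), ev m = 0)
    (φ : (gelfandGraev n ψ).toRepresentation.IntertwiningMap τ)
    (f : (gelfandGraev n ψ).toSubmodule) :
    ev (φ f) = f.val 1 * ev (φ (hT.bumpInd 0)) := by
  have h1 : f - f.val 1 • hT.bumpInd 0 ∈ twistedKernel (gelfandGraev n ψ).toRepresentation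
      (unipotentInMirabolic n F) (genericCharMirabolic ψ) := by
    rw [hT.mem_twistedKernel_iff]
    change f.val 1 - f.val 1 * (hT.bumpInd 0).val 1 = 0
    rw [hT.bumpInd_apply_one, mul_one, sub_self]
  have h2 := hev _ (map_mem_twistedKernel φ h1)
  rw [map_sub, map_smul, map_sub, map_smul, sub_eq_zero] at h2
  exact h2

variable {ρ ψ e}

/-- A map from the Gelfand-Graev representation to the Whittaker space is determined by its
effect on values at `1`. -/
theorem intertwiningMap_whittaker_ext (hρ : IsSmooth ρ)
    {φ φ' : (gelfandGraev n ψ).toRepresentation.IntertwiningMap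
      (resMirabolic (whittakerRep ρ ψ e))}
    (h : ∀ f, whittakerEval ρ ψ e (φ f) = whittakerEval ρ ψ e (φ' f)) : φ = φ' := by
  rw [← sub_eq_zero]
  refine Representation.IntertwiningMap.ext (LinearMap.ext fun f => ?_)
  refine hT.eq_zero_of_forall_mem_twistedKernel (isSmooth_resMirabolic_whittaker ρ ψ e hρ)
    (φ - φ') (fun f => ?_) f
  rw [mem_twistedKernel_whittaker_iff]
  change whittakerEval ρ ψ e (φ f - φ' f) = 0
  rw [map_sub, h, sub_self]

/-- The value at `1` of the image of the bump function decides whether a map to the Whittaker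
space induces an isomorphism on highest derivatives. -/
theorem bijective_map_iff
    (φ : (gelfandGraev n ψ).toRepresentation.IntertwiningMap
      (resMirabolic (whittakerRep ρ ψ e))) :
    Function.Bijective (TwistedCoinvariants.map (unipotentInMirabolic n F)
      (genericCharMirabolic ψ) φ) ↔ IsUnit (whittakerEval ρ ψ e (φ (hT.bumpInd 0))) := by
  have hφ := eval_intertwiningMap hT (whittakerEval ρ ψ e)
    (fun m hm => (mem_twistedKernel_whittaker_iff ρ ψ e m).mp hm) φ
  obtain ⟨w₀, hw₀⟩ := whittakerEval_surjective ρ ψ e 1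
  constructor
  · intro h
    obtain ⟨q, hq⟩ := h.2 (Submodule.Quotient.mk w₀)
    obtain ⟨f, rfl⟩ := Submodule.Quotient.mk_surjective _ q
    have h1 : φ f - w₀ ∈ twistedKernel (resMirabolic (whittakerRep ρ ψ e))
      (unipotentInMirabolic n F) (genericCharMirabolic ψ) := (Submodule.Quotient.eq _).mp hq
    rw [mem_twistedKernel_whittaker_iff, map_sub, hφ, hw₀, sub_eq_zero] at h1
    exact .of_mul_eq_one _ (mul_comm _ _ |>.trans h1)
  · rintro ⟨u, hu⟩
    rw [← hu] at hφ
    constructor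
    · rw [injective_iff_map_eq_zero]
      intro q hq
      obtain ⟨f, rfl⟩ := Submodule.Quotient.mk_surjective _ q
      have h1 := (Submodule.Quotient.mk_eq_zero _).mp hq
      have h2 := (mem_twistedKernel_whittaker_iff ρ ψ e (φ f)).mp h1
      rw [hφ] at h2
      refine (Submodule.Quotient.mk_eq_zero _).mpr ((hT.mem_twistedKernel_iff f).mpr ?_)
      exact (Units.mul_left_eq_zero u).mp h2
    · intro q
      obtain ⟨w, rfl⟩ := Submodule.Quotient.mk_surjective _ q
      refine ⟨Submodule.Quotient.mk ((whittakerEval ρ ψ e w * ↑u⁻¹) • hT.bumpInd 0), ?_⟩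
      refine (Submodule.Quotient.eq _).mpr ?_
      rw [mem_twistedKernel_whittaker_iff, map_sub]
      change whittakerEval ρ ψ e (φ (_ • hT.bumpInd 0)) - _ = 0
      rw [map_smul, map_smul, ← hu, smul_eq_mul, mul_assoc, Units.inv_mul, mul_one, sub_self]

theorem injective_of_isUnit
    (φ : (gelfandGraev n ψ).toRepresentation.IntertwiningMap
      (resMirabolic (whittakerRep ρ ψ e)))
    (hu : IsUnit (whittakerEval ρ ψ e (φ (hT.bumpInd 0)))) : Function.Injective φ := by
  have hφ := eval_intertwiningMap hT (whittakerEval ρ ψ e)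
    (fun m hm => (mem_twistedKernel_whittaker_iff ρ ψ e m).mp hm) φ
  rw [injective_iff_map_eq_zero]
  intro f hf
  refine Subtype.ext (funext fun x => ?_)
  have h1 := hφ ((gelfandGraev n ψ).toRepresentation x f)
  rw [φ.isIntertwining, hf, map_zero, map_zero] at h1
  have h2 : f.val (1 * x) = 0 := hu.mul_left_eq_zero.mp h1.symm
  rwa [one_mul] at h2

theorem exists_isSchwartzSpace (hρ : IsSmooth ρ) :
    ∃ S : Subrepresentation (resMirabolic (whittakerRep ρ ψ e)), IsSchwartzSpace ψ S := by
  obtain ⟨w₀, hw₀⟩ := whittakerEval_surjective ρ ψ e 1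
  obtain ⟨φ, hφ⟩ := hT.exists_intertwiningMap (isSmooth_resMirabolic_whittaker ρ ψ e hρ) w₀
  have hu : IsUnit (whittakerEval ρ ψ e (φ (hT.bumpInd 0))) := by
    have h1 := (mem_twistedKernel_whittaker_iff ρ ψ e _).mp (hφ (hT.bumpInd 0))
    rw [hT.bumpInd_apply_one, one_smul, map_sub, hw₀, sub_eq_zero] at h1
    rw [h1]
    exact isUnit_one
  exact ⟨φ.range, φ, injective_of_isUnit hT φ hu, (bijective_map_iff hT φ).mpr hu, rfl⟩

/-- Any map from the Gelfand-Graev representation to the Whittaker space is a multiple of any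
such map inducing an isomorphism on highest derivatives. -/
theorem exists_eq_smul (hρ : IsSmooth ρ)
    (φ φ' : (gelfandGraev n ψ).toRepresentation.IntertwiningMap
      (resMirabolic (whittakerRep ρ ψ e)))
    (hu : IsUnit (whittakerEval ρ ψ e (φ (hT.bumpInd 0)))) :
    ∃ a : A, φ' = a • φ := by
  have hker := fun m hm => (mem_twistedKernel_whittaker_iff ρ ψ e m).mp hm
  have hφ := eval_intertwiningMap hT (whittakerEval ρ ψ e) hker φ
  have hφ' := eval_intertwiningMap hT (whittakerEval ρ ψ e) hker φ'
  obtain ⟨u, hu⟩ := hu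
  refine ⟨whittakerEval ρ ψ e (φ' (hT.bumpInd 0)) * ↑u⁻¹,
    intertwiningMap_whittaker_ext hT hρ fun f => ?_⟩
  change _ = whittakerEval ρ ψ e ((_ : A) • φ f)
  rw [map_smul, hφ, hφ', ← hu, smul_eq_mul, mul_left_comm, mul_assoc, Units.inv_mul, mul_one]

theorem isSchwartzSpace_le (hρ : IsSmooth ρ)
    {S S' : Subrepresentation (resMirabolic (whittakerRep ρ ψ e))}
    (hS : IsSchwartzSpace ψ S) (hS' : IsSchwartzSpace ψ S') : S ≤ S' := by
  obtain ⟨φ, -, -, rfl⟩ := hS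
  obtain ⟨φ', -, hb, rfl⟩ := hS'
  obtain ⟨a, rfl⟩ := exists_eq_smul hT hρ φ' φ ((bijective_map_iff hT φ').mp hb)
  rintro _ ⟨f, rfl⟩
  exact ⟨a • f, map_smul φ' a f⟩

theorem bijective_algebraMap_schwartz (hρ : IsSmooth ρ)
    {S : Subrepresentation (resMirabolic (whittakerRep ρ ψ e))} (hS : IsSchwartzSpace ψ S) :
    Function.Bijective (algebraMap A
      (S.toRepresentation.IntertwiningMap S.toRepresentation)) := by
  obtain ⟨φ, -, hb, rfl⟩ := hS
  have hu := (bijective_map_iff hT φ).mp hb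
  constructor
  · intro a b hab
    have h1 := congrArg (fun θ => (θ ⟨φ (hT.bumpInd 0), hT.bumpInd 0, rfl⟩).val) hab
    have h2 : a • φ (hT.bumpInd 0) = b • φ (hT.bumpInd 0) := h1
    have h3 := congrArg (whittakerEval ρ ψ e) h2
    rw [map_smul, map_smul] at h3
    exact hu.mul_right_cancel h3
  · intro θ
    let r : (gelfandGraev n ψ).toSubmodule →ₗ[A] φ.range.toSubmodule :=
      φ.toLinearMap.rangeRestrict
    let φ' : (gelfandGraev n ψ).toRepresentation.IntertwiningMap
        (resMirabolic (whittakerRep ρ ψ e)) :=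
      LinearMap.intertwiningMap_of_isIntertwiningMap _ _
        (φ.range.toSubmodule.subtype ∘ₗ θ.toLinearMap ∘ₗ r) (by
          intro g f
          have h1 : r ((gelfandGraev n ψ).toRepresentation g f) =
              φ.range.toRepresentation g (r f) :=
            Subtype.ext (Representation.IntertwiningMap.isIntertwining _ _ φ g f)
          change (θ (r ((gelfandGraev n ψ).toRepresentation g f))).val = _
          rw [h1, θ.isIntertwining]
          rfl)
    obtain ⟨a, ha⟩ := exists_eq_smul hT hρ φ φ' hu
    refine ⟨a, Representation.IntertwiningMap.ext (LinearMap.ext ?_)⟩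
    rintro ⟨_, f, rfl⟩
    exact Subtype.ext (congrArg (fun φ => φ f) ha).symm

/-- The statements on Whittaker spaces, for a smooth module and a character that admits a Rodier
tower. -/
theorem whittaker_of_isRodierTower (hρ : IsSmooth ρ) :
    Function.Bijective (algebraMap A
      ((whittakerRep ρ ψ e).IntertwiningMap (whittakerRep ρ ψ e))) ∧
    (∃! S : Subrepresentation (resMirabolic (whittakerRep ρ ψ e)), IsSchwartzSpace ψ S) ∧
    ∀ S : Subrepresentation (resMirabolic (whittakerRep ρ ψ e)), IsSchwartzSpace ψ S →
      ∃ res : (whittakerRep ρ ψ e).IntertwiningMap (whittakerRep ρ ψ e) ≃ₐ[A]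
          S.toRepresentation.IntertwiningMap S.toRepresentation,
        ∀ φ (s : S.toSubmodule), (res φ s).val = φ s.val := by
  refine ⟨bijective_algebraMap_whittaker ρ ψ e, ?_, fun S hS => ?_⟩
  · obtain ⟨S, hS⟩ := exists_isSchwartzSpace (e := e) hT hρ
    exact ⟨S, hS, fun S' hS' => le_antisymm (isSchwartzSpace_le hT hρ hS' hS)
      (isSchwartzSpace_le hT hρ hS hS')⟩
  · let e₁ := AlgEquiv.ofBijective (Algebra.ofId A _) (bijective_algebraMap_whittaker ρ ψ e)
    let e₂ := AlgEquiv.ofBijective (Algebra.ofId A _) (bijective_algebraMap_schwartz hT hρ hS)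
    refine ⟨e₁.symm.trans e₂, fun φ s => ?_⟩
    obtain ⟨a, rfl⟩ := e₁.surjective φ
    rw [AlgEquiv.trans_apply, AlgEquiv.symm_apply_apply]
    rfl

end WhittakerSpace

end WhittakerFamily

/-! ### Balls in a local field and conductors -/

namespace WhittakerFamily

open Filter Topology ValuativeRel

section LocalField

variable {F : Type*} [Field F] [ValuativeRel F] [TopologicalSpace F] [IsNonarchimedeanLocalField F]

variable (F) in
/-- The normalized valuation of a local field, with values in `ℤᵐ⁰`. -/
noncomputable def normVal : Valuation F (WithZero (Multiplicative ℤ)) :=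
  (valuation F).map (MonoidWithZeroHom.ofClass
    (IsNonarchimedeanLocalField.valueGroupWithZeroIsoInt F))
    (IsNonarchimedeanLocalField.valueGroupWithZeroIsoInt F).toOrderIso.monotone

theorem normVal_le_iff {x : F} {γ : WithZero (Multiplicative ℤ)} : normVal F x ≤ γ ↔
    valuation F x ≤ (IsNonarchimedeanLocalField.valueGroupWithZeroIsoInt F).symm γ := by
  rw [← map_le_map_iff (IsNonarchimedeanLocalField.valueGroupWithZeroIsoInt F),
    OrderMonoidIso.apply_symm_apply]
  rfl

variable (F) in
/-- The fractional ideal of elements of valuation at least `a`. -/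
noncomputable def ball (a : ℤ) : AddSubgroup F where
  carrier := {x | normVal F x ≤ WithZero.exp (-a)}
  zero_mem' := by simp
  add_mem' hx hy := (normVal F).map_add_le hx hy
  neg_mem' := by simp

theorem mem_ball {a : ℤ} {x : F} : x ∈ ball F a ↔ normVal F x ≤ WithZero.exp (-a) := Iff.rfl

theorem ball_anti {a b : ℤ} (h : a ≤ b) {x : F} (hx : x ∈ ball F b) : x ∈ ball F a := by
  rw [mem_ball] at *
  exact hx.trans (WithZero.exp_le_exp.mpr (by omega))

theorem mul_mem_ball {a b c : ℤ} {x y : F} (hx : x ∈ ball F a) (hy : y ∈ ball F b)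
    (h : c ≤ a + b) : x * y ∈ ball F c := by
  refine ball_anti h ?_
  rw [mem_ball] at *
  rw [map_mul, neg_add, WithZero.exp_add]
  exact mul_le_mul' hx hy

theorem one_mem_ball {a : ℤ} (h : a ≤ 0) : (1 : F) ∈ ball F a := by
  refine ball_anti h ?_
  simp [mem_ball]

theorem inv_mem_ball {a : ℤ} {x : F} (hx : x ∉ ball F a) : x⁻¹ ∈ ball F (1 - a) := by
  rw [mem_ball, not_le] at *
  rw [map_inv₀]
  have h0 : normVal F x ≠ 0 := (WithZero.exp_pos.trans hx).ne'
  rw [← WithZero.exp_log h0] at hx ⊢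
  rw [WithZero.exp_lt_exp] at hx
  rw [← WithZero.exp_neg, WithZero.exp_le_exp]
  omega

theorem exists_mem_ball (x : F) : ∃ a : ℤ, x ∈ ball F a := by
  by_cases h0 : x = 0
  · exact ⟨0, h0 ▸ (ball F 0).zero_mem⟩
  · refine ⟨-WithZero.log (normVal F x), ?_⟩
    rw [mem_ball, neg_neg, WithZero.exp_log ((normVal F).ne_zero_iff.mpr h0)]

theorem eq_zero_of_forall_mem_ball {x : F} (h : ∀ k : ℕ, ∃ a : ℤ, k ≤ a ∧ x ∈ ball F a) :
    x = 0 := by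
  by_contra h0
  have hv := (normVal F).ne_zero_iff.mpr h0
  obtain ⟨a, ha, hx⟩ := h ((1 - WithZero.log (normVal F x)).toNat)
  rw [mem_ball, ← WithZero.exp_log hv, WithZero.exp_le_exp] at hx
  omega

theorem isCompact_ball (a : ℤ) : IsCompact (ball F a : Set F) := by
  have := IsNonarchimedeanLocalField.isCompact_closedBall F
    ((IsNonarchimedeanLocalField.valueGroupWithZeroIsoInt F).symm (WithZero.exp (-a)))
  convert this using 1
  ext x
  exact normVal_le_iff

theorem ball_subset_of_mem_nhds {O : Set F} (hO : O ∈ 𝓝 (0 : F)) :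
    ∃ a : ℤ, ∀ b ≥ a, (ball F b : Set F) ⊆ O := by
  obtain ⟨r, hr, hrO⟩ := (IsValuativeTopology.hasBasis_nhds_zero' F).mem_iff.mp hO
  let e := IsNonarchimedeanLocalField.valueGroupWithZeroIsoInt F
  have h0 : e r ≠ 0 := by simpa using hr
  refine ⟨1 - WithZero.log (e r), fun b hb x hx => hrO ?_⟩
  have h1 : normVal F x < e r := by
    refine lt_of_le_of_lt hx ?_
    rw [← WithZero.exp_log h0, WithZero.exp_lt_exp]
    omega
  exact (map_lt_map_iff e).mp h1

theorem isOpen_ball (a : ℤ) : IsOpen (ball F a : Set F) := by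
  refine (ball F a).isOpen_of_mem_nhds (g := 0) ?_
  refine (IsValuativeTopology.hasBasis_nhds_zero' F).mem_iff.mpr
    ⟨(IsNonarchimedeanLocalField.valueGroupWithZeroIsoInt F).symm (WithZero.exp (-a)), ?_, ?_⟩
  · simp
  · intro x hx
    exact normVal_le_iff.mpr (le_of_lt hx)

variable (F) in
theorem t2Space_localField : T2Space F :=
  IsTopologicalAddGroup.t2Space_of_zero_sep fun x hx => by
    by_contra! h
    refine hx (eq_zero_of_forall_mem_ball fun k => ⟨k, le_rfl, ?_⟩)
    exact h (ball F k) ((isOpen_ball k).mem_nhds (ball F k).zero_mem)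

theorem ringChar_mem_ball : ((ringChar 𝓀[F] : ℕ) : F) ∈ ball F 1 := by
  have h1 : ((ringChar 𝓀[F] : ℕ) : 𝒪[F]) ∈ 𝓂[F] := by
    rw [← IsLocalRing.residue_eq_zero_iff, map_natCast]
    exact ringChar.Nat.cast_ringChar
  have h2 : valuation F ((ringChar 𝓀[F] : ℕ) : F) < 1 := by
    have := Valuation.Integer.not_isUnit_iff_valuation_lt_one.mp
      ((IsLocalRing.mem_maximalIdeal _).mp h1)
    simpa using this
  have h3 : normVal F ((ringChar 𝓀[F] : ℕ) : F) < 1 := by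
    have := (map_lt_map_iff (IsNonarchimedeanLocalField.valueGroupWithZeroIsoInt F)).mpr h2
    rwa [map_one] at this
  rw [mem_ball]
  by_cases h0 : normVal F ((ringChar 𝓀[F] : ℕ) : F) = 0
  · simp [h0]
  · rw [← WithZero.exp_log h0] at h3 ⊢
    rw [← WithZero.exp_zero, WithZero.exp_lt_exp] at h3
    rw [WithZero.exp_le_exp]
    omega

theorem prime_ringChar : (ringChar 𝓀[F]).Prime := by
  have : Finite 𝓀[F] := inferInstance
  have := ringChar.charP 𝓀[F]
  exact (CharP.char_is_prime_or_zero 𝓀[F] (ringChar 𝓀[F])).resolve_right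
    (CharP.char_ne_zero_of_finite 𝓀[F] _)

/-- `c` is the conductor of the additive character `ψ`: the character is trivial on the elements of
valuation at least `c`, and `c` is minimal with this property. -/
structure IsConductor {R : Type*} [CommRing R] (ψ : AddChar F R) (c : ℤ) : Prop where
  eq_one : ∀ x ∈ ball F c, ψ x = 1
  exists_ne : ∃ x ∈ ball F (c - 1), ψ x ≠ 1

theorem exists_isConductor {R : Type*} [CommRing R] {ψ : AddChar F R} (hψ : ψ ≠ 1)
    (hψ' : IsLocallyConstant ψ) : ∃ c, IsConductor ψ c := by
  have hO : ψ ⁻¹' {1} ∈ 𝓝 (0 : F) := (hψ'.isOpen_fiber 1).mem_nhds (by simp)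
  obtain ⟨a, ha⟩ := ball_subset_of_mem_nhds hO
  obtain ⟨x, hx⟩ : ∃ x, ψ x ≠ 1 := by
    by_contra! h
    exact hψ (by ext x; simp [h])
  obtain ⟨b, hb⟩ := exists_mem_ball x
  obtain ⟨c, hc, hmin⟩ := Int.exists_least_of_bdd (P := fun c => ∀ x ∈ ball F c, ψ x = 1)
    ⟨b, fun c hc => by
      by_contra! h
      exact hx (hc x (ball_anti h.le hb))⟩ ⟨a, fun x hx => ha a le_rfl hx⟩
  refine ⟨c, hc, ?_⟩
  by_contra! h
  have := hmin (c - 1) h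
  omega

theorem IsConductor.mem_ball {R : Type*} [CommRing R] {ψ : AddChar F R} {c : ℤ}
    (hc : IsConductor ψ c) {a b : ℤ} (hb : b ≤ c - a) {y : F}
    (hy : ∀ x ∈ ball F a, ψ (y * x) = 1) : y ∈ ball F b := by
  refine ball_anti hb ?_
  by_contra h
  obtain ⟨x, hx, hx1⟩ := hc.exists_ne
  have hy0 : y ≠ 0 := by
    rintro rfl
    exact h (AddSubgroup.zero_mem _)
  refine hx1 ?_
  have := hy (y⁻¹ * x) (mul_mem_ball (inv_mem_ball h) hx (by omega))
  rwa [mul_inv_cancel_left₀ hy0] at this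

end LocalField

end WhittakerFamily

/-! ### Lattices of matrices and congruence subgroups -/

namespace WhittakerFamily

open Filter Topology ValuativeRel Matrix

section Lattice

variable {n : ℕ} {F : Type*} [Field F] [ValuativeRel F] [TopologicalSpace F]
  [IsNonarchimedeanLocalField F]

variable (n F) in
/-- The matrices whose entry at `(i, j)` has valuation at least `m + d * (i - j)`. For `m = 0` this
is the conjugate of the order of integral matrices by a diagonal matrix. -/
noncomputable def lattice (d m : ℤ) : AddSubgroup (Matrix (Fin n) (Fin n) F) where
  carrier := {X | ∀ i j : Fin n, X i j ∈ ball F (m + d * ((i : ℤ) - j))}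
  zero_mem' _ _ := (ball F _).zero_mem
  add_mem' hX hY i j := (ball F _).add_mem (hX i j) (hY i j)
  neg_mem' hX i j := (ball F _).neg_mem (hX i j)

theorem mem_lattice {d m : ℤ} {X : Matrix (Fin n) (Fin n) F} :
    X ∈ lattice n F d m ↔ ∀ i j : Fin n, X i j ∈ ball F (m + d * ((i : ℤ) - j)) := Iff.rfl

theorem lattice_anti {d m m' : ℤ} (h : m ≤ m') : lattice n F d m' ≤ lattice n F d m :=
  fun _ hX i j => ball_anti (by omega) (hX i j)

theorem mul_mem_lattice {d m m' k : ℤ} {X Y : Matrix (Fin n) (Fin n) F}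
    (hX : X ∈ lattice n F d m) (hY : Y ∈ lattice n F d m') (hk : k ≤ m + m') :
    X * Y ∈ lattice n F d k := by
  intro i j
  rw [Matrix.mul_apply]
  exact sum_mem fun l _ => mul_mem_ball (hX i l) (hY l j) (by
    have : d * ((i : ℤ) - j) = d * ((i : ℤ) - l) + d * ((l : ℤ) - j) := by ring
    omega)

theorem one_mem_lattice (d : ℤ) : (1 : Matrix (Fin n) (Fin n) F) ∈ lattice n F d 0 := by
  intro i j
  rw [Matrix.one_apply]
  split_ifs with h
  · subst h
    exact one_mem_ball (by simp)
  · exact (ball F _).zero_mem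

theorem pow_mem_lattice {d m : ℤ} {X : Matrix (Fin n) (Fin n) F} (hX : X ∈ lattice n F d m)
    (k : ℕ) : X ^ k ∈ lattice n F d (k * m) := by
  induction k with
  | zero => simpa using one_mem_lattice d
  | succ k ih =>
    rw [pow_succ]
    exact mul_mem_lattice ih hX (by push_cast; ring_nf; rfl)

theorem mem_lattice_zero_of_sub {d m : ℤ} (hm : 0 ≤ m) {X : Matrix (Fin n) (Fin n) F}
    (hX : X - 1 ∈ lattice n F d m) : X ∈ lattice n F d 0 := by
  have := (lattice n F d 0).add_mem (lattice_anti hm hX) (one_mem_lattice d)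
  simpa using this

/-- Every finite family of entries is bounded. -/
theorem exists_forall_mem_ball {ι : Type*} [Finite ι] (f : ι → F) :
    ∃ a : ℤ, ∀ i, ∀ b ≤ a, f i ∈ ball F b := by
  choose a ha using fun i => exists_mem_ball (f i)
  obtain ⟨b, hb⟩ := (Set.finite_range a).bddBelow
  exact ⟨b, fun i c hc => ball_anti (hc.trans (hb ⟨i, rfl⟩)) (ha i)⟩

theorem exists_mem_lattice (d : ℤ) (X : Matrix (Fin n) (Fin n) F) :
    ∃ m, X ∈ lattice n F d m := by
  obtain ⟨a, ha⟩ := exists_forall_mem_ball fun q : Fin n × Fin n => X q.1 q.2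
  obtain ⟨b, hb⟩ := (Set.finite_range
    (fun q : Fin n × Fin n => a - d * ((q.1 : ℤ) - q.2))).bddBelow
  refine ⟨b, fun i j => ha (i, j) _ ?_⟩
  have := hb ⟨(i, j), rfl⟩
  simp only at this
  omega

theorem isOpen_lattice (d m : ℤ) :
    IsOpen (lattice n F d m : Set (Matrix (Fin n) (Fin n) F)) := by
  have : (lattice n F d m : Set (Matrix (Fin n) (Fin n) F)) =
      ⋂ (i : Fin n) (j : Fin n),
        (fun X : Matrix (Fin n) (Fin n) F => X i j) ⁻¹' (ball F (m + d * ((i : ℤ) - j))) := by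
    ext X
    simp [mem_lattice]
  rw [this]
  exact isOpen_iInter_of_finite fun i => isOpen_iInter_of_finite fun j =>
    (isOpen_ball _).preimage (by fun_prop)

theorem isCompact_lattice (d m : ℤ) :
    IsCompact (lattice n F d m : Set (Matrix (Fin n) (Fin n) F)) := by
  have h := isCompact_univ_pi fun i : Fin n => isCompact_univ_pi fun j : Fin n =>
    isCompact_ball (F := F) (m + d * ((i : ℤ) - j))
  have e : (lattice n F d m : Set (Matrix (Fin n) (Fin n) F)) =
      Set.univ.pi fun i : Fin n => Set.univ.pi fun j : Fin n =>
        (ball F (m + d * ((i : ℤ) - j)) : Set F) := by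
    ext X
    exact ⟨fun h i _ j _ => h i j, fun h i j => h i trivial j trivial⟩
  rw [e]
  exact h

variable (n F) in
/-- The elements `g` of `GL_n` such that `g - 1` and `g⁻¹ - 1` lie in `lattice d m`. For `m ≥ 1` the
condition on the inverse is automatic, see `mem_congruence_iff`. -/
noncomputable def congruence (d : ℤ) (m : ℕ) : Subgroup (GL (Fin n) F) where
  carrier := {g | g.val - 1 ∈ lattice n F d m ∧ g⁻¹.val - 1 ∈ lattice n F d m}
  one_mem' := by simp [(lattice n F d m).zero_mem]
  mul_mem' := by
    have key : ∀ X Y : Matrix (Fin n) (Fin n) F, X - 1 ∈ lattice n F d m →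
        Y - 1 ∈ lattice n F d m → X * Y - 1 ∈ lattice n F d m := by
      intro X Y hX hY
      have : X * Y - 1 = X * (Y - 1) + (X - 1) := by noncomm_ring
      rw [this]
      exact (lattice n F d m).add_mem
        (mul_mem_lattice (mem_lattice_zero_of_sub (by omega) hX) hY (by simp)) hX
    rintro a b ⟨ha, ha'⟩ ⟨hb, hb'⟩
    refine ⟨key _ _ ha hb, ?_⟩
    rw [_root_.mul_inv_rev]
    exact key _ _ hb' ha'
  inv_mem' := by
    rintro a ⟨ha, ha'⟩
    exact ⟨ha', by rwa [inv_inv]⟩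

/-- The inverse of an element congruent to `1` is congruent to `1`, by the geometric series. -/
theorem inv_sub_one_mem_lattice {d m : ℤ} (hm : 1 ≤ m) (g : GL (Fin n) F)
    (hg : g.val - 1 ∈ lattice n F d m) : g⁻¹.val - 1 ∈ lattice n F d m := by
  set X : Matrix (Fin n) (Fin n) F := 1 - g.val with hX
  have hXm : X ∈ lattice n F d m := by
    have := (lattice n F d m).neg_mem hg
    rwa [neg_sub] at this
  obtain ⟨b, hb⟩ := exists_mem_lattice d g⁻¹.val
  let k : ℕ := (m - b).toNat + 1
  have h1 : g⁻¹.val - 1 = X * (∑ j ∈ Finset.range k, X ^ j) - X ^ k + g⁻¹.val * X ^ k := by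
    have h2 : g.val * ∑ j ∈ Finset.range k, X ^ j = 1 - X ^ k := by
      have := mul_neg_geom_sum X k
      rwa [hX, sub_sub_cancel, ← hX] at this
    have h3 : ∑ j ∈ Finset.range k, X ^ j = g⁻¹.val - g⁻¹.val * X ^ k := by
      rw [← mul_one g⁻¹.val, mul_assoc, one_mul, ← mul_sub, ← h2, ← mul_assoc, ← Units.val_mul,
        inv_mul_cancel, Units.val_one, one_mul]
    have h4 : X * (∑ j ∈ Finset.range k, X ^ j) = (∑ j ∈ Finset.range k, X ^ j) - (1 - X ^ k) := by
      rw [← h2, hX]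
      noncomm_ring
    rw [h4, h3]
    abel
  rw [h1]
  have hk : X ^ k ∈ lattice n F d (k * m) := pow_mem_lattice hXm k
  have hkm : (k : ℤ) ≤ k * m := le_mul_of_one_le_right (by omega) hm
  have hkb : m - b ≤ k := by omega
  have hk1 : m ≤ k * m := by
    refine le_mul_of_one_le_left (by omega) (by omega)
  refine (lattice n F d m).add_mem ((lattice n F d m).sub_mem ?_ (lattice_anti hk1 hk))
    (mul_mem_lattice hb hk (by omega))
  refine mul_mem_lattice (m' := 0) hXm (sum_mem fun j _ => ?_) (by simp)
  exact lattice_anti (by positivity) (pow_mem_lattice hXm j)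

theorem mem_congruence_iff {d : ℤ} {m : ℕ} (hm : 1 ≤ m) {g : GL (Fin n) F} :
    g ∈ congruence n F d m ↔ g.val - 1 ∈ lattice n F d m :=
  ⟨fun h => h.1, fun h => ⟨h, inv_sub_one_mem_lattice (by omega) g h⟩⟩

theorem exists_val_eq_one_add {d m : ℤ} (hm : 1 ≤ m) {X : Matrix (Fin n) (Fin n) F}
    (hX : X ∈ lattice n F d m) : ∃ g : GL (Fin n) F, g.val = 1 + X := by
  have hdet : IsUnit (1 + X).det := by
    rw [isUnit_iff_ne_zero]
    intro h0
    obtain ⟨w, hw, hXw⟩ := Matrix.exists_mulVec_eq_zero_iff.mpr h0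
    refine hw (funext fun i => eq_zero_of_forall_mem_ball fun k => ?_)
    have hpow : ∀ k : ℕ, w = (-X) ^ k *ᵥ w := by
      intro k
      induction k with
      | zero => simp
      | succ k ih =>
        rw [pow_succ, ← Matrix.mulVec_mulVec]
        have : (-X) *ᵥ w = w := by
          rw [Matrix.add_mulVec, Matrix.one_mulVec] at hXw
          rw [Matrix.neg_mulVec, neg_eq_iff_add_eq_zero, add_comm, hXw]
        rw [this, ← ih]
    obtain ⟨a, ha⟩ := exists_forall_mem_ball w
    obtain ⟨b, hb⟩ := (Set.finite_range (fun j : Fin n => d * ((i : ℤ) - j) + a)).bddBelow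
    let l : ℕ := ((k : ℤ) - b).toNat
    have hl : (l : ℤ) ≤ l * m := le_mul_of_one_le_right (by omega) hm
    refine ⟨k, le_rfl, ?_⟩
    have h1 : w i = ∑ j, ((-X) ^ l) i j * w j := congrFun (hpow l) i
    rw [h1]
    refine sum_mem fun j _ => mul_mem_ball
      (pow_mem_lattice ((lattice n F d m).neg_mem hX) l i j) (ha j a le_rfl) ?_
    have := hb ⟨j, rfl⟩
    simp only at this
    omega
  exact ⟨Matrix.GeneralLinearGroup.mk'' (1 + X) hdet, rfl⟩

theorem isOpen_congruence (d : ℤ) (m : ℕ) :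
    IsOpen (congruence n F d m : Set (GL (Fin n) F)) := by
  have h1 := (isOpen_lattice (n := n) (F := F) d m).preimage
    (f := fun g : GL (Fin n) F => g.val - 1) (by fun_prop)
  have h2 := (isOpen_lattice (n := n) (F := F) d m).preimage
    (f := fun g : GL (Fin n) F => g⁻¹.val - 1)
    ((Units.continuous_val.comp continuous_inv).sub continuous_const)
  exact h1.inter h2

theorem isCompact_congruence (d : ℤ) (m : ℕ) :
    IsCompact (congruence n F d m : Set (GL (Fin n) F)) := by
  have := t2Space_localField F
  have : T2Space (Matrix (Fin n) (Fin n) F) := inferInstanceAs (T2Space (Fin n → Fin n → F))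
  have hK : IsCompact ((fun X : Matrix (Fin n) (Fin n) F => X + 1) ''
      (lattice n F d m : Set (Matrix (Fin n) (Fin n) F))) :=
    (isCompact_lattice d m).image (by fun_prop)
  have h := (Units.isClosedEmbedding_embedProduct
    (α := Matrix (Fin n) (Fin n) F)).isCompact_preimage
    (hK.prod (hK.image MulOpposite.continuous_op))
  convert h using 1
  ext g
  constructor
  · rintro ⟨h1, h2⟩
    exact ⟨⟨_, h1, by simp⟩, ⟨_, ⟨_, h2, sub_add_cancel _ _⟩, rfl⟩⟩
  · rintro ⟨⟨X, hX, hXg⟩, ⟨_, ⟨Y, hY, rfl⟩, hYg⟩⟩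
    have e1 : X + 1 = g.val := hXg
    have e2 : Y + 1 = g⁻¹.val := MulOpposite.op_injective hYg
    refine ⟨?_, ?_⟩
    · rw [← e1, add_sub_cancel_right]
      exact hX
    · rw [← e2, add_sub_cancel_right]
      exact hY

/-- The groups `congruence d m`, for fixed `d` and large `m`, lie in any given neighbourhood
of `1`. -/
theorem eventually_congruence_subset (d : ℤ) {O : Set (GL (Fin n) F)}
    (hO : O ∈ 𝓝 (1 : GL (Fin n) F)) :
    ∀ᶠ m : ℕ in atTop, (congruence n F d m : Set (GL (Fin n) F)) ⊆ O := by
  have hanti : ∀ m m' : ℕ, m ≤ m' → congruence n F d m' ≤ congruence n F d m := fun m m' h g hg =>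
    ⟨lattice_anti (by exact_mod_cast h) hg.1, lattice_anti (by exact_mod_cast h) hg.2⟩
  obtain ⟨m, hm⟩ := exists_subset_nhds_of_isCompact' (U := O)
    (V := fun m : ℕ => (congruence n F d m : Set (GL (Fin n) F)))
    (directed_of_isDirected_le fun m m' h => hanti m m' h)
    (fun m => isCompact_congruence d m)
    (fun m => Subgroup.isClosed_of_isOpen _ (isOpen_congruence d m)) (by
      intro g hg
      have : g = 1 := by
        refine Units.ext (sub_eq_zero.mp (Matrix.ext fun i j => ?_))
        obtain ⟨k, hk⟩ : ∃ k : ℕ, -(d * ((i : ℤ) - j)) ≤ k := ⟨_, Int.self_le_toNat _⟩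
        refine eq_zero_of_forall_mem_ball fun l =>
          ⟨_, ?_, (Set.mem_iInter.mp hg (l + k)).1 i j⟩
        push_cast
        omega
      rwa [this])
  exact (eventually_ge_atTop m).mono fun m' h => fun g hg => hm (hanti m m' h hg)

/-- The `p`-th power map shrinks the congruence groups, where `p` is the residue
characteristic. -/
theorem pow_sub_one_mem_lattice {d m : ℤ} (hm : 1 ≤ m) {X : Matrix (Fin n) (Fin n) F}
    (hX : X - 1 ∈ lattice n F d m) :
    X ^ (ringChar 𝓀[F]) - 1 ∈ lattice n F d (m + 1) := by
  set p := ringChar 𝓀[F]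
  set Y := X - 1
  have hXY : X = Y + 1 := by simp [Y]
  have hp : 2 ≤ p := (prime_ringChar (F := F)).two_le
  obtain ⟨q, hq⟩ : ∃ q, p = q + 2 := ⟨p - 2, by omega⟩
  have h1 : X ^ p - 1 = (p : Matrix (Fin n) (Fin n) F) * Y +
      Y * Y * ∑ j ∈ Finset.range (q + 1), Y ^ j * ((p.choose (j + 1 + 1) : ℕ) : Matrix _ _ F) := by
    rw [hXY, (Commute.one_right Y).add_pow, hq, Finset.sum_range_succ', Finset.sum_range_succ',
      Finset.mul_sum]
    simp only [one_pow, mul_one, pow_zero, Nat.choose_zero_right, Nat.cast_one, zero_add, pow_one,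
      Nat.choose_one_right, add_sub_cancel_right]
    rw [add_comm, (Nat.cast_commute (q + 2) Y).eq]
    congr 1
    refine Finset.sum_congr rfl fun j _ => ?_
    simp only [pow_succ', mul_assoc]
  have hnat : ∀ k : ℕ, ((k : ℕ) : Matrix (Fin n) (Fin n) F) ∈ lattice n F d 0 := by
    intro k
    rw [← nsmul_one]
    exact (lattice n F d 0).nsmul_mem (one_mem_lattice d) k
  rw [h1]
  refine (lattice n F d (m + 1)).add_mem ?_ ?_
  · intro i j
    have : ((p : Matrix (Fin n) (Fin n) F) * Y) i j = (p : F) * Y i j := by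
      rw [← nsmul_eq_mul, Matrix.smul_apply, nsmul_eq_mul]
    rw [this]
    exact mul_mem_ball ringChar_mem_ball (hX i j) (by omega)
  · refine mul_mem_lattice (m' := 0) (mul_mem_lattice hX hX (by omega : m + 1 ≤ m + m))
      (sum_mem fun j _ => ?_) (by simp)
    exact mul_mem_lattice (lattice_anti (by positivity) (pow_mem_lattice hX j)) (hnat _) (by simp)

theorem pow_pow_mem_congruence {d : ℤ} {m : ℕ} (hm : 1 ≤ m) {g : GL (Fin n) F}
    (hg : g ∈ congruence n F d m) (k : ℕ) :
    g ^ (ringChar 𝓀[F]) ^ k ∈ congruence n F d (m + k) := by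
  induction k with
  | zero => simpa using hg
  | succ k ih =>
    rw [mem_congruence_iff (by omega)] at ih ⊢
    have := pow_sub_one_mem_lattice (by omega) ih
    rw [pow_succ, pow_mul, Units.val_pow_eq_pow_val]
    push_cast at this ⊢
    rwa [add_assoc] at this

end Lattice

end WhittakerFamily

/-! ### Rodier's subgroups of the mirabolic group -/

namespace WhittakerFamily

open Filter Topology ValuativeRel Matrix

section Superdiagonal

variable {n : ℕ} {F : Type*} [Field F]

theorem superdiagonalSum_add (X Y : Matrix (Fin n) (Fin n) F) :
    superdiagonalSum (X + Y) = superdiagonalSum X + superdiagonalSum Y := by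
  rw [superdiagonalSum, superdiagonalSum, superdiagonalSum, ← Finset.sum_add_distrib]
  refine Finset.sum_congr rfl fun i _ => ?_
  split_ifs <;> simp

theorem superdiagonalSum_one : superdiagonalSum (1 : Matrix (Fin n) (Fin n) F) = 0 := by
  refine Finset.sum_eq_zero fun i _ => ?_
  split_ifs with h
  · exact Matrix.one_apply_ne fun e => by
      have := congrArg Fin.val e
      simp at this
  · rfl

theorem superdiagonalSum_single_mul (l k : Fin n) (hl : (l : ℕ) + 1 < n) (x : F)
    (M : Matrix (Fin n) (Fin n) F) :
    superdiagonalSum (Matrix.single l k x * M) = x * M k ⟨l + 1, hl⟩ := by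
  rw [superdiagonalSum, Finset.sum_eq_single l, dif_pos hl, Matrix.single_mul_apply_same]
  · intro i _ hi
    split_ifs with h
    · exact Matrix.single_mul_apply_of_ne _ _ _ _ _ hi _
    · rfl
  · simp

theorem superdiagonalSum_mul_single_succ (l k : Fin n) (hk : (k : ℕ) + 1 < n) (x : F)
    (M : Matrix (Fin n) (Fin n) F) :
    superdiagonalSum (M * Matrix.single l ⟨k + 1, hk⟩ x) = M k l * x := by
  rw [superdiagonalSum, Finset.sum_eq_single k, dif_pos hk, Matrix.mul_single_apply_same]
  · intro i _ hi
    split_ifs with h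
    · refine Matrix.mul_single_apply_of_ne _ _ _ _ _ (fun e => hi (Fin.ext ?_)) _
      have := congrArg Fin.val e
      simpa using this
    · rfl
  · simp

theorem superdiagonalSum_mul_single_zero (l k : Fin n) (hk : (k : ℕ) = 0) (x : F)
    (M : Matrix (Fin n) (Fin n) F) :
    superdiagonalSum (M * Matrix.single l k x) = 0 := by
  refine Finset.sum_eq_zero fun i _ => ?_
  split_ifs with h
  · refine Matrix.mul_single_apply_of_ne _ _ _ _ _ (fun e => ?_) _
    have := congrArg Fin.val e
    simp [hk] at this
  · rfl

theorem exists_unipotent {U : Matrix (Fin n) (Fin n) F} (hU : ∀ i j, j ≤ i → U i j = 0) :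
    ∃ u : mirabolic n F, u.val.val = 1 + U ∧ u ∈ unipotentInMirabolic n F := by
  have hdet : IsUnit (1 + U).det := by
    rw [Matrix.det_of_isUpperTriangular]
    · rw [Finset.prod_congr rfl fun i _ => show (1 + U) i i = 1 by simp [hU i i le_rfl]]
      simp
    · intro i j hij
      have hij' : j < i := hij
      rw [Matrix.add_apply, hU i j hij'.le, Matrix.one_apply_ne hij'.ne', add_zero]
  have hu : Matrix.GeneralLinearGroup.mk'' (1 + U) hdet ∈ unipotent n F := by
    intro i j hij
    change (1 + U) i j = _
    rw [Matrix.add_apply, hU i j hij, add_zero]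
  exact ⟨⟨_, unipotent_le_mirabolic n F hu⟩, rfl, hu⟩

/-- The strictly upper triangular part of a matrix. -/
def upperPart (X : Matrix (Fin n) (Fin n) F) : Matrix (Fin n) (Fin n) F :=
  Matrix.of fun i j => if i < j then X i j else 0

theorem upperPart_of_lt (X : Matrix (Fin n) (Fin n) F) {i j : Fin n} (h : i < j) :
    upperPart X i j = X i j := if_pos h

theorem upperPart_of_le (X : Matrix (Fin n) (Fin n) F) {i j : Fin n} (h : j ≤ i) :
    upperPart X i j = 0 := if_neg (not_lt.mpr h)

/-- The function `g ↦ ψ(g_{1,2} + ⋯ + g_{n-1,n})` on `P_n`. -/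
def genericFun {A : Type*} [CommRing A] (ψ : AddChar F A) (g : mirabolic n F) : A :=
  ψ (superdiagonalSum g.val.val)

theorem superdiagonalSum_eq (g : mirabolic n F) :
    superdiagonalSum g.val.val = superdiagonalSum (g.val.val - 1) := by
  conv_lhs => rw [← sub_add_cancel g.val.val 1, superdiagonalSum_add, superdiagonalSum_one,
    add_zero]

end Superdiagonal

section RodierGroups

variable {n : ℕ} {F : Type*} [Field F] [ValuativeRel F] [TopologicalSpace F]
  [IsNonarchimedeanLocalField F]

variable (n F) in
/-- Rodier's compact open subgroups of `P_n` for an additive character of conductor `c`: the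
entry of `g - 1` at `(i, j)` has valuation at least `m + (2 * m - c) * (i - j)`. As `m` grows the
intersection with `N_n` exhausts `N_n`, while the lower triangular part shrinks. -/
noncomputable def rodierGroup (c : ℤ) (m : ℕ) : Subgroup (mirabolic n F) :=
  (congruence n F (2 * m - c) m).comap (mirabolic n F).subtype

theorem mem_rodierGroup_iff {c : ℤ} {m : ℕ} (hm : 1 ≤ m) {g : mirabolic n F} :
    g ∈ rodierGroup n F c m ↔ g.val.val - 1 ∈ lattice n F (2 * m - c) m :=
  mem_congruence_iff hm

/-- For `u` unipotent, only the entries above the diagonal have to be tested. -/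
theorem mem_rodierGroup_of_unipotent {c : ℤ} {m : ℕ} (hm : 1 ≤ m) {u : mirabolic n F}
    (hu : u ∈ unipotentInMirabolic n F)
    (h : ∀ i j : Fin n, i < j → u.val.val i j ∈ ball F (m + (2 * m - c) * ((i : ℤ) - j))) :
    u ∈ rodierGroup n F c m := by
  rw [mem_rodierGroup_iff hm]
  intro i j
  rw [Matrix.sub_apply]
  rcases lt_or_ge i j with hij | hij
  · rw [Matrix.one_apply_ne hij.ne, sub_zero]
    exact h i j hij
  · have h1 : u.val.val i j = (1 : Matrix (Fin n) (Fin n) F) i j := hu i j hij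
    rw [h1, sub_self]
    exact (ball F _).zero_mem

theorem entry_mem_ball_of_mem_rodierGroup {c : ℤ} {m : ℕ} {g : mirabolic n F}
    (hg : g ∈ rodierGroup n F c m) {i j : Fin n} (h : i ≠ j) :
    g.val.val i j ∈ ball F (m + (2 * m - c) * ((i : ℤ) - j)) := by
  have := hg.1 i j
  rwa [Matrix.sub_apply, Matrix.one_apply_ne h, sub_zero] at this

theorem exists_mem_rodierGroup {c : ℤ} {m : ℕ} (hm : 1 ≤ m) {X : Matrix (Fin n) (Fin n) F}
    (hX : X ∈ lattice n F (2 * m - c) m) (hX' : ∀ i j : Fin n, (i : ℕ) + 1 = n → X i j = 0) :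
    ∃ g ∈ rodierGroup n F c m, g.val.val = 1 + X := by
  obtain ⟨g, hg⟩ := exists_val_eq_one_add (by omega) hX
  refine ⟨⟨g, fun i j hi => ?_⟩, (mem_rodierGroup_iff hm).mpr ?_, hg⟩
  · rw [hg, Matrix.add_apply, hX' i j hi, add_zero]
  · change g.val - 1 ∈ _
    rwa [hg, add_sub_cancel_left]

theorem isOpen_rodierGroup (c : ℤ) (m : ℕ) :
    IsOpen (rodierGroup n F c m : Set (mirabolic n F)) :=
  (isOpen_congruence _ m).preimage continuous_subtype_val

theorem isClosed_entry_eq (i j : Fin n) :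
    IsClosed {g : GL (Fin n) F | g.val i j = (1 : Matrix (Fin n) (Fin n) F) i j} := by
  have := t2Space_localField F
  exact isClosed_eq (Units.continuous_val.matrix_elem i j) continuous_const

theorem isClosed_mirabolic : IsClosed (mirabolic n F : Set (GL (Fin n) F)) := by
  have : (mirabolic n F : Set (GL (Fin n) F)) = ⋂ (i : Fin n) (j : Fin n) (_ : (i : ℕ) + 1 = n),
      {g : GL (Fin n) F | g.val i j = (1 : Matrix (Fin n) (Fin n) F) i j} := by
    ext g
    simp only [Set.mem_iInter]
    exact Iff.rfl
  rw [this]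
  exact isClosed_iInter fun i => isClosed_iInter fun j => isClosed_iInter fun _ =>
    isClosed_entry_eq i j

theorem isClosed_unipotentInMirabolic :
    IsClosed (unipotentInMirabolic n F : Set (mirabolic n F)) := by
  have : (unipotent n F : Set (GL (Fin n) F)) = ⋂ (i : Fin n) (j : Fin n) (_ : j ≤ i),
      {g : GL (Fin n) F | g.val i j = (1 : Matrix (Fin n) (Fin n) F) i j} := by
    ext g
    simp only [Set.mem_iInter]
    exact Iff.rfl
  have h : IsClosed (unipotent n F : Set (GL (Fin n) F)) := by
    rw [this]
    exact isClosed_iInter fun i => isClosed_iInter fun j => isClosed_iInter fun _ =>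
      isClosed_entry_eq i j
  exact h.preimage continuous_subtype_val

theorem isCompact_rodierGroup (c : ℤ) (m : ℕ) :
    IsCompact (rodierGroup n F c m : Set (mirabolic n F)) :=
  isClosed_mirabolic.isClosedEmbedding_subtypeVal.isCompact_preimage
    (isCompact_congruence (2 * m - c) m)

theorem eventually_congruence_mirabolic (d : ℤ) {O : Set (mirabolic n F)}
    (hO : O ∈ 𝓝 (1 : mirabolic n F)) :
    ∀ᶠ m : ℕ in atTop, ∀ g : mirabolic n F, g.val ∈ congruence n F d m → g ∈ O := by
  rw [nhds_induced, mem_comap] at hO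
  obtain ⟨U, hU, hUO⟩ := hO
  filter_upwards [eventually_congruence_subset d hU] with m hm g hg
  exact hUO (hm hg)

theorem exists_pow_mem {c : ℤ} {m : ℕ} (hm : 1 ≤ m) {g : mirabolic n F}
    (hg : g ∈ rodierGroup n F c m) {O : Set (mirabolic n F)} (hO : O ∈ 𝓝 (1 : mirabolic n F)) :
    ∃ k : ℕ, g ^ (ringChar 𝓀[F]) ^ k ∈ O := by
  obtain ⟨k, hk⟩ := ((tendsto_add_atTop_nat m).eventually
    (eventually_congruence_mirabolic (2 * m - c) hO)).exists
  refine ⟨k, hk _ ?_⟩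
  rw [add_comm]
  exact pow_pow_mem_congruence hm hg k

theorem superdiagonalSum_mem_ball {d k : ℤ} {X : Matrix (Fin n) (Fin n) F}
    (hX : X ∈ lattice n F d k) : superdiagonalSum X ∈ ball F (k - d) := by
  refine sum_mem fun i _ => ?_
  split_ifs with h
  · refine ball_anti ?_ (hX _ _)
    push_cast
    rw [show (i : ℤ) - (i + 1) = -1 by ring]
    omega
  · exact (ball F _).zero_mem

theorem isCharOn_rodierGroup {A : Type*} [CommRing A] {ψ : AddChar F A} {c : ℤ}
    (hψ : ∀ x ∈ ball F c, ψ x = 1) (m : ℕ) :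
    IsCharOn (genericFun ψ) (rodierGroup n F c m) where
  map_one := by
    rw [genericFun]
    change ψ (superdiagonalSum (1 : Matrix (Fin n) (Fin n) F)) = 1
    rw [superdiagonalSum_one, AddChar.map_zero_eq_one]
  map_mul a ha b hb := by
    have ha' : a.val.val - 1 ∈ lattice n F (2 * m - c) m := ha.1
    have hb' : b.val.val - 1 ∈ lattice n F (2 * m - c) m := hb.1
    have h1 : (a * b).val.val - 1 =
        (a.val.val - 1) + (b.val.val - 1) + (a.val.val - 1) * (b.val.val - 1) := by
      rw [Subgroup.coe_mul, Units.val_mul]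
      noncomm_ring
    rw [genericFun, genericFun, genericFun, superdiagonalSum_eq, superdiagonalSum_eq a,
      superdiagonalSum_eq b, h1, superdiagonalSum_add, superdiagonalSum_add,
      AddChar.map_add_eq_mul, AddChar.map_add_eq_mul, hψ _ (ball_anti (by omega)
        (superdiagonalSum_mem_ball (mul_mem_lattice ha' hb' le_rfl))), mul_one]

theorem eventually_genericFun_eq_one {A : Type*} [CommRing A] {ψ : AddChar F A} {c : ℤ}
    (hψ : ∀ x ∈ ball F c, ψ x = 1) : ∀ᶠ g in 𝓝 (1 : mirabolic n F), genericFun ψ g = 1 := by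
  have h : ((congruence n F 0 c.toNat).comap (mirabolic n F).subtype : Set (mirabolic n F)) ∈
      𝓝 (1 : mirabolic n F) :=
    ((isOpen_congruence 0 c.toNat).preimage continuous_subtype_val).mem_nhds (Subgroup.one_mem _)
  filter_upwards [h] with g hg
  rw [genericFun, superdiagonalSum_eq]
  refine hψ _ (ball_anti ?_ (superdiagonalSum_mem_ball hg.1))
  omega

theorem inf_rodierGroup_le_succ {c : ℤ} {m : ℕ} :
    unipotentInMirabolic n F ⊓ rodierGroup n F c m ≤ rodierGroup n F c (m + 1) := by
  rintro u ⟨hu, hum⟩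
  refine mem_rodierGroup_of_unipotent (by omega) hu fun i j hij => ?_
  refine ball_anti ?_ (entry_mem_ball_of_mem_rodierGroup hum hij.ne)
  have : (i : ℤ) + 1 ≤ j := by exact_mod_cast hij
  push_cast
  nlinarith

theorem exists_mem_rodierGroup_of_unipotent {u : mirabolic n F} (c : ℤ)
    (hu : u ∈ unipotentInMirabolic n F) : ∃ m₀ : ℕ, ∀ m ≥ m₀, u ∈ rodierGroup n F c m := by
  obtain ⟨b, hb⟩ := exists_forall_mem_ball fun q : Fin n × Fin n => u.val.val q.1 q.2
  refine ⟨(c - b).toNat + c.natAbs + 1, fun m hm => mem_rodierGroup_of_unipotent (by omega) hu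
    fun i j hij => hb (i, j) _ ?_⟩
  have h1 : (i : ℤ) + 1 ≤ j := by exact_mod_cast hij
  have h2 : (0 : ℤ) ≤ 2 * m - c := by omega
  have h3 : (c : ℤ) - b ≤ m := by omega
  nlinarith

/-- Consecutive Rodier groups are so close that each lies in the order attached to the other. -/
theorem lattice_succ_le {c : ℤ} {m : ℕ} (hm : 2 * n ≤ m) :
    lattice n F (2 * (m + 1 : ℕ) - c) (m + 1 : ℕ) ≤ lattice n F (2 * m - c) 0 := by
  intro X hX i j
  refine ball_anti ?_ (hX i j)
  have h1 : (j : ℤ) < n := by exact_mod_cast j.2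
  have h2 : (0 : ℤ) ≤ i := by positivity
  push_cast
  nlinarith

theorem lattice_le_succ {c : ℤ} {m : ℕ} (hm : 2 * n ≤ m) :
    lattice n F (2 * m - c) m ≤ lattice n F (2 * (m + 1 : ℕ) - c) 0 := by
  intro X hX i j
  refine ball_anti ?_ (hX i j)
  have h1 : (i : ℤ) < n := by exact_mod_cast i.2
  have h2 : (0 : ℤ) ≤ j := by positivity
  push_cast
  nlinarith

theorem mem_order_of_sub {d d' m : ℤ} (h : lattice n F d m ≤ lattice n F d' 0)
    {X : Matrix (Fin n) (Fin n) F} (hX : X - 1 ∈ lattice n F d m) : X ∈ lattice n F d' 0 := by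
  have := (lattice n F d' 0).add_mem (h hX) (one_mem_lattice d')
  simpa using this

theorem exists_unipotent_left {c : ℤ} {m : ℕ} (hm : 2 * n ≤ m) (hm1 : 1 ≤ m) {h : mirabolic n F}
    (hh : h ∈ rodierGroup n F c (m + 1)) :
    ∃ u ∈ unipotentInMirabolic n F ⊓ rodierGroup n F c (m + 1), u⁻¹ * h ∈ rodierGroup n F c m := by
  set X := h.val.val - 1 with hX
  obtain ⟨u, hu, huN⟩ := exists_unipotent (U := upperPart X) fun i j => upperPart_of_le X
  have hum : u ∈ rodierGroup n F c (m + 1) := by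
    refine mem_rodierGroup_of_unipotent (by omega) huN fun i j hij => ?_
    rw [hu, Matrix.add_apply, Matrix.one_apply_ne hij.ne, zero_add, upperPart_of_lt X hij]
    exact hh.1 i j
  refine ⟨u, ⟨huN, hum⟩, (mem_rodierGroup_iff hm1).mpr ?_⟩
  have h1 : (u⁻¹ * h).val.val - 1 = u⁻¹.val.val * (X - upperPart X) := by
    have : X - upperPart X = h.val.val - u.val.val := by
      rw [hu, hX]
      abel
    rw [this, mul_sub, Subgroup.coe_mul, Units.val_mul, Subgroup.coe_inv, Units.inv_mul]
  rw [h1]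
  refine mul_mem_lattice (m := 0) (mem_order_of_sub (lattice_succ_le hm) hum.2) ?_ (zero_add _).ge
  intro i j
  rw [Matrix.sub_apply]
  rcases lt_or_ge i j with hij | hij
  · rw [upperPart_of_lt X hij, sub_self]
    exact (ball F _).zero_mem
  · rw [upperPart_of_le X hij, sub_zero]
    refine ball_anti ?_ (hh.1 i j)
    have h2 : (j : ℤ) ≤ i := by exact_mod_cast hij
    push_cast
    nlinarith

theorem mul_mem_rodierGroup_succ {c : ℤ} {m : ℕ} (hm : 2 * n ≤ m) {u h : mirabolic n F}
    (hu : u ∈ unipotentInMirabolic n F) (hh : h ∈ rodierGroup n F c (m + 1))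
    (huh : u * h ∈ rodierGroup n F c m) : u * h ∈ rodierGroup n F c (m + 1) := by
  refine Subgroup.mul_mem _ (mem_rodierGroup_of_unipotent (by omega) hu fun i j hij => ?_) hh
  have h1 : u.val.val = (u * h).val.val + (u * h).val.val * (h⁻¹.val.val - 1) := by
    rw [mul_sub, mul_one, add_sub_cancel, ← Units.val_mul, ← Subgroup.coe_mul, mul_inv_cancel_right]
  rw [h1, Matrix.add_apply]
  refine (ball F _).add_mem (ball_anti ?_ (entry_mem_ball_of_mem_rodierGroup huh hij.ne))
    (mul_mem_lattice (mem_order_of_sub (lattice_le_succ hm) huh.1) hh.2 (zero_add _).ge i j)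
  have : (i : ℤ) + 1 ≤ j := by exact_mod_cast hij
  push_cast
  nlinarith

/-- For large `m`, the elements of `rodierGroup n F c m` are products of a unipotent element of
this group and an element close to `1`. -/
theorem eventually_exists_small {c : ℤ} {m₀ : ℕ} (hm₀ : 2 * n ≤ m₀) (hm1 : 1 ≤ m₀) (hc : c ≤ m₀)
    {O : Set (mirabolic n F)} (hO : O ∈ 𝓝 (1 : mirabolic n F)) :
    ∀ᶠ s : ℕ in atTop, ∀ h ∈ rodierGroup n F c (m₀ + s),
      ∃ u ∈ unipotentInMirabolic n F ⊓ rodierGroup n F c (m₀ + s), u⁻¹ * h ∈ O := by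
  have hmono : ∀ s t : ℕ, s ≤ t → unipotentInMirabolic n F ⊓ rodierGroup n F c (m₀ + s) ≤
      rodierGroup n F c (m₀ + t) := by
    intro s t hst
    induction t, hst using Nat.le_induction with
    | base => exact inf_le_right
    | succ t _ ih => exact fun u hu => inf_rodierGroup_le_succ ⟨hu.1, ih hu⟩
  -- Modulo unipotent elements, `h` can be moved into all the preceding groups.
  have hall : ∀ s : ℕ, ∀ h ∈ rodierGroup n F c (m₀ + s),
      ∃ u ∈ unipotentInMirabolic n F ⊓ rodierGroup n F c (m₀ + s),
        ∀ t ≤ s, u⁻¹ * h ∈ rodierGroup n F c (m₀ + t) := by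
    intro s
    induction s with
    | zero =>
      intro h hh
      refine ⟨1, Subgroup.one_mem _, fun t ht => ?_⟩
      obtain rfl : t = 0 := by omega
      simpa using hh
    | succ s ih =>
      intro h hh
      obtain ⟨u, hu, huh⟩ := exists_unipotent_left (m := m₀ + s) (by omega) (by omega) hh
      obtain ⟨u', hu', h'⟩ := ih _ huh
      have hu'1 : u' ∈ rodierGroup n F c (m₀ + (s + 1)) := inf_rodierGroup_le_succ hu'
      refine ⟨u * u', ⟨Subgroup.mul_mem _ hu.1 hu'.1, Subgroup.mul_mem _ hu.2 hu'1⟩,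
        fun t ht => ?_⟩
      rw [_root_.mul_inv_rev, mul_assoc]
      rcases Nat.lt_or_ge t (s + 1) with hlt | hge
      · exact h' t (by omega)
      · obtain rfl : t = s + 1 := by omega
        exact Subgroup.mul_mem _ (Subgroup.inv_mem _ hu'1)
          (Subgroup.mul_mem _ (Subgroup.inv_mem _ hu.2) hh)
  obtain ⟨M, hM, hM1⟩ := ((eventually_congruence_mirabolic 0 hO).and (eventually_ge_atTop 1)).exists
  filter_upwards [eventually_ge_atTop (M + ((2 * m₀ - c) * n).toNat)] with s hs h hh
  obtain ⟨u, hu, hb⟩ := hall s h hh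
  set b := u⁻¹ * h with hbdef
  set X := b.val.val - 1 with hX
  obtain ⟨w, hw, hwN⟩ := exists_unipotent (U := upperPart X) fun i j => upperPart_of_le X
  have hw0 : w ∈ rodierGroup n F c (m₀ + 0) := by
    refine mem_rodierGroup_of_unipotent (by omega) hwN fun i j hij => ?_
    rw [hw, Matrix.add_apply, Matrix.one_apply_ne hij.ne, zero_add, upperPart_of_lt X hij]
    exact (hb 0 (by omega)).1 i j
  refine ⟨u * w, ⟨Subgroup.mul_mem _ hu.1 hwN,
    Subgroup.mul_mem _ hu.2 (hmono 0 s (by omega) ⟨hwN, hw0⟩)⟩, ?_⟩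
  rw [_root_.mul_inv_rev, mul_assoc, ← hbdef]
  refine hM _ ((mem_congruence_iff hM1).mpr ?_)
  have h1 : (w⁻¹ * b).val.val - 1 = w⁻¹.val.val * (X - upperPart X) := by
    have : X - upperPart X = b.val.val - w.val.val := by
      rw [hw, hX]
      abel
    rw [this, mul_sub, Subgroup.coe_mul, Units.val_mul, Subgroup.coe_inv, Units.inv_mul]
  change (w⁻¹ * b).val.val - 1 ∈ _
  rw [h1]
  intro i j
  rw [Matrix.mul_apply]
  refine sum_mem fun l _ => ?_
  rw [Matrix.sub_apply]
  rcases lt_or_ge l j with hlj | hlj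
  · rw [upperPart_of_lt X hlj, sub_self, mul_zero]
    exact (ball F _).zero_mem
  · rw [upperPart_of_le X hlj, sub_zero]
    refine mul_mem_ball (mem_lattice_zero_of_sub (by omega) hw0.2 i l) ((hb s le_rfl).1 l j) ?_
    have h2 : (j : ℤ) ≤ l := by exact_mod_cast hlj
    have h3 : (l : ℤ) < n := by exact_mod_cast l.2
    have h4 : (0 : ℤ) ≤ i := by positivity
    have h5 : (0 : ℤ) ≤ 2 * m₀ - c := by omega
    have h6 : (M : ℤ) + (2 * m₀ - c) * n ≤ s := by omega
    push_cast
    have h7 : (0 : ℤ) ≤ (2 * (m₀ + s) - c) * ((l : ℤ) - j) := mul_nonneg (by omega) (by omega)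
    have h8 : (2 * m₀ - c) * ((l : ℤ) - i) ≤ (2 * m₀ - c) * n :=
      mul_le_mul_of_nonneg_left (by omega) h5
    nlinarith

end RodierGroups

end WhittakerFamily

/-! ### The action of unipotent elements and intertwining -/

namespace WhittakerFamily

open Filter Topology ValuativeRel Matrix

section Mackey

variable {n : ℕ} {F : Type*} [Field F] [ValuativeRel F] [TopologicalSpace F]
  [IsNonarchimedeanLocalField F]

theorem single_mem_lattice {d m : ℤ} {l k : Fin n} {x : F}
    (hx : x ∈ ball F (m + d * ((l : ℤ) - k))) : Matrix.single l k x ∈ lattice n F d m := by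
  intro i j
  rw [Matrix.single_apply]
  split_ifs with h
  · obtain ⟨rfl, rfl⟩ := h
    exact hx
  · exact (ball F _).zero_mem

theorem conj_mem_rodierGroup {c : ℤ} {m : ℕ} (hm : 2 * n ≤ m) (hm1 : 1 ≤ m)
    {u y : mirabolic n F} (hu : u ∈ rodierGroup n F c (m + 1)) (hy : y ∈ rodierGroup n F c m) :
    u⁻¹ * y * u ∈ rodierGroup n F c m := by
  rw [mem_rodierGroup_iff hm1]
  have h1 : (u⁻¹ * y * u).val.val - 1 = u⁻¹.val.val * (y.val.val - 1) * u.val.val := by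
    rw [mul_sub, sub_mul, mul_one, ← Units.val_mul, ← Units.val_mul, ← Units.val_mul,
      ← Subgroup.coe_mul, ← Subgroup.coe_mul, ← Subgroup.coe_mul, inv_mul_cancel]
    rfl
  rw [h1]
  exact mul_mem_lattice (mul_mem_lattice (mem_order_of_sub (lattice_succ_le hm) hu.2) hy.1
    (zero_add _).ge) (mem_order_of_sub (lattice_succ_le hm) hu.1) (add_zero _).ge

variable {R : Type*} [CommRing R] {ψ : AddChar F R} {c : ℤ}

/-- A unipotent element of `rodierGroup n F c (m + 1)` that fixes the character of
`rodierGroup n F c m` lies in the latter group. -/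
theorem mem_rodierGroup_of_forall_conj (hψ : IsConductor ψ c) {m : ℕ} (hm : 2 * n ≤ m)
    (hm1 : 1 ≤ m) {u : mirabolic n F}
    (hu : u ∈ unipotentInMirabolic n F ⊓ rodierGroup n F c (m + 1))
    (h : ∀ y ∈ rodierGroup n F c m,
      ψ (superdiagonalSum (u⁻¹ * y * u).val.val - superdiagonalSum y.val.val) = 1) :
    u ∈ rodierGroup n F c m := by
  have hu0 : u.val.val ∈ lattice n F (2 * m - c) 0 :=
    mem_order_of_sub (lattice_succ_le hm) hu.2.1
  -- The elements `y = 1 + u * E` with `E` elementary are tested, so that `u⁻¹ * y * u = 1 + E * u`.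
  have key : ∀ (k l : Fin n) (hkl : k ≤ l) (hl : (l : ℕ) + 1 < n),
      ∀ x ∈ ball F (m + (2 * m - c) * ((l : ℤ) - k)),
        ψ (superdiagonalSum (Matrix.single l k x * u.val.val) -
          superdiagonalSum (u.val.val * Matrix.single l k x)) = 1 := by
    intro k l hkl hl x hx
    have hX : u.val.val * Matrix.single l k x ∈ lattice n F (2 * m - c) m :=
      mul_mem_lattice hu0 (single_mem_lattice hx) (zero_add _).ge
    obtain ⟨y, hy, hyX⟩ := exists_mem_rodierGroup hm1 hX fun i j hi => by
      rcases eq_or_ne j k with rfl | hj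
      · have hil : i ≠ l := by
          rintro rfl
          omega
        rw [Matrix.mul_single_apply_same, u.2 i l hi, Matrix.one_apply_ne hil, zero_mul]
      · exact Matrix.mul_single_apply_of_ne _ _ _ _ _ hj _
    have h1 := h y hy
    have h2 : (u⁻¹ * y * u).val.val = 1 + Matrix.single l k x * u.val.val := by
      rw [Subgroup.coe_mul, Subgroup.coe_mul, Units.val_mul, Units.val_mul, hyX, mul_add, mul_one,
        ← mul_assoc, ← Units.val_mul u⁻¹.val u.val, ← Subgroup.coe_mul, inv_mul_cancel, add_mul,
        ← Units.val_mul u⁻¹.val u.val, ← Subgroup.coe_mul, inv_mul_cancel]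
      simp
    rwa [h2, hyX, superdiagonalSum_add, superdiagonalSum_add, add_sub_add_left_eq_sub] at h1
  have main : ∀ (t : ℕ) (i j : Fin n), (i : ℕ) = t → i < j →
      u.val.val i j ∈ ball F (m + (2 * m - c) * ((i : ℤ) - j)) := by
    intro t
    induction t with
    | zero =>
      intro i j hi hij
      obtain ⟨l, hl, rfl⟩ : ∃ (l : Fin n) (hl : (l : ℕ) + 1 < n), j = ⟨l + 1, hl⟩ :=
        ⟨⟨j - 1, by omega⟩, by simp only; omega, Fin.ext (by simp only; omega)⟩
      refine hψ.mem_ball (a := m + (2 * m - c) * ((l : ℤ) - i)) ?_ fun x hx => ?_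
      · push_cast
        nlinarith
      · have := key i l (Fin.le_def.mpr (by omega)) hl x hx
        rwa [superdiagonalSum_single_mul _ _ hl, superdiagonalSum_mul_single_zero _ _ hi, sub_zero,
          mul_comm] at this
    | succ t ih =>
      intro i j hi hij
      have hij' : (i : ℕ) < j := hij
      obtain ⟨l, hl, rfl⟩ : ∃ (l : Fin n) (hl : (l : ℕ) + 1 < n), j = ⟨l + 1, hl⟩ :=
        ⟨⟨j - 1, by omega⟩, by simp only; omega, Fin.ext (by simp only; omega)⟩
      obtain ⟨q, hq, rfl⟩ : ∃ (q : Fin n) (hq : (q : ℕ) + 1 < n), i = ⟨q + 1, hq⟩ :=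
        ⟨⟨t, by omega⟩, by simp only; omega, Fin.ext (by simp only; omega)⟩
      simp only at hi hij'
      have h1 := ih q l (by omega) (Fin.lt_def.mpr (by omega))
      rw [← sub_add_cancel (u.val.val _ _) (u.val.val q l)]
      refine (ball F _).add_mem ?_ (ball_anti (by push_cast; apply le_of_eq; ring) h1)
      refine hψ.mem_ball (a := m + (2 * m - c) * ((l : ℤ) - (q + 1))) ?_ fun x hx => ?_
      · push_cast
        nlinarith
      · have := key ⟨q + 1, hq⟩ l (Fin.le_def.mpr (by simp only; omega)) hl x
          (by push_cast; exact hx)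
        rwa [superdiagonalSum_single_mul _ _ hl, superdiagonalSum_mul_single_succ _ _ hq,
          mul_comm x, ← sub_mul] at this
  exact mem_rodierGroup_of_unipotent hm1 hu.1 fun i j hij => main i i j rfl hij

omit [ValuativeRel F] [TopologicalSpace F] [IsNonarchimedeanLocalField F] in
theorem isCharOn_unipotentInMirabolic (ψ : AddChar F R) :
    IsCharOn (genericFun ψ) (unipotentInMirabolic n F) where
  map_one := (genericCharMirabolic ψ).map_one
  map_mul a ha b hb := (genericCharMirabolic ψ).map_mul ⟨a, ha⟩ ⟨b, hb⟩

/-- An element `g` that intertwines the generic characters of `N_n` and of a Rodier group `H` lies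
in `N_n * H`. The induction is on the number `t` of rows in which `g` may differ from `1`: the
intertwining property bounds the last of these rows, which is then cleared by an element of `N_n`
on the left and an element of `H` on the right. -/
theorem exists_eq_mul_of_forall_conj (hψ : IsConductor ψ c) {m : ℕ} (hm1 : 1 ≤ m) (t : ℕ) :
    t < n → ∀ g : mirabolic n F,
    (∀ i j : Fin n, t ≤ i → g.val.val i j = (1 : Matrix (Fin n) (Fin n) F) i j) →
    (∀ h ∈ rodierGroup n F c m, g * h * g⁻¹ ∈ unipotentInMirabolic n F →
      genericFun ψ (g * h * g⁻¹) = genericFun ψ h) →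
    ∃ u ∈ unipotentInMirabolic n F, ∃ h ∈ rodierGroup n F c m, g = u * h := by
  induction t with
  | zero =>
    intro _ g hg _
    refine ⟨1, Subgroup.one_mem _, 1, Subgroup.one_mem _, ?_⟩
    rw [mul_one]
    exact Subtype.ext (Units.ext (Matrix.ext fun i j => hg i j (Nat.zero_le _)))
  | succ t ih =>
    intro ht g hg hint
    set k : Fin n := ⟨t, by omega⟩ with hk
    have hkv : (k : ℕ) = t := rfl
    have hk1 : (k : ℕ) + 1 < n := ht
    -- Conjugates of elementary matrices with entry in column `k + 1` control row `k` of `g`.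
    have hrow : ∀ i : Fin n, i ≤ k →
        (g.val.val - 1) k i ∈ ball F (m + (2 * m - c) * ((k : ℤ) - i)) := by
      intro i hik
      have hik' : (i : ℕ) ≤ k := hik
      refine hψ.mem_ball (a := m + (2 * m - c) * ((i : ℤ) - (k + 1))) (by nlinarith)
        fun x hx => ?_
      set E : Matrix (Fin n) (Fin n) F := Matrix.single i ⟨k + 1, hk1⟩ x with hE
      obtain ⟨h, hh, hhE⟩ := exists_mem_rodierGroup hm1
        (single_mem_lattice (l := i) (k := ⟨k + 1, hk1⟩) (x := x) (d := 2 * m - c) (m := m)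
          (by push_cast; exact hx))
        fun a b ha => Matrix.single_apply_of_row_ne (fun e : i = a => by
          subst e
          omega) _ _ _
      rw [← hE] at hhE
      have h1 : E * g.val.val = E := by
        ext a b
        rcases eq_or_ne a i with rfl | ha
        · rw [hE, Matrix.single_mul_apply_same, hg _ _ (by simp only; omega), Matrix.single_apply,
            Matrix.one_apply]
          simp
        · rw [hE, Matrix.single_mul_apply_of_ne _ _ _ _ _ ha,
            Matrix.single_apply_of_row_ne ha.symm]
      have h2 : (g * h * g⁻¹).val.val = 1 + g.val.val * E := by
        have h3 : (g * h * g⁻¹).val.val * g.val.val = (1 + g.val.val * E) * g.val.val := by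
          rw [← Units.val_mul, ← Subgroup.coe_mul, inv_mul_cancel_right, Subgroup.coe_mul,
            Units.val_mul, hhE, add_mul, mul_assoc, h1, mul_add, mul_one, one_mul]
        exact (Units.isUnit g.val).mul_right_cancel h3
      have hN : g * h * g⁻¹ ∈ unipotentInMirabolic n F := by
        intro a b hab
        change (g * h * g⁻¹).val.val a b = _
        have hab' : (b : ℕ) ≤ a := hab
        rw [h2, Matrix.add_apply, add_eq_left]
        rcases eq_or_ne b ⟨k + 1, hk1⟩ with rfl | hb
        · simp only at hab'
          rw [Matrix.mul_single_apply_same, hg a i (by omega), Matrix.one_apply_ne, zero_mul]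
          rintro rfl
          omega
        · exact Matrix.mul_single_apply_of_ne _ _ _ _ _ hb _
      have h4 := hint h hh hN
      have hx1 : superdiagonalSum (g * h * g⁻¹).val.val =
          (g.val.val - 1) k i * x + superdiagonalSum h.val.val := by
        rw [h2, hhE, superdiagonalSum_add, superdiagonalSum_add, superdiagonalSum_one,
          superdiagonalSum_mul_single_succ, ← one_mul E, superdiagonalSum_mul_single_succ,
          Matrix.sub_apply]
        ring
      rw [genericFun, genericFun, hx1, AddChar.map_add_eq_mul] at h4
      have h5 : IsUnit (ψ (superdiagonalSum h.val.val)) := ψ.val_isUnit _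
      exact h5.mul_right_cancel (h4.trans (one_mul _).symm)
    obtain ⟨y, hy, hyY⟩ := exists_mem_rodierGroup (c := c) (m := m) (n := n) (F := F) hm1
      (X := Matrix.of fun a b => if a = k ∧ b ≤ k then (g.val.val - 1) a b else 0) (by
        intro a b
        rw [Matrix.of_apply]
        split_ifs with hab
        · obtain ⟨rfl, hb⟩ := hab
          exact hrow b hb
        · exact (ball F _).zero_mem) (by
        intro a b ha
        refine if_neg ?_
        rintro ⟨rfl, -⟩
        omega)
    obtain ⟨u, huU, hu⟩ := exists_unipotent (F := F)
      (U := Matrix.of fun a b : Fin n => if a = k ∧ k < b then -g.val.val a b else 0) (by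
        intro a b hab
        refine if_neg ?_
        rintro ⟨rfl, hb⟩
        exact absurd hab (not_le.mpr hb))
    have hrows : ∀ a b : Fin n, t ≤ a → (u.val.val * g.val.val) a b = y.val.val a b := by
      intro a b ha
      rw [huU, hyY, add_mul, one_mul, Matrix.add_apply, Matrix.add_apply, Matrix.of_apply,
        Matrix.mul_apply]
      rcases eq_or_ne a k with rfl | hak
      · have h1 : ∀ l : Fin n, (Matrix.of fun a' b' : Fin n =>
            if a' = k ∧ k < b' then -g.val.val a' b' else 0) k l * g.val.val l b =
            if k < l then -g.val.val k l * (1 : Matrix (Fin n) (Fin n) F) l b else 0 := by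
          intro l
          rw [Matrix.of_apply]
          by_cases hl : k < l
          · have hl' : (k : ℕ) < l := hl
            rw [if_pos ⟨rfl, hl⟩, if_pos hl, hg l b (by omega)]
          · rw [if_neg (fun h => hl h.2), if_neg hl, zero_mul]
        rw [Finset.sum_congr rfl fun l _ => h1 l, Finset.sum_eq_single b]
        · by_cases hb : b ≤ k
          · rw [if_neg (not_lt.mpr hb), if_pos ⟨rfl, hb⟩, Matrix.sub_apply]
            ring
          · rw [if_pos (not_le.mp hb), if_neg (fun h => hb h.2), Matrix.one_apply_eq,
              Matrix.one_apply_ne (not_le.mp hb).ne]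
            ring
        · intro l _ hl
          split_ifs
          · rw [Matrix.one_apply_ne hl, mul_zero]
          · rfl
        · simp
      · have hak' : (a : ℕ) ≠ t := fun h => hak (Fin.ext h)
        rw [if_neg (fun h => hak h.1), hg a b (by omega), add_eq_left.mpr]
        · rw [add_zero]
        · refine Finset.sum_eq_zero fun l _ => ?_
          rw [Matrix.of_apply, if_neg (fun h => hak h.1), zero_mul]
    obtain ⟨u', hu', h', hh', e⟩ := ih (by omega) (u * g * y⁻¹) (by
      intro i j hi
      rw [Subgroup.coe_mul, Subgroup.coe_mul, Units.val_mul, Units.val_mul, Matrix.mul_apply,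
        Finset.sum_congr rfl fun l _ => by rw [hrows i l hi], ← Matrix.mul_apply,
        ← Units.val_mul, ← Subgroup.coe_mul, mul_inv_cancel]
      rfl) (by
      intro h hh hN
      have e1 : u * g * y⁻¹ * h * (u * g * y⁻¹)⁻¹ =
          (u⁻¹)⁻¹ * (g * (y⁻¹ * h * y) * g⁻¹) * u⁻¹ := by group
      rw [e1] at hN ⊢
      have hu1 := Subgroup.inv_mem _ hu
      have hN' : g * (y⁻¹ * h * y) * g⁻¹ ∈ unipotentInMirabolic n F := by
        have := Subgroup.mul_mem _ (Subgroup.mul_mem _ hu1 hN) hu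
        convert this using 1
        group
      rw [(isCharOn_unipotentInMirabolic ψ).conj hN' hu1,
        hint _ (Subgroup.mul_mem _ (Subgroup.mul_mem _ (Subgroup.inv_mem _ hy) hh) hy) hN',
        (isCharOn_rodierGroup hψ.eq_one m).conj hh hy])
    refine ⟨u⁻¹ * u', Subgroup.mul_mem _ (Subgroup.inv_mem _ hu) hu', h' * y,
      Subgroup.mul_mem _ hh' hy, ?_⟩
    have : u⁻¹ * u' * (h' * y) = u⁻¹ * (u' * h') * y := by group
    rw [this, ← e]
    group

end Mackey

end WhittakerFamily

/-! ### Characters with values in Witt vectors -/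

namespace WhittakerFamily

open Filter Topology ValuativeRel Matrix

section Witt

variable {ℓ : ℕ} [Fact ℓ.Prime] {k : Type*} [Field k] [CharP k ℓ]

theorem isUnit_natCast_wittVector {p : ℕ} (hp : p.Prime) (h : ℓ ≠ p) :
    IsUnit (p : WittVector ℓ k) := by
  refine WittVector.isUnit_of_coeff_zero_ne_zero _ ?_
  have h1 : (p : WittVector ℓ k).coeff 0 = (p : k) :=
    map_natCast (WittVector.constantCoeff : WittVector ℓ k →+* k) p
  rw [h1, Ne, CharP.cast_eq_zero_iff k ℓ, Nat.prime_dvd_prime_iff_eq Fact.out hp]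
  exact h

/-- A root of unity `ζ ≠ 1` of order prime to `ℓ` in the domain `W(k)` stays different from `1`
modulo `ℓ`: if `ζ ≡ 1` then `0 = 1 + ζ + ⋯ + ζ ^ (q - 1) ≡ q`. -/
theorem isUnit_sub_one_of_pow_eq_one {q : ℕ} (hq : IsUnit (q : WittVector ℓ k))
    {ζ : WittVector ℓ k} (hζ : ζ ^ q = 1) (h1 : ζ ≠ 1) : IsUnit (ζ - 1) := by
  refine WittVector.isUnit_of_coeff_zero_ne_zero _ fun h0 => ?_
  let r : WittVector ℓ k →+* k := WittVector.constantCoeff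
  have h2 : r ζ = 1 := by
    have : r (ζ - 1) = 0 := h0
    rwa [map_sub, map_one, sub_eq_zero] at this
  have h3 : ∑ i ∈ Finset.range q, ζ ^ i = 0 := by
    have := geom_sum_mul ζ q
    rw [hζ, sub_self] at this
    exact (mul_eq_zero.mp this).resolve_right (sub_ne_zero.mpr h1)
  have h4 := congrArg r h3
  rw [map_sum, map_zero] at h4
  simp only [map_pow, h2, one_pow, Finset.sum_const, Finset.card_range, nsmul_eq_mul,
    mul_one] at h4
  refine (hq.map r).ne_zero ?_
  rw [map_natCast, h4]

variable {n : ℕ} {F : Type*} [Field F] [ValuativeRel F] [TopologicalSpace F]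
  [IsNonarchimedeanLocalField F]

/-- The values of `ψ` are roots of unity of `p`-power order, hence distinct values differ by a
unit. -/
theorem IsConductor.isUnit_sub {ψ : AddChar F (WittVector ℓ k)} {c : ℤ} (hψ : IsConductor ψ c)
    (hp : IsUnit ((ringChar 𝓀[F] : ℕ) : WittVector ℓ k)) {x y : F} (h : ψ x ≠ ψ y) :
    IsUnit (ψ x - ψ y) := by
  have hxy : ψ x = ψ (x - y) * ψ y := by rw [← AddChar.map_add_eq_mul, sub_add_cancel]
  rw [hxy, ← sub_one_mul]
  refine IsUnit.mul ?_ (ψ.val_isUnit y)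
  obtain ⟨a, ha⟩ := exists_mem_ball (x - y)
  have hpow : ∀ j : ℕ, ((ringChar 𝓀[F] : ℕ) : F) ^ j * (x - y) ∈ ball F (j + a) := by
    intro j
    induction j with
    | zero => simpa using ha
    | succ j ih =>
      rw [pow_succ', mul_assoc]
      exact mul_mem_ball ringChar_mem_ball ih (by push_cast; omega)
  refine isUnit_sub_one_of_pow_eq_one (q := ringChar 𝓀[F] ^ (c - a).toNat)
    (by push_cast; exact hp.pow _) ?_ fun h1 => h (by rw [hxy, h1, one_mul])
  rw [← AddChar.map_nsmul_eq_pow, nsmul_eq_mul]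
  push_cast
  exact hψ.eq_one _ (ball_anti (by omega) (hpow _))

variable (n) in
/-- Rodier's groups form a Rodier tower for the generic character of `N_n`. -/
theorem isRodierTower_rodierGroup (hn : 1 ≤ n) (hℓ : ℓ ≠ ringChar 𝓀[F])
    {ψ : AddChar F (WittVector ℓ k)} {c : ℤ} (hψ : IsConductor ψ c)
    (A : Type*) [CommRing A] [Algebra (WittVector ℓ k) A] :
    IsRodierTower (ringChar 𝓀[F]) (unipotentInMirabolic n F)
      (genericCharMirabolic (extendScalars A ψ)) (genericFun (extendScalars A ψ))
      fun s => rodierGroup n F c (2 * n + c.natAbs + s) := by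
  have hp : IsUnit ((ringChar 𝓀[F] : ℕ) : WittVector ℓ k) :=
    isUnit_natCast_wittVector prime_ringChar hℓ
  have hψA : ∀ x ∈ ball F c, extendScalars A ψ x = 1 := fun x hx => by
    change algebraMap _ A (ψ x) = 1
    rw [hψ.eq_one x hx, map_one]
  have hunit : ∀ g h : mirabolic n F, genericFun ψ g ≠ genericFun ψ h →
      IsUnit (genericFun (extendScalars A ψ) g - genericFun (extendScalars A ψ) h) := by
    intro g h hgh
    have := (hψ.isUnit_sub hp hgh).map (algebraMap (WittVector ℓ k) A)
    rwa [map_sub] at this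
  exact {
    prime := prime_ringChar
    isUnit := by
      have := hp.map (algebraMap (WittVector ℓ k) A)
      rwa [map_natCast] at this
    isCharOn := fun s => isCharOn_rodierGroup hψA _
    apply_coe := fun _ => rfl
    eventually_one := eventually_genericFun_eq_one hψA
    isClosed := isClosed_unipotentInMirabolic
    isOpen := fun s => isOpen_rodierGroup c _
    isCompact := fun s => isCompact_rodierGroup c _
    pow_mem := fun s h hh O hO => exists_pow_mem (by omega) hh hO
    inf_le_succ := fun s => inf_rodierGroup_le_succ
    exists_mem := fun u hu => by
      obtain ⟨m, hm⟩ := exists_mem_rodierGroup_of_unipotent c hu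
      exact ⟨m, hm _ (by omega)⟩
    exists_left := fun s h hh => exists_unipotent_left (m := 2 * n + c.natAbs + s)
      (by omega) (by omega) hh
    exists_small := fun O hO => eventually_exists_small (by omega) (by omega) (by omega) hO
    mul_mem_succ := fun s u hu h hh huh => mul_mem_rodierGroup_succ
      (m := 2 * n + c.natAbs + s) (by omega) hu hh huh
    conj := fun s u hu hus => by
      refine ⟨fun y hy => conj_mem_rodierGroup (by omega) (by omega) hu.2 hy, ?_⟩
      by_contra! hall
      refine hus (mem_rodierGroup_of_forall_conj hψ (by omega) (by omega) hu fun y hy => ?_)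
      have h1 : genericFun ψ (u⁻¹ * y * u) = genericFun ψ y := by
        by_contra h
        exact hall y hy (hunit _ _ h)
      refine (ψ.val_isUnit (superdiagonalSum y.val.val)).mul_right_cancel ?_
      rw [← AddChar.map_add_eq_mul, sub_add_cancel, one_mul]
      exact h1
    intertwine := fun s g hg => by
      by_contra! hall
      obtain ⟨u, hu, h, hh, e⟩ := exists_eq_mul_of_forall_conj hψ (m := 2 * n + c.natAbs + s)
        (by omega) (n - 1) (by omega) g (fun i j hi => g.2 i j (by omega)) fun h hh hN => by
          by_contra hne
          exact hall h hh hN (hunit _ _ hne)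
      exact hg u hu h hh e }

end Witt

end WhittakerFamily

open WhittakerFamily ValuativeRel in
/-- The Whittaker space of `V` is formed with an arbitrary isomorphism `e : V^{(n)} ≃ A`; `ψ_A`
is `extendScalars A ψ`. -/
theorem proposition3p1
    (n : ℕ) (hn : 1 ≤ n)
    {F : Type*} [Field F] [ValuativeRel F] [TopologicalSpace F] [IsNonarchimedeanLocalField F]
    (ℓ : ℕ) [Fact ℓ.Prime] {k : Type*} [Field k] [IsAlgClosed k] [CharP k ℓ]
    (hℓ : ℓ ≠ ringChar 𝓀[F])
    (ψ : AddChar F (WittVector ℓ k)) (hψ : ψ ≠ 1) (hψ' : IsLocallyConstant ψ)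
    {A : Type*} [CommRing A] [IsNoetherianRing A] [Algebra (WittVector ℓ k) A]
    {V : Type*} [AddCommGroup V] [Module A V] (ρ : Representation A (GL (Fin n) F) V)
    (hV : IsWhittakerType ρ (extendScalars A ψ))
    (e : TopDerivative (resMirabolic ρ) (extendScalars A ψ) ≃ₗ[A] A) :
    Function.Bijective (algebraMap A
      ((whittakerRep ρ (extendScalars A ψ) e).IntertwiningMap
        (whittakerRep ρ (extendScalars A ψ) e))) ∧
    (∃! S : Subrepresentation (resMirabolic (whittakerRep ρ (extendScalars A ψ) e)),
      IsSchwartzSpace (extendScalars A ψ) S) ∧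
    ∀ S : Subrepresentation (resMirabolic (whittakerRep ρ (extendScalars A ψ) e)),
      IsSchwartzSpace (extendScalars A ψ) S →
      ∃ res : (whittakerRep ρ (extendScalars A ψ) e).IntertwiningMap
            (whittakerRep ρ (extendScalars A ψ) e) ≃ₐ[A]
          S.toRepresentation.IntertwiningMap S.toRepresentation,
        ∀ φ (s : S.toSubmodule), (res φ s).val = φ s.val := by
  obtain ⟨c, hc⟩ := exists_isConductor hψ hψ'
  exact whittaker_of_isRodierTower (isRodierTower_rodierGroup n hn hℓ hc A) hV.admissible.smooth
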